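/- Let $M$ be a smooth manifold and $\Delta\subset TM$ a smooth distribution (vector subbundle). Put $\Delta_0=0$, $\Delta_1=\Delta$, and let $\Delta_{i+1}$ be spanned by $\Delta_i$ and the brackets $[\Gamma(\Delta),\Gamma(\Delta_i)]$ of local sections (the weak derived flag). Assume that all $\Delta_i$ have constant rank and that $\Delta_\kappa=TM$ for some $\kappa$. Fix $x\in M$. Tanaka algebra. Let $\mathfrak m=\bigoplus_{p>0}\mathfrak g_{-p}$, $\mathfrak g_{-p}=(\Delta_p/\Delta_{p-1})_x$, be the graded nilpotent Lie algebra with the bracket induced by the commutator of vector fields, and define successively, for $k\ge0$, $$\mathfrak g_k=\Big\{u\in\bigoplus_{i<0}\mathfrak g_{k+i}\otimes\mathfrak g_i^*:\ u([X,Y])=[u(X),Y]+[X,u(Y)]\ \ \forall X,Y\in\mathfrak m\Big\},\qquad [u,X]:=u(X).$$ Spencer symbols. Let $\mathcal E=\{j^1_yX: L_X(\Delta_i)_y\subset(\Delta_i)_y\ \forall i>0,\ y\in M\}\subset J^1(TM)$ be the Lie equation of the weak derived flag and $\mathcal E^{(k)}\subset J^{k+1}(TM)$ its prolongations (the jets satisfying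 the equation and its derivatives up to order $k$). Over the point $x$ let $\bar{\mathcal E}_i=\bigcap_{k\ge0,\ k+1\ge i}\pi_{k+1,i}(\mathcal E^{(k)})$ be the prolongation-projection, let $\bar{\mathcal E}_\infty=\varprojlim\bar{\mathcal E}_i$ be the space of formal (infinite jet) symmetries at $x$, and let $\bar g_i=\ker(\pi_{i,i-1}:\bar{\mathcal E}_i\to\bar{\mathcal E}_{i-1})$, $i>0$. Filtrations. Let $L$ be either (a) $\bar{\mathcal E}_\infty$, or (b) the stalk at $x$ of the sheaf of smooth vector fields preserving $\Delta$. For $j\ge0$ let $L_*^j\subset L$ consist of the elements with zero $j$-jet at $x$. For $i\ge0$ let $L^i\subset L$ consist of the elements $X$ with $X_x=0$ and $[[\dots[X,Y_1],\dots],Y_r]_x=0$ for all $1\le r\le i$ and all local sections $Y_1,\dots,Y_r$ of $\Delta$. Put $\mathbf g_i=L^i/L^{i+1}$ and $$h_{ij}=\frac{L^i\cap L^j_*}{L^i\cap L^{j+1}_*+L^{i+1}\cap L^j_*}\qquad(i,j\ge0).$$ Then the infinite jet at $x$ of every element of the stalk lies in $\bar{\mathcal E}_\infty$, and in both cases (a)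 and (b): 1. For all $i,j\ge0$ there are (noncanonical) linear isomorphisms $\mathbf g_i\simeq\bigoplus_{j\le i}h_{ij}$ and $L_*^j/L_*^{j+1}\simeq\bigoplus_{i\ge j}h_{ij}$, and $h_{ij}=0$ if $i<j$ or $i\ge(j+1)\kappa$. 2. In case (a), $\bar g_{j+1}$ is the image of $L_*^j$ under the projection to $(j+1)$-jets, so that $\bar g_{j+1}=L_*^j/L_*^{j+1}\simeq\bigoplus_{i\ge j}h_{ij}$ for all $j\ge0$. 3. For every $i\ge0$ there is a linear monomorphism $\mathbf g_i\hookrightarrow\mathfrak g_i$, and there is a (noncanonical) linear monomorphism $\bigoplus_{j\ge0}L_*^j/L_*^{j+1}\hookrightarrow\bigoplus_{i\ge0}\mathfrak g_i$; in case (a) this is a monomorphism $\bigoplus_{j>0}\bar g_j\hookrightarrow\bigoplus_{i\ge0}\mathfrak g_i$. 4. Consequently $\sum_{j\ge0}\dim(L_*^j/L_*^{j+1})\le\sum_{i\ge0}\dim\mathfrak g_i$; in case (a), $\sum_{i>0}\dim\bar g_i\le\sum_{j\ge0}\dim\mathfrak g_j$. (The sums may be infinite.) -/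

import Mathlib

open scoped Manifold ContDiff Topology DirectSum

universe u

set_option linter.unusedSectionVars false

noncomputable section

namespace WeakFlag

/-! ### Linear algebra of filtrations -/

section Filtrations

variable {V : Type*} [AddCommGroup V] [Module ℝ V]

/-- The graded piece `A i / A (i + 1)` of a decreasing filtration `A`. -/
abbrev Gr (A : ℕ → Submodule ℝ V) (i : ℕ) : Type _ :=
  ↥(A i) ⧸ (A (i + 1)).submoduleOf (A i)

/-- The bigraded space
`h i j = (A i ∩ B j) / (A i ∩ B (j + 1) + A (i + 1) ∩ B j)` of two decreasing filtrations. -/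
abbrev BiGr (A B : ℕ → Submodule ℝ V) (i j : ℕ) : Type _ :=
  ↥(A i ⊓ B j) ⧸ ((A i ⊓ B (j + 1)) ⊔ (A (i + 1) ⊓ B j)).submoduleOf (A i ⊓ B j)

end Filtrations

/-! ### Algebraic Tanaka prolongation -/

section Prolongation

variable {m : Type} [AddCommGroup m] [Module ℝ m]

/-- A partially prolonged algebra `m ⊕ 𝔤₀ ⊕ ⋯ ⊕ 𝔤ₖ₋₁`: a vector space `V` with the family `gr` of
its graded components, and the bracket `act v X = [v, X]` of `v ∈ V` with `X ∈ m`. -/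
structure Stage (m : Type) [AddCommGroup m] [Module ℝ m] where
  V : Type
  [grp : AddCommGroup V]
  [mod : Module ℝ V]
  gr : ℤ → Submodule ℝ V
  act : V →ₗ[ℝ] m →ₗ[ℝ] V

attribute [instance] Stage.grp Stage.mod

/-- The linear maps `u : m → V` of degree `k` such that `u [X, Y] = [u X, Y] + [X, u Y]`
for all `X, Y ∈ m`; here `[X, u Y] = -[u Y, X]`. -/
def symbol (gr₀ : ℤ → Submodule ℝ m) (B : m →ₗ[ℝ] m →ₗ[ℝ] m) (S : Stage m) (k : ℤ) :
    Submodule ℝ (m →ₗ[ℝ] S.V) where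
  carrier := {u | (∀ d : ℤ, ∀ X ∈ gr₀ d, u X ∈ S.gr (d + k)) ∧
    ∀ X Y : m, u (B X Y) = S.act (u X) Y - S.act (u Y) X}
  zero_mem' := ⟨fun _ _ _ => by simp, fun _ _ => by simp⟩
  add_mem' := by
    rintro u v ⟨hu, hu'⟩ ⟨hv, hv'⟩
    refine ⟨fun d X hX => (S.gr _).add_mem (hu d X hX) (hv d X hX), fun X Y => ?_⟩
    simp only [LinearMap.add_apply, map_add, hu', hv']
    abel
  smul_mem' := by
    rintro c u ⟨hu, hu'⟩
    refine ⟨fun d X hX => (S.gr _).smul_mem c (hu d X hX), fun X Y => ?_⟩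
    simp only [LinearMap.smul_apply, map_smul, hu', smul_sub]

/-- `stage gr₀ B k = m ⊕ 𝔤₀ ⊕ ⋯ ⊕ 𝔤ₖ₋₁`, where successively `𝔤ₖ = symbol gr₀ B (stage k) k`
and `[u, X] = u X` for `u ∈ 𝔤ₖ`, `X ∈ m`. -/
def stage (gr₀ : ℤ → Submodule ℝ m) (B : m →ₗ[ℝ] m →ₗ[ℝ] m) : ℕ → Stage m
  | 0 => { V := m, gr := gr₀, act := B }
  | k + 1 =>
    let S := stage gr₀ B k
    { V := S.V × ↥(symbol gr₀ B S k)
      gr := fun d => (S.gr d).prod (if d = (k : ℤ) then ⊤ else ⊥)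
      act :=
        { toFun := fun w => (LinearMap.inl ℝ S.V ↥(symbol gr₀ B S k)).comp
            (S.act w.1 + (w.2 : m →ₗ[ℝ] S.V))
          map_add' := fun w w' => by
            ext X <;> simp; abel
          map_smul' := fun c w => by
            ext X <;> simp } }

end Prolongation

/-! ### Vector fields, distributions, the weak derived flag -/

variable {n : ℕ} {M : Type*} [TopologicalSpace M] [ChartedSpace (EuclideanSpace ℝ (Fin n)) M]

variable (n M) in
/-- Arbitrary (not necessarily smooth) vector fields on `M`. -/
abbrev VF : Type _ := (y : M) → TangentSpace (𝓡 n) y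

variable (n M) in
/-- A choice of a subspace of every tangent space. -/
abbrev PlaneField : Type _ := (y : M) → Submodule ℝ (TangentSpace (𝓡 n) y)

/-- The Lie bracket of vector fields. -/
abbrev br (X Y : VF n M) : VF n M := VectorField.mlieBracket (𝓡 n) X Y

section Smooth

variable [IsManifold (𝓡 n) ∞ M]

/-- `X` is smooth on some neighbourhood of `x`. -/
def SmoothNear (x : M) (X : VF n M) : Prop :=
  ∀ᶠ y in 𝓝 x, ContMDiffAt (𝓡 n) ((𝓡 n).prod 𝓘(ℝ, EuclideanSpace ℝ (Fin n))) ∞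
    (fun z => (⟨z, X z⟩ : TangentBundle (𝓡 n) M)) y

theorem SmoothNear.add {x : M} {X Y : VF n M} (hX : SmoothNear x X) (hY : SmoothNear x Y) :
    SmoothNear x (X + Y) := by
  filter_upwards [hX, hY] with y h1 h2
  exact h1.add_section h2

theorem SmoothNear.smul {x : M} {X : VF n M} (c : ℝ) (hX : SmoothNear x X) :
    SmoothNear x (c • X) := by
  filter_upwards [hX] with y h1
  exact h1.const_smul_section

theorem smoothNear_zero (x : M) : SmoothNear x (0 : VF n M) :=
  Filter.Eventually.of_forall fun _ =>
    (Bundle.contMDiff_zeroSection ℝ (fun z : M => TangentSpace (𝓡 n) z)).contMDiffAt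

/-- The space of vector fields that are smooth near `x`.
A germ of a smooth vector field at `x` is an element of this space up to fields vanishing near
`x`; everything below depends only on germs at `x`. -/
def LocVF (x : M) : Submodule ℝ (VF n M) where
  carrier := {X | SmoothNear x X}
  zero_mem' := smoothNear_zero x
  add_mem' := SmoothNear.add
  smul_mem' c _ := SmoothNear.smul c

/-- The local smooth sections near `x` of a field of subspaces `D`. -/
def secs (D : PlaneField n M) (x : M) : Submodule ℝ (VF n M) where
  carrier := {X | SmoothNear x X ∧ ∀ᶠ y in 𝓝 x, X y ∈ D y}
  zero_mem' := ⟨smoothNear_zero x, Filter.Eventually.of_forall fun y => (D y).zero_mem⟩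
  add_mem' := by
    rintro X Y ⟨h1, h2⟩ ⟨h3, h4⟩
    refine ⟨h1.add h3, ?_⟩
    filter_upwards [h2, h4] with y a b using (D y).add_mem a b
  smul_mem' := by
    rintro c X ⟨h1, h2⟩
    refine ⟨h1.smul c, ?_⟩
    filter_upwards [h2] with y a using (D y).smul_mem c a

theorem secs_apply_mem {D : PlaneField n M} {x : M} {X : VF n M} (h : X ∈ secs D x) :
    X x ∈ D x :=
  h.2.self_of_nhds

/-- `Δ` is a smooth distribution, i.e. a smooth vector subbundle of `TM`: it has constant rank and
each of its vectors extends to a local smooth section. -/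
def IsDistribution (Δ : PlaneField n M) : Prop :=
  (∃ r : ℕ, ∀ y, Module.finrank ℝ (Δ y) = r) ∧
    ∀ y, ∀ v ∈ Δ y, ∃ Y ∈ secs Δ y, Y y = v

/-- The weak derived flag: `flag Δ 0 = 0`, `flag Δ 1 = Δ`, and `flag Δ (i + 1)` is spanned by
`flag Δ i` and the brackets of local sections of `Δ` with local sections of `flag Δ i`. -/
def flag (Δ : PlaneField n M) : ℕ → PlaneField n M
  | 0 => fun _ => ⊥
  | 1 => Δ
  | i + 2 => fun y => flag Δ (i + 1) y ⊔
      Submodule.span ℝ {v | ∃ Y ∈ secs Δ y, ∃ Z ∈ secs (flag Δ (i + 1)) y, v = br Y Z y}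

/-- The weak derived flag is regular: all its members have constant rank. -/
def IsRegular (Δ : PlaneField n M) : Prop :=
  ∀ i : ℕ, ∃ r : ℕ, ∀ y, Module.finrank ℝ (flag Δ i y) = r

/-! ### The graded nilpotent Lie algebra and the Tanaka algebra at a point -/

/-- `𝔤₋ₚ = Δₚ / Δₚ₋₁` at the point `x` (it is zero for `p = 0`). -/
abbrev NegPart (Δ : PlaneField n M) (x : M) (p : ℕ) : Type :=
  ↥(flag Δ p x) ⧸ (flag Δ (p - 1) x).submoduleOf (flag Δ p x)

/-- `𝔪 = ⊕_{p > 0} 𝔤₋ₚ` at the point `x`. -/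
abbrev Neg (Δ : PlaneField n M) (x : M) : Type := ⨁ p : ℕ, NegPart Δ x p

/-- The element of `𝔤₋ₚ ⊆ 𝔪` represented by a vector of `Δₚ` at `x`. -/
def cls (Δ : PlaneField n M) (x : M) (p : ℕ) (v : TangentSpace (𝓡 n) x) (hv : v ∈ flag Δ p x) :
    Neg Δ x :=
  DirectSum.lof ℝ ℕ (NegPart Δ x) p (Submodule.Quotient.mk ⟨v, hv⟩)

/-- The grading of `𝔪` by negative integers: the component of degree `d` is `𝔤₋ₚ` if `d = -p`,
and zero if `d > 0`. -/
def negGr (Δ : PlaneField n M) (x : M) (d : ℤ) : Submodule ℝ (Neg Δ x) :=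
  ⨆ p : ℕ, ⨆ _ : d = -(p : ℤ), LinearMap.range (DirectSum.lof ℝ ℕ (NegPart Δ x) p)

/-- `B` is induced by the commutator of vector fields:
`B [Y x] [Z x] = [[Y, Z] x]` for all local sections `Y` of `Δₚ` and `Z` of `Δ_q`. -/
def IsLeviBracket (Δ : PlaneField n M) (x : M) (B : Neg Δ x →ₗ[ℝ] Neg Δ x →ₗ[ℝ] Neg Δ x) : Prop :=
  ∀ (p q : ℕ) (Y Z : VF n M) (hY : Y ∈ secs (flag Δ p) x) (hZ : Z ∈ secs (flag Δ q) x),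
    ∃ h : br Y Z x ∈ flag Δ (p + q) x,
      B (cls Δ x p (Y x) (secs_apply_mem hY)) (cls Δ x q (Z x) (secs_apply_mem hZ)) =
        cls Δ x (p + q) (br Y Z x) h

open Classical in
/-- The Lie bracket of `𝔪`, induced by the commutator of vector fields. For a regular flag there is
exactly one bilinear map with this property. -/
def leviBracket (Δ : PlaneField n M) (x : M) : Neg Δ x →ₗ[ℝ] Neg Δ x →ₗ[ℝ] Neg Δ x :=
  if h : ∃ B, IsLeviBracket Δ x B then h.choose else 0

/-- The component `𝔤ₖ`, `k ≥ 0`, of the Tanaka algebra of `Δ` at `x`. -/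
def tanaka (Δ : PlaneField n M) (x : M) (k : ℕ) :
    Submodule ℝ (Neg Δ x →ₗ[ℝ] (stage (m := Neg Δ x) (negGr Δ x) (leviBracket Δ x) k).V) :=
  symbol (m := Neg Δ x) (negGr Δ x) (leviBracket Δ x) (stage (m := Neg Δ x) (negGr Δ x) (leviBracket Δ x) k) k

/-! ### Jets of vector fields -/

/-- The vector field `X` in the preferred chart at `x`. -/
def rep (x : M) (X : VF n M) : EuclideanSpace ℝ (Fin n) → EuclideanSpace ℝ (Fin n) :=
  VectorField.mpullbackWithin 𝓘(ℝ, EuclideanSpace ℝ (Fin n)) (𝓡 n)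
    (extChartAt (𝓡 n) x).symm X (Set.range (𝓡 n))

theorem rep_contDiffAt {x : M} {X : VF n M} (h : SmoothNear x X) :
    ContDiffAt ℝ ∞ (rep x X) (extChartAt (𝓡 n) x x) := by
  have h1 := h.self_of_nhds
  rw [← contMDiffWithinAt_univ] at h1
  have h2 := VectorField.contMDiffWithinAt_mpullbackWithin_extChartAt_symm (m := ∞) (n := ∞) h1
    uniqueMDiffOn_univ (Set.mem_univ x) (by simp)
  simp only [Set.preimage_univ, Set.inter_univ] at h2
  have h3 := h2.contMDiffAt (extChartAt_target_mem_nhds x)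
  exact ((contMDiff_snd_tangentBundle_modelSpace (EuclideanSpace ℝ (Fin n))
    𝓘(ℝ, EuclideanSpace ℝ (Fin n))).contMDiffAt.comp _ h3).contDiffAt

theorem rep_zero (x : M) : rep x (0 : VF n M) = 0 :=
  VectorField.mpullbackWithin_zero

theorem rep_add (x : M) (X Y : VF n M) : rep x (X + Y) = rep x X + rep x Y :=
  VectorField.mpullbackWithin_add ..

theorem rep_smul (x : M) (c : ℝ) (X : VF n M) : rep x (c • X) = c • rep x X :=
  VectorField.mpullbackWithin_const_smul ..

/-- The fields vanishing at `x` together with their partial derivatives up to order `k`. -/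
def van (x : M) (k : ℕ) : Submodule ℝ (VF n M) where
  carrier := {X | SmoothNear x X ∧
    ∀ t ≤ k, iteratedFDeriv ℝ t (rep x X) (extChartAt (𝓡 n) x x) = 0}
  zero_mem' := ⟨smoothNear_zero x, fun t _ => by rw [rep_zero]; simp⟩
  add_mem' := by
    rintro X Y ⟨h1, h2⟩ ⟨h3, h4⟩
    refine ⟨h1.add h3, fun t ht => ?_⟩
    rw [rep_add, iteratedFDeriv_add_apply ((rep_contDiffAt h1).of_le (mod_cast le_top))
      ((rep_contDiffAt h3).of_le (mod_cast le_top)), h2 t ht, h4 t ht, add_zero]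
  smul_mem' := by
    rintro c X ⟨h1, h2⟩
    refine ⟨h1.smul c, fun t ht => ?_⟩
    rw [rep_smul, iteratedFDeriv_const_smul_apply ((rep_contDiffAt h1).of_le (mod_cast le_top)),
      h2 t ht, smul_zero]

/-- The space `J^k_x(TM)` of `k`-jets at `x` of vector fields. -/
def Jet (x : M) (k : ℕ) : Type _ :=
  ↥(LocVF (n := n) x) ⧸ (van (n := n) x k).submoduleOf (LocVF x)

instance (x : M) (k : ℕ) : AddCommGroup (Jet (n := n) x k) :=
  inferInstanceAs (AddCommGroup (↥(LocVF (n := n) x) ⧸ (van (n := n) x k).submoduleOf (LocVF x)))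

instance (x : M) (k : ℕ) : Module ℝ (Jet (n := n) x k) :=
  inferInstanceAs (Module ℝ (↥(LocVF (n := n) x) ⧸ (van (n := n) x k).submoduleOf (LocVF x)))

variable (n) in
/-- The `k`-jet at `x` of a local vector field. -/
def jet (x : M) (k : ℕ) : ↥(LocVF (n := n) x) →ₗ[ℝ] Jet (n := n) x k :=
  Submodule.mkQ ((van (n := n) x k).submoduleOf (LocVF x))

theorem van_anti (x : M) {k l : ℕ} (h : k ≤ l) : van (n := n) x l ≤ van x k :=
  fun _ hX => ⟨hX.1, fun t ht => hX.2 t (ht.trans h)⟩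

variable (n) in
/-- The projection `π_{l,k} : J^l_x(TM) → J^k_x(TM)`, `k ≤ l`. -/
def proj (x : M) {k l : ℕ} (h : k ≤ l) : Jet (n := n) x l →ₗ[ℝ] Jet (n := n) x k :=
  Submodule.factor (p := (van (n := n) x l).submoduleOf (LocVF x))
    (p' := (van (n := n) x k).submoduleOf (LocVF x)) (Submodule.comap_mono (van_anti x h))

/-! ### Brackets of local vector fields -/

theorem SmoothNear.br {x : M} {X Y : VF n M} (hX : SmoothNear x X) (hY : SmoothNear x Y) :
    SmoothNear x (br X Y) := by
  filter_upwards [hX, hY] with y h1 h2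
  have : IsManifold (𝓡 n) (((⊤ : ℕ∞) : WithTop ℕ∞) + 1) M := by simpa using ‹IsManifold (𝓡 n) ∞ M›
  have : IsManifold (𝓡 n) (minSmoothness ℝ 2) M := by
    rw [minSmoothness_of_isRCLikeNormedField]; infer_instance
  exact h1.mlieBracket_vectorField (m := ⊤) (n := ⊤) h2 (by simp)

theorem SmoothNear.congr {x : M} {X Y : VF n M} (hX : SmoothNear x X) (h : Y =ᶠ[𝓝 x] X) :
    SmoothNear x Y := by
  filter_upwards [hX, h.eventuallyEq_nhds] with y h1 h2
  exact h1.congr_of_eventuallyEq (h2.mono fun z hz => by simp [hz])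

theorem br_add_left {x : M} {X X' Y : VF n M} (hX : SmoothNear x X) (hX' : SmoothNear x X') :
    br (X + X') Y =ᶠ[𝓝 x] br X Y + br X' Y := by
  filter_upwards [hX, hX'] with y h1 h2
  exact VectorField.mlieBracket_add_left (h1.mdifferentiableAt (by simp))
    (h2.mdifferentiableAt (by simp))

theorem br_smul_left {x : M} {X Y : VF n M} (c : ℝ) (hX : SmoothNear x X) :
    br (c • X) Y =ᶠ[𝓝 x] c • br X Y := by
  filter_upwards [hX] with y h1
  exact VectorField.mlieBracket_const_smul_left (h1.mdifferentiableAt (by simp))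

theorem secs_congr {D : PlaneField n M} {x : M} {X Y : VF n M} (hX : X ∈ secs D x)
    (h : Y =ᶠ[𝓝 x] X) : Y ∈ secs D x :=
  ⟨hX.1.congr h, by filter_upwards [hX.2, h] with y h1 h2; rwa [h2]⟩

theorem secs_sup_van_congr {D : PlaneField n M} {x : M} {k : ℕ} {X Y : VF n M}
    (hX : X ∈ secs D x ⊔ van x k) (h : Y =ᶠ[𝓝 x] X) : Y ∈ secs D x ⊔ van x k := by
  have h0 : Y - X ∈ secs D x := by
    refine secs_congr (secs D x).zero_mem ?_
    filter_upwards [h] with y hy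
    simp [hy]
    rfl
  have := add_mem (Submodule.mem_sup_left (T := van x k) h0) hX
  simpa using this

/-- The iterated bracket `[[…[[X, Y₁], Y₂], …], Y_r]`, where `l = [Y₁, …, Y_r]`. -/
def iterBr (X : VF n M) (l : List (VF n M)) : VF n M :=
  l.foldl (fun X Y => br X Y) X

theorem iterBr_congr {x : M} (l : List (VF n M)) {X X' : VF n M} (h : X =ᶠ[𝓝 x] X') :
    iterBr X l =ᶠ[𝓝 x] iterBr X' l := by
  induction l generalizing X X' with
  | nil => exact h
  | cons Y l ih => exact ih (h.mlieBracket_vectorField (Filter.EventuallyEq.refl _ Y))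

theorem iterBr_add {x : M} (l : List (VF n M)) (hl : ∀ Y ∈ l, SmoothNear x Y) {X X' : VF n M}
    (hX : SmoothNear x X) (hX' : SmoothNear x X') :
    iterBr (X + X') l =ᶠ[𝓝 x] iterBr X l + iterBr X' l := by
  induction l generalizing X X' with
  | nil => exact Filter.EventuallyEq.refl _ _
  | cons Y l ih =>
    have hY := hl Y (by simp)
    exact (iterBr_congr l (br_add_left hX hX')).trans
      (ih (fun Z hZ => hl Z (by simp [hZ])) (hX.br hY) (hX'.br hY))

theorem iterBr_smul {x : M} (l : List (VF n M)) (hl : ∀ Y ∈ l, SmoothNear x Y) (c : ℝ)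
    {X : VF n M} (hX : SmoothNear x X) :
    iterBr (c • X) l =ᶠ[𝓝 x] c • iterBr X l := by
  induction l generalizing X with
  | nil => exact Filter.EventuallyEq.refl _ _
  | cons Y l ih =>
    exact (iterBr_congr l (br_smul_left c hX)).trans
      (ih (fun Z hZ => hl Z (by simp [hZ])) (hX.br (hl Y (by simp))))

theorem iterBr_zero (l : List (VF n M)) : iterBr (0 : VF n M) l = 0 := by
  induction l with
  | nil => rfl
  | cons Y l ih =>
    have : br (0 : VF n M) Y = 0 := VectorField.mlieBracket_zero_left
    simpa [iterBr, this] using ih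

/-- The local vector fields `X` for which `X x = 0` and
`Ψ_X^r (Y₁, …, Y_r) = [[…[X, Y₁], …], Y_r] x` vanishes for all `r ≤ i` and all local sections
`Y₁, …, Y_r` of `Δ`. -/
def wvan (Δ : PlaneField n M) (x : M) (i : ℕ) : Submodule ℝ (VF n M) where
  carrier := {X | SmoothNear x X ∧
    ∀ l : List (VF n M), l.length ≤ i → (∀ Y ∈ l, Y ∈ secs Δ x) → iterBr X l x = 0}
  zero_mem' := ⟨smoothNear_zero x, fun l _ _ => by rw [iterBr_zero]; rfl⟩
  add_mem' := by
    rintro X X' ⟨h1, h2⟩ ⟨h3, h4⟩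
    refine ⟨h1.add h3, fun l hl hY => ?_⟩
    have h := (iterBr_add l (fun Y hy => (hY Y hy).1) h1 h3).self_of_nhds
    rw [h, Pi.add_apply, h2 l hl hY, h4 l hl hY, add_zero]
  smul_mem' := by
    rintro c X ⟨h1, h2⟩
    refine ⟨h1.smul c, fun l hl hY => ?_⟩
    have h := (iterBr_smul l (fun Y hy => (hY Y hy).1) c h1).self_of_nhds
    rw [h, Pi.smul_apply, h2 l hl hY, smul_zero]

/-! ### Local symmetries and their two filtrations -/

/-- The stalk `L(x)`: local vector fields near `x` that preserve the distribution `Δ`. -/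
def sym (Δ : PlaneField n M) (x : M) : Submodule ℝ (VF n M) where
  carrier := {X | SmoothNear x X ∧ ∀ Y ∈ secs Δ x, br X Y ∈ secs Δ x}
  zero_mem' := ⟨smoothNear_zero x, fun Y _ => by
    have : br (0 : VF n M) Y = 0 := VectorField.mlieBracket_zero_left
    rw [this]; exact (secs Δ x).zero_mem⟩
  add_mem' := by
    rintro X X' ⟨h1, h2⟩ ⟨h3, h4⟩
    exact ⟨h1.add h3, fun Y hY =>
      secs_congr ((secs Δ x).add_mem (h2 Y hY) (h4 Y hY)) (br_add_left h1 h3)⟩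
  smul_mem' := by
    rintro c X ⟨h1, h2⟩
    exact ⟨h1.smul c, fun Y hY =>
      secs_congr ((secs Δ x).smul_mem c (h2 Y hY)) (br_smul_left c h1)⟩

/-- The first filtration `L(x)_*^j = L(x) ∩ μ_x^{j+1} · D_loc`, `j ≥ 0`. -/
def symJet (Δ : PlaneField n M) (x : M) (j : ℕ) : Submodule ℝ (VF n M) :=
  sym Δ x ⊓ van x j

/-- The second filtration `L(x)^i`, `i ≥ 0`. -/
def symWt (Δ : PlaneField n M) (x : M) (i : ℕ) : Submodule ℝ (VF n M) :=
  sym Δ x ⊓ wvan Δ x i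

/-! ### The Lie equation of the weak derived flag and its prolongation-projection -/

/-- The local vector fields `X` for which the `k`-jet at `x` of `L_X Y mod Δ_i` vanishes for all `i`
and all local sections `Y` of `Δ_i`. -/
def lieEqn (Δ : PlaneField n M) (x : M) (k : ℕ) : Submodule ℝ (VF n M) where
  carrier := {X | SmoothNear x X ∧
    ∀ i : ℕ, ∀ Y ∈ secs (flag Δ i) x, br X Y ∈ secs (flag Δ i) x ⊔ van x k}
  zero_mem' := ⟨smoothNear_zero x, fun i Y _ => by
    have : br (0 : VF n M) Y = 0 := VectorField.mlieBracket_zero_left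
    rw [this]; exact Submodule.zero_mem _⟩
  add_mem' := by
    rintro X X' ⟨h1, h2⟩ ⟨h3, h4⟩
    exact ⟨h1.add h3, fun i Y hY =>
      secs_sup_van_congr (Submodule.add_mem _ (h2 i Y hY) (h4 i Y hY)) (br_add_left h1 h3)⟩
  smul_mem' := by
    rintro c X ⟨h1, h2⟩
    exact ⟨h1.smul c, fun i Y hY =>
      secs_sup_van_congr (Submodule.smul_mem _ c (h2 i Y hY)) (br_smul_left c h1)⟩

/-- The fibre at `x` of the prolongation `E^{(k)} ⊆ J^{k+1}(TM)` of the Lie equation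
`E = E^{(0)} = {j¹_x X : L_X (Δ_i)_x ⊆ (Δ_i)_x for all i > 0} ⊆ J¹(TM)` of the weak derived flag:
the jets satisfying the equation together with its derivatives up to order `k`. -/
def prolong (Δ : PlaneField n M) (x : M) (k : ℕ) : Submodule ℝ (Jet (n := n) x (k + 1)) :=
  ((lieEqn Δ x k).submoduleOf (LocVF x)).map (jet n x (k + 1))

/-- The fibre at `x` of the prolongation-projection `Ē_i = ⋂_k π_{k+1,i} (E^{(k)}) ⊆ J^i(TM)`. -/
def ebar (Δ : PlaneField n M) (x : M) (i : ℕ) : Submodule ℝ (Jet (n := n) x i) :=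
  ⨅ k : ℕ, ⨅ h : i ≤ k + 1, (prolong Δ x k).map (proj n x h)

/-- The Spencer symbols `ḡ_i = Ker (π_{i,i-1} : Ē_i → Ē_{i-1})` at `x`, with `ḡ_0 = Ē_0`. -/
def spencer (Δ : PlaneField n M) (x : M) : (i : ℕ) → Submodule ℝ (Jet (n := n) x i)
  | 0 => ebar Δ x 0
  | j + 1 => ebar Δ x (j + 1) ⊓ LinearMap.ker (proj n x (Nat.le_succ j))

variable (n) in
/-- Sequences of jets at `x` of all orders; the infinite jets are the compatible ones. -/
abbrev JetSeq (x : M) : Type _ := (k : ℕ) → Jet (n := n) x k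

variable (n) in
/-- The `k`-jet of a sequence of jets, as a linear map. -/
abbrev toJet (x : M) (k : ℕ) : JetSeq n x →ₗ[ℝ] Jet (n := n) x k :=
  LinearMap.proj (φ := fun k => Jet (n := n) x k) k

/-- The space `Ē_∞` of infinite jets at `x` solving the equation to all orders, i.e. the inverse
limit of the spaces `Ē_k`. -/
def ebarInf (Δ : PlaneField n M) (x : M) : Submodule ℝ (JetSeq n x) where
  carrier := {ξ | (∀ k, proj n x (Nat.le_succ k) (ξ (k + 1)) = ξ k) ∧ ∀ k, ξ k ∈ ebar Δ x k}
  zero_mem' := ⟨fun _ => by simp, fun _ => by simp⟩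
  add_mem' := by
    rintro ξ η ⟨h1, h2⟩ ⟨h3, h4⟩
    exact ⟨fun k => by simp [h1, h3], fun k => Submodule.add_mem _ (h2 k) (h4 k)⟩
  smul_mem' := by
    rintro c ξ ⟨h1, h2⟩
    exact ⟨fun k => by simp [h1], fun k => Submodule.smul_mem _ c (h2 k)⟩

/-- The first filtration of `Ē_∞`: the infinite jets whose `j`-jet is zero. -/
def formalJet (Δ : PlaneField n M) (x : M) (j : ℕ) : Submodule ℝ (JetSeq n x) :=
  ebarInf Δ x ⊓ LinearMap.ker (toJet n x j)

/-- The second filtration of `Ē_∞`: the infinite jets `ξ` such that `Ψ_ξ^r` vanishes on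
`Δ_x ⊗ ⋯ ⊗ Δ_x` for all `0 ≤ r ≤ i`; as `Ψ_ξ^r` depends only on the `i`-jet of `ξ`, this is a
condition on a vector field representing that jet. -/
def formalWt (Δ : PlaneField n M) (x : M) (i : ℕ) : Submodule ℝ (JetSeq n x) :=
  ebarInf Δ x ⊓ (((wvan Δ x i).submoduleOf (LocVF x)).map (jet n x i)).comap (toJet n x i)

/-! ### The graded and bigraded spaces of the two pairs of filtrations -/

/-- `𝐠_i`, the graded piece of the second filtration of `Ē_∞`. -/
abbrev formalG (Δ : PlaneField n M) (x : M) (i : ℕ) : Type _ :=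
  Gr (V := JetSeq n x) (formalWt Δ x) i

/-- `h_ij` for the two filtrations of `Ē_∞`. -/
abbrev formalH (Δ : PlaneField n M) (x : M) (i j : ℕ) : Type _ :=
  BiGr (V := JetSeq n x) (formalWt Δ x) (formalJet Δ x) i j

/-- `L(x)^i / L(x)^{i+1}`. -/
abbrev symG (Δ : PlaneField n M) (x : M) (i : ℕ) : Type _ :=
  Gr (V := VF n M) (symWt Δ x) i

/-- `L(x)_*^j / L(x)_*^{j+1}`. -/
abbrev symS (Δ : PlaneField n M) (x : M) (j : ℕ) : Type _ :=
  Gr (V := VF n M) (symJet Δ x) j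

/-- `h_ij` for the two filtrations of `L(x)`. -/
abbrev symH (Δ : PlaneField n M) (x : M) (i j : ℕ) : Type _ :=
  BiGr (V := VF n M) (symWt Δ x) (symJet Δ x) i j

end Smooth

end WeakFlag

end

noncomputable section

namespace WeakFlag

/-! ### Sums of cardinals -/

section CardinalSums

open Cardinal

/-! Near `x` one chooses a frame `X a` with weights `1 ≤ w a ≤ κ` adapted to the flag: `X a` is a
section of Δ_{w a} and, if `w a ≥ 2`, a bracket of a section of Δ with one of Δ_{w a - 1}. A vector
field becomes the tuple `f` of its coefficient germs. Differentiating along words `E_l` in the frame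
gives two orders of vanishing: the jet order counts letters, the weighted order adds their weights.
Brackets with sections of Δ detect the derivatives of weight one, and these generate all others, so
membership in `L^i` means that all coefficients have weighted order at least `i + 1`
(`IsFlagFrame.mem_wvan_iff`). As the weight of a word lies between its length and κ times its
length, the two filtrations are comparable.

Linear algebra does the rest of the bookkeeping. Each of two comparable filtrations cuts the graded
pieces of the other into finitely many steps with quotients `h_ij` (`rank_gr`). Summing over `i` and
`j` in either order shows that both graded spaces have the same total dimension, so only an
embedding of the `i`-th weighted piece into the Tanaka component of degree `i` is missing.

That embedding is the leading part. The symmetry equation, `E_b f_c = ∑ f_a C_abc` for `w b < w c`,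
raises the weighted order of `f_c` from `i + 1` to `i + w c` (`WeightedFrame.mem_wOrd_add_weight`).
Hence the values at `x` of `E_l f_c` with `wt l = w c + i` form a function from words to `m`. At
leading order the commutators of the `E_a` become the bracket of `m`, and the symmetry equation
expresses the values on long words by brackets (`WeightedFrame.leading_mem_wordSymbol`). Removing
the first letter of a word plays the role of bracketing with a basis vector, so a recursion on the
degree maps such functions injectively into the Tanaka prolongation
(`GradedBasis.exists_wordSymbol_injective`). The leading part vanishes exactly on `L^{i+1}`.

Only derivatives of bounded order occur, so the same argument serves germs of symmetries and formal
ones, the latter through a linear choice of fields representing jets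
(`IsFlagFrame.exists_gr_injective`). A Mittag-Leffler argument in the finite-dimensional jet spaces
identifies the Spencer symbols with the graded pieces of the formal jet filtration
(`spencer_succ_eq`). -/

theorem sum_subtype_eq_sum {ι : Type} (s : ι → Prop) (g : ι → Cardinal.{u})
    (hg : ∀ i, ¬ s i → g i = 0) : Cardinal.sum (fun i : {i // s i} => g i) = Cardinal.sum g := by
  refine Cardinal.mk_congr (Equiv.ofBijective (fun y => ⟨y.1.1, y.2⟩) ⟨?_, ?_⟩)
  · rintro ⟨⟨i, hi⟩, y⟩ ⟨⟨j, hj⟩, z⟩ h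
    simp only [Sigma.mk.injEq] at h
    obtain ⟨rfl, h⟩ := h
    simpa using h
  · rintro ⟨i, y⟩
    have hi : s i := by
      by_contra hi
      have : IsEmpty (g i).out := by
        rw [← Cardinal.mk_eq_zero_iff, Cardinal.mk_out, hg i hi]
      exact this.elim y
    exact ⟨⟨⟨i, hi⟩, y⟩, rfl⟩

theorem sum_eq_sum_range {g : ℕ → Cardinal.{u}} {N : ℕ} (hg : ∀ i, N ≤ i → g i = 0) :
    Cardinal.sum g = ∑ i ∈ Finset.range N, g i := by
  induction N generalizing g with
  | zero =>
    have : g = fun _ => 0 := funext fun i => hg i (Nat.zero_le i)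
    simp [this]
  | succ N ih =>
    rw [Cardinal.sum_nat_eq_add_sum_succ, ih (g := fun i => g (i + 1))
      (fun i hi => hg _ (by omega)), Finset.sum_range_succ', add_comm]

/-- Both sides count the same disjoint union, so no finiteness is needed. -/
theorem sum_sum_comm {ι κ : Type} (f : ι → κ → Cardinal.{u}) :
    Cardinal.sum (fun i => Cardinal.sum (f i)) =
      Cardinal.sum fun j => Cardinal.sum fun i => f i j := by
  have h : f = fun i j => #((f i j).out) := by simp
  rw [h]
  simp only [← Cardinal.mk_sigma]
  exact Cardinal.mk_congr
    ⟨fun z => ⟨z.2.1, z.1, z.2.2⟩, fun z => ⟨z.2.1, z.1, z.2.2⟩, fun _ => rfl, fun _ => rfl⟩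

end CardinalSums

/-! ### Two comparable filtrations of a vector space -/

section Filtrations

variable {V : Type u} [AddCommGroup V] [Module ℝ V]

/-- The short exact sequence `q/r → p/r → p/q`. -/
theorem rank_relQuotient_add {r q p : Submodule ℝ V} (hrq : r ≤ q) (hqp : q ≤ p) :
    Module.rank ℝ (↥p ⧸ r.submoduleOf p) =
      Module.rank ℝ (↥p ⧸ q.submoduleOf p) + Module.rank ℝ (↥q ⧸ r.submoduleOf q) := by
  let f : (↥q ⧸ r.submoduleOf q) →ₗ[ℝ] (↥p ⧸ r.submoduleOf p) :=
    Submodule.mapQ _ _ (Submodule.inclusion hqp) (fun y hy => hy)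
  let g : (↥p ⧸ r.submoduleOf p) →ₗ[ℝ] (↥p ⧸ q.submoduleOf p) :=
    Submodule.factor (Submodule.comap_mono hrq)
  have hf : Function.Injective f := by
    refine (injective_iff_map_eq_zero f).2 fun y hy => ?_
    obtain ⟨y, rfl⟩ := Submodule.Quotient.mk_surjective _ y
    exact (Submodule.Quotient.mk_eq_zero _).2 ((Submodule.Quotient.mk_eq_zero
      (r.submoduleOf p) (x := Submodule.inclusion hqp y)).1 hy)
  have hg : Function.Surjective g := Submodule.factor_surjective _
  have hfg : LinearMap.range f = LinearMap.ker g := by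
    ext z
    obtain ⟨z, rfl⟩ := Submodule.Quotient.mk_surjective _ z
    constructor
    · rintro ⟨y, hy⟩
      obtain ⟨y, rfl⟩ := Submodule.Quotient.mk_surjective _ y
      rw [← hy]
      exact (Submodule.Quotient.mk_eq_zero _).2 y.2
    · intro hz
      have hz : (z : V) ∈ q :=
        (Submodule.Quotient.mk_eq_zero (q.submoduleOf p) (x := z)).1 hz
      exact ⟨Submodule.Quotient.mk ⟨z, hz⟩, rfl⟩
  rw [LinearMap.rank_eq_of_surjective hg, ← hfg, (LinearEquiv.ofInjective f hf).rank_eq]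

theorem rank_relQuotient_chain {C : ℕ → Submodule ℝ V} (hC : Antitone C) (N : ℕ) :
    Module.rank ℝ (↥(C 0) ⧸ (C N).submoduleOf (C 0)) =
      ∑ j ∈ Finset.range N, Module.rank ℝ (↥(C j) ⧸ (C (j + 1)).submoduleOf (C j)) := by
  induction N with
  | zero =>
    rw [Finset.sum_range_zero, Submodule.submoduleOf_self]
    exact rank_subsingleton' ℝ _
  | succ N ih =>
    rw [rank_relQuotient_add (hC (Nat.le_succ N)) (hC (Nat.zero_le N)), ih, Finset.sum_range_succ]

/-- The second isomorphism theorem with the modular law: `h_ij` is a graded piece of the filtration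
that `B` induces on `A i / A (i + 1)`, lifted here to subspaces between `A (i + 1)` and `A i`. -/
theorem rank_biGr {A B : ℕ → Submodule ℝ V} (hA : Antitone A) (hB : Antitone B) (i j : ℕ) :
    Module.rank ℝ (BiGr A B i j) =
      Module.rank ℝ (↥(A (i + 1) ⊔ A i ⊓ B j) ⧸
        (A (i + 1) ⊔ A i ⊓ B (j + 1)).submoduleOf (A (i + 1) ⊔ A i ⊓ B j)) := by
  have e := LinearMap.quotientInfEquivSupQuotient (A i ⊓ B j) (A (i + 1) ⊔ A i ⊓ B (j + 1))
  have h1 : (A i ⊓ B j) ⊓ (A (i + 1) ⊔ A i ⊓ B (j + 1)) =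
      (A i ⊓ B (j + 1)) ⊔ (A (i + 1) ⊓ B j) := by
    have hle : A i ⊓ B (j + 1) ≤ A i ⊓ B j := inf_le_inf_left _ (hB (Nat.le_succ j))
    rw [sup_comm, inf_comm, sup_inf_assoc_of_le _ hle]
    congr 1
    rw [← inf_assoc, inf_eq_left.2 (hA (Nat.le_succ i))]
  have h2 : (A i ⊓ B j) ⊔ (A (i + 1) ⊔ A i ⊓ B (j + 1)) = A (i + 1) ⊔ A i ⊓ B j := by
    have hle : A i ⊓ B (j + 1) ≤ A i ⊓ B j := inf_le_inf_left _ (hB (Nat.le_succ j))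
    rw [sup_left_comm, sup_eq_left.2 hle]
  rw [← Submodule.comap_inf, h1, h2] at e
  exact e.rank_eq

/-- The definition is symmetric in the two filtrations, so one decomposition lemma serves both. -/
theorem rank_biGr_swap (A B : ℕ → Submodule ℝ V) (i j : ℕ) :
    Module.rank ℝ (BiGr A B i j) = Module.rank ℝ (BiGr B A j i) := by
  have h : (B j ⊓ A (i + 1)) ⊔ (B (j + 1) ⊓ A i) = (A i ⊓ B (j + 1)) ⊔ (A (i + 1) ⊓ B j) := by
    rw [sup_comm, inf_comm (B j), inf_comm (B (j + 1))]
  have h' : B j ⊓ A i = A i ⊓ B j := inf_comm ..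
  unfold BiGr
  rw [h, h']

theorem biGr_subsingleton_iff (A B : ℕ → Submodule ℝ V) (i j : ℕ) :
    Subsingleton (BiGr A B i j) ↔ A i ⊓ B j ≤ (A i ⊓ B (j + 1)) ⊔ (A (i + 1) ⊓ B j) := by
  rw [Submodule.Quotient.subsingleton_iff, Submodule.submoduleOf_eq_top]

/-- The graded piece of a filtration is the sum of the bigraded pieces, if the induced filtration
is exhaustive and becomes trivial. -/
theorem rank_gr {A B : ℕ → Submodule ℝ V} (hA : Antitone A) (hB : Antitone B) (i N : ℕ)
    (h0 : A i ≤ B 0) (hN : A i ⊓ B N ≤ A (i + 1)) :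
    Module.rank ℝ (Gr A i) = Cardinal.sum fun j => Module.rank ℝ (BiGr A B i j) := by
  have hC : Antitone fun j => A (i + 1) ⊔ A i ⊓ B j := fun j k h =>
    sup_le_sup_left (inf_le_inf_left _ (hB h)) _
  have h := rank_relQuotient_chain hC N
  have h1 : A (i + 1) ⊔ A i ⊓ B 0 = A i := by
    rw [inf_eq_left.2 h0, sup_eq_right.2 (hA (Nat.le_succ i))]
  have h2 : A (i + 1) ⊔ A i ⊓ B N = A (i + 1) := sup_eq_left.2 hN
  beta_reduce at h
  rw [h1, h2] at h
  rw [h, sum_eq_sum_range (N := N)]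
  · exact Finset.sum_congr rfl fun j _ => (rank_biGr hA hB i j).symm
  -- From `N` on, the induced filtration is constantly `A (i + 1)`, so the remaining terms of the
  -- infinite sum vanish.
  · intro j hj
    rw [rank_biGr hA hB]
    have hj1 : A (i + 1) ⊔ A i ⊓ B j = A (i + 1) :=
      sup_eq_left.2 ((inf_le_inf_left _ (hB hj)).trans hN)
    have hj2 : A (i + 1) ⊔ A i ⊓ B (j + 1) = A (i + 1) :=
      sup_eq_left.2 ((inf_le_inf_left _ (hB (hj.trans (Nat.le_succ j)))).trans hN)
    rw [hj1, hj2, Submodule.submoduleOf_self]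
    exact rank_subsingleton' ℝ _

/-- A pair of decreasing filtrations which are comparable: `B` is finer than `A`, and
`A ((j + 1) κ) ⊆ B (j + 1)`. -/
structure ComparableFiltrations (A B : ℕ → Submodule ℝ V) (κ : ℕ) : Prop where
  antiA : Antitone A
  antiB : Antitone B
  zero_le : A 0 ≤ B 0
  le : ∀ j, B j ≤ A j
  ge : ∀ j, A ((j + 1) * κ) ≤ B (j + 1)

namespace ComparableFiltrations

variable {A B : ℕ → Submodule ℝ V} {κ : ℕ} (H : ComparableFiltrations A B κ)
include H

/-- If `i < j` then `B j ≤ A j ≤ A (i + 1)`; in the other range `A i ≤ A ((j + 1) * κ) ≤ B (j + 1)`.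
Either way one summand of the denominator is everything. -/
theorem subsingleton (i j : ℕ) (h : i < j ∨ (j + 1) * κ ≤ i) : Subsingleton (BiGr A B i j) := by
  rw [biGr_subsingleton_iff]
  rcases h with h | h
  · exact le_sup_of_le_right (le_inf (inf_le_right.trans ((H.le j).trans (H.antiA h))) inf_le_right)
  · exact le_sup_of_le_left (le_inf inf_le_left (inf_le_left.trans ((H.antiA h).trans (H.ge j))))

theorem rank_eq_zero (i j : ℕ) (h : i < j) : Module.rank ℝ (BiGr A B i j) = 0 := by
  have := H.subsingleton i j (Or.inl h)
  exact rank_subsingleton' ℝ _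

theorem rank_grA (i : ℕ) :
    Module.rank ℝ (Gr A i) = Cardinal.sum fun j => Module.rank ℝ (BiGr A B i j) :=
  rank_gr H.antiA H.antiB i (i + 1) ((H.antiA (Nat.zero_le i)).trans H.zero_le)
    (inf_le_right.trans (H.le _))

theorem rank_grB (j : ℕ) :
    Module.rank ℝ (Gr B j) = Cardinal.sum fun i => Module.rank ℝ (BiGr A B i j) := by
  simp_rw [rank_biGr_swap A B]
  refine rank_gr H.antiB H.antiA j ((j + 1) * κ) ?_ (inf_le_right.trans (H.ge j))
  exact (H.antiB (Nat.zero_le j)).trans (H.le 0)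

theorem nonempty_grA_equiv (i : ℕ) :
    Nonempty (Gr A i ≃ₗ[ℝ] ⨁ j : {j : ℕ // j ≤ i}, BiGr A B i j) := by
  refine nonempty_linearEquiv_of_rank_eq ?_
  rw [rank_directSum, H.rank_grA,
    sum_subtype_eq_sum (fun j => j ≤ i) (fun j => Module.rank ℝ (BiGr A B i j))]
  exact fun j hj => H.rank_eq_zero i j (not_le.1 hj)

theorem nonempty_grB_equiv (j : ℕ) :
    Nonempty (Gr B j ≃ₗ[ℝ] ⨁ i : {i : ℕ // j ≤ i}, BiGr A B i j) := by
  refine nonempty_linearEquiv_of_rank_eq ?_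
  rw [rank_directSum, H.rank_grB,
    sum_subtype_eq_sum (fun i => j ≤ i) (fun i => Module.rank ℝ (BiGr A B i j))]
  exact fun i hi => H.rank_eq_zero i j (not_le.1 hi)

/-- Both sides are the double sum of the ranks of the `h_ij`. -/
theorem sum_rank_grB :
    (Cardinal.sum fun j => Module.rank ℝ (Gr B j)) =
      Cardinal.sum fun i => Module.rank ℝ (Gr A i) := by
  simp_rw [H.rank_grA, H.rank_grB]
  exact sum_sum_comm _

/-- If the graded pieces of `A` embed into `T i`, then the total dimension of the graded pieces of
`B` is at most that of the `T i`. -/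
theorem sum_rank_le {T : ℕ → Type} [∀ i, AddCommGroup (T i)] [∀ i, Module ℝ (T i)]
    (hT : ∀ i, ∃ f : Gr A i →ₗ[ℝ] T i, Function.Injective f) :
    Cardinal.lift.{0} (Cardinal.sum fun j => Module.rank ℝ (Gr B j)) ≤
      Cardinal.lift.{u} (Cardinal.sum fun i => Module.rank ℝ (T i)) := by
  rw [H.sum_rank_grB, Cardinal.lift_sum, Cardinal.lift_sum]
  refine Cardinal.sum_le_sum _ _ fun i => ?_
  obtain ⟨f, hf⟩ := hT i
  exact f.lift_rank_le_of_injective hf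

end ComparableFiltrations

/-- Over a field a comparison of dimensions is already an embedding; this is the source of the
noncanonical monomorphisms. -/
theorem exists_injective_directSum {S : ℕ → Type u} [∀ i, AddCommGroup (S i)]
    [∀ i, Module ℝ (S i)] {T : ℕ → Type} [∀ i, AddCommGroup (T i)] [∀ i, Module ℝ (T i)]
    (h : Cardinal.lift.{0} (Cardinal.sum fun j => Module.rank ℝ (S j)) ≤
      Cardinal.lift.{u} (Cardinal.sum fun i => Module.rank ℝ (T i))) :
    ∃ f : (⨁ j, S j) →ₗ[ℝ] ⨁ i, T i, Function.Injective f := by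
  rw [← lift_rank_le_iff_exists_linearMap, rank_directSum, rank_directSum]
  exact h

end Filtrations

/-! ### Symbols as functions of words, and the Tanaka prolongation -/

section WordSymbols

variable {m : Type} [AddCommGroup m] [Module ℝ m] {A : Type}

/-- The weight of a word. -/
def wt (w : A → ℕ) (l : List A) : ℕ := (l.map w).sum

@[simp] theorem wt_nil (w : A → ℕ) : wt w [] = 0 := rfl

@[simp] theorem wt_cons (w : A → ℕ) (a : A) (l : List A) : wt w (a :: l) = w a + wt w l := by
  simp [wt]

@[simp] theorem wt_append (w : A → ℕ) (l l' : List A) : wt w (l ++ l') = wt w l + wt w l' := by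
  simp [wt]

/-- The symbols of degree `d` of infinitesimal symmetries, as functions of words in a basis of `m`:
the value at a word is the corresponding derivative of the coefficients of the symmetry with
respect to left invariant frames. -/
def wordSymbol (gr₀ : ℤ → Submodule ℝ m) (B : m →ₗ[ℝ] m →ₗ[ℝ] m) (e : Module.Basis A ℝ m)
    (w : A → ℕ) (d : ℤ) : Submodule ℝ (List A → m) where
  carrier := {φ | (∀ l, φ l ∈ gr₀ (d - wt w l)) ∧
    (∀ l a b l', φ (l ++ a :: b :: l') - φ (l ++ b :: a :: l') =
      e.constr ℝ (fun c => φ (l ++ c :: l')) (B (e a) (e b))) ∧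
    ∀ l b, d < wt w l → φ (l ++ [b]) = B (φ l) (e b)}
  zero_mem' := by
    refine ⟨fun l => Submodule.zero_mem _, fun l a b l' => ?_, fun l b _ => by simp⟩
    have : (fun c : A => (0 : List A → m) (l ++ c :: l')) = 0 := rfl
    rw [this, map_zero]
    simp
  add_mem' := by
    rintro φ ψ ⟨h1, h2, h3⟩ ⟨k1, k2, k3⟩
    refine ⟨fun l => Submodule.add_mem _ (h1 l) (k1 l), fun l a b l' => ?_, fun l b h => ?_⟩
    · have : (fun c => (φ + ψ) (l ++ c :: l')) =
        (fun c => φ (l ++ c :: l')) + fun c => ψ (l ++ c :: l') := rfl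
      rw [this, map_add, LinearMap.add_apply, ← h2, ← k2, Pi.add_apply, Pi.add_apply]
      abel
    · rw [Pi.add_apply, Pi.add_apply, h3 l b h, k3 l b h, map_add, LinearMap.add_apply]
  smul_mem' := by
    rintro r φ ⟨h1, h2, h3⟩
    refine ⟨fun l => Submodule.smul_mem _ r (h1 l), fun l a b l' => ?_, fun l b h => ?_⟩
    · have : (fun c => (r • φ) (l ++ c :: l')) = r • fun c => φ (l ++ c :: l') := rfl
      rw [this, map_smul, LinearMap.smul_apply, ← h2, Pi.smul_apply, Pi.smul_apply, smul_sub]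
    · rw [Pi.smul_apply, Pi.smul_apply, h3 l b h, map_smul, LinearMap.smul_apply]

variable {gr₀ : ℤ → Submodule ℝ m} {B : m →ₗ[ℝ] m →ₗ[ℝ] m} {e : Module.Basis A ℝ m} {w : A → ℕ}

/-- The action of a basis vector on word symbols. -/
def wordShift (b : A) (d : ℤ) : wordSymbol gr₀ B e w d →ₗ[ℝ] wordSymbol gr₀ B e w (d - w b) where
  toFun φ := ⟨fun l => φ.1 (b :: l), by
    obtain ⟨φ, h1, h2, h3⟩ := φ
    refine ⟨fun l => ?_, fun l a c l' => h2 (b :: l) a c l', fun l c h => h3 (b :: l) c ?_⟩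
    · have := h1 (b :: l)
      rwa [wt_cons, Nat.cast_add, ← sub_sub] at this
    · rw [wt_cons]; push_cast; linarith⟩
  map_add' _ _ := rfl
  map_smul' _ _ := rfl

/-- Transport between degrees such as `d - w a - w b` and `d - w b - w a`, which are equal but not
definitionally so. -/
theorem wordMap_congr {V : Type} {τ : ∀ d : ℤ, wordSymbol gr₀ B e w d → V} {d d' : ℤ}
    (hd : d = d') {φ : wordSymbol gr₀ B e w d} {φ' : wordSymbol gr₀ B e w d'}
    (h : φ.1 = φ'.1) : τ d φ = τ d' φ' := by
  subst hd
  rw [Subtype.ext h]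

/-- Evaluation of a family of linear maps on the shifts of a word symbol. -/
def shiftEval {V : Type} [AddCommGroup V] [Module ℝ V]
    (τ : ∀ d : ℤ, wordSymbol gr₀ B e w d →ₗ[ℝ] V) (d : ℤ) :
    wordSymbol gr₀ B e w d →ₗ[ℝ] m →ₗ[ℝ] V :=
  (e.constr ℝ).toLinearMap.comp (LinearMap.pi fun a => (τ (d - w a)).comp (wordShift a d))

theorem shiftEval_basis {V : Type} [AddCommGroup V] [Module ℝ V]
    (τ : ∀ d : ℤ, wordSymbol gr₀ B e w d →ₗ[ℝ] V) (d : ℤ) (φ : wordSymbol gr₀ B e w d) (a : A) :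
    shiftEval τ d φ (e a) = τ (d - w a) (wordShift a d φ) := by
  simp [shiftEval]

/-- The bracket of two basis vectors is a combination of basis vectors of one weight `W`. Shifts
along such a combination stay inside a single degree, hence may be added before `τ` is applied. -/
theorem shiftEval_of_mem_span {V : Type} [AddCommGroup V] [Module ℝ V]
    (τ : ∀ d : ℤ, wordSymbol gr₀ B e w d →ₗ[ℝ] V) (d : ℤ) (φ : wordSymbol gr₀ B e w d) (W : ℕ)
    (v : m) (hv : v ∈ Submodule.span ℝ {v | ∃ a, w a = W ∧ v = e a}) :
    ∃ h : (fun l => e.constr ℝ (fun c => φ.1 (c :: l)) v) ∈ wordSymbol gr₀ B e w (d - W),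
      shiftEval τ d φ v = τ (d - W) ⟨_, h⟩ := by
  induction hv using Submodule.span_induction with
  | mem v hv =>
    obtain ⟨a, rfl, rfl⟩ := hv
    have h : (fun l => e.constr ℝ (fun c => φ.1 (c :: l)) (e a)) = (wordShift a d φ).1 := by
      ext l
      simp
      rfl
    refine ⟨h ▸ (wordShift a d φ).2, ?_⟩
    rw [shiftEval_basis]
    congr 1
    exact Subtype.ext h.symm
  | zero =>
    have h : (fun l => e.constr ℝ (fun c => φ.1 (c :: l)) 0) = (0 : List A → m) := by
      ext l; simp
    refine ⟨h ▸ Submodule.zero_mem _, ?_⟩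
    rw [map_zero, eq_comm]
    convert map_zero (τ (d - W)) using 2
    exact Subtype.ext h
  | add v v' _ _ hv hv' =>
    obtain ⟨h1, h2⟩ := hv
    obtain ⟨h3, h4⟩ := hv'
    have h : (fun l => e.constr ℝ (fun c => φ.1 (c :: l)) (v + v')) =
        (fun l => e.constr ℝ (fun c => φ.1 (c :: l)) v) +
        fun l => e.constr ℝ (fun c => φ.1 (c :: l)) v' := by
      ext l; simp
    refine ⟨h ▸ Submodule.add_mem _ h1 h3, ?_⟩
    rw [map_add, h2, h4, ← map_add]
    congr 1
    exact Subtype.ext h.symm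
  | smul r v _ hv =>
    obtain ⟨h1, h2⟩ := hv
    have h : (fun l => e.constr ℝ (fun c => φ.1 (c :: l)) (r • v)) =
        r • (fun l => e.constr ℝ (fun c => φ.1 (c :: l)) v) := by
      ext l; simp
    refine ⟨h ▸ Submodule.smul_mem _ r h1, ?_⟩
    rw [map_smul, h2, ← map_smul]
    congr 1
    exact Subtype.ext h.symm

/-- The compatibility of a basis with a negative grading and a graded bracket. -/
structure GradedBasis (gr₀ : ℤ → Submodule ℝ m) (B : m →ₗ[ℝ] m →ₗ[ℝ] m)
    (e : Module.Basis A ℝ m) (w : A → ℕ) : Prop where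
  pos : ∀ a, 0 < w a
  mem : ∀ a b, B (e a) (e b) ∈ gr₀ (-((w a + w b : ℕ) : ℤ))
  span : ∀ d, gr₀ d = Submodule.span ℝ {v | ∃ a, -(w a : ℤ) = d ∧ v = e a}

namespace GradedBasis

variable (H : GradedBasis gr₀ B e w)
include H

theorem gr_nonneg {d : ℤ} (hd : 0 ≤ d) {v : m} (hv : v ∈ gr₀ d) : v = 0 := by
  rw [H.span, Submodule.mem_span] at hv
  refine (Submodule.mem_bot ℝ).1 (hv ⊥ ?_)
  rintro _ ⟨a, ha, -⟩
  have := H.pos a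
  omega

theorem mem_span_bracket (a b : A) :
    B (e a) (e b) ∈ Submodule.span ℝ {v | ∃ c, w c = w a + w b ∧ v = e c} := by
  have h := H.mem a b
  rw [H.span] at h
  refine Submodule.span_mono ?_ h
  rintro _ ⟨c, hc, rfl⟩
  exact ⟨c, by omega, rfl⟩

/-- If in degrees below `k` bracketing with `e b` is the shift by `b`, then the Leibniz identity on
`e a`, `e b` compares the two double shifts with the shift along `B (e a) (e b)`. This is the
commutation rule of `φ` for the first two letters. -/
theorem shiftEval_mem_symbol {S : Stage m} {k : ℕ}
    (τ : ∀ d : ℤ, wordSymbol gr₀ B e w d →ₗ[ℝ] S.V)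
    (hτ : ∀ d < (k : ℤ), ∀ φ, τ d φ ∈ S.gr d ∧
      ∀ b, S.act (τ d φ) (e b) = τ (d - w b) (wordShift b d φ))
    (φ : wordSymbol gr₀ B e w k) : shiftEval τ k φ ∈ symbol gr₀ B S k := by
  constructor
  · intro d X hX
    rw [H.span] at hX
    have h : Submodule.span ℝ {v | ∃ a, -(w a : ℤ) = d ∧ v = e a} ≤
        (S.gr (d + k)).comap (shiftEval τ k φ) := by
      rw [Submodule.span_le]
      rintro _ ⟨a, rfl, rfl⟩
      rw [SetLike.mem_coe, Submodule.mem_comap, shiftEval_basis]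
      have := (hτ (k - w a) (by have := H.pos a; omega) (wordShift a k φ)).1
      rwa [neg_add_eq_sub]
    exact h hX
  · have key : (LinearMap.compr₂ B (shiftEval τ k φ)) =
        S.act.comp (shiftEval τ k φ) - (S.act.comp (shiftEval τ k φ)).flip := by
      refine e.ext fun a => e.ext fun b => ?_
      simp only [LinearMap.compr₂_apply, LinearMap.sub_apply, LinearMap.comp_apply,
        LinearMap.flip_apply, shiftEval_basis]
      have ha := H.pos a
      have hb := H.pos b
      rw [(hτ (k - w a) (by omega) _).2 b, (hτ (k - w b) (by omega) _).2 a]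
      obtain ⟨h1, h2⟩ := shiftEval_of_mem_span τ k φ _ _ (H.mem_span_bracket a b)
      rw [h2]
      have e1 : (k : ℤ) - w b - w a = k - (w a + w b : ℕ) := by push_cast; ring
      have e2 : (k : ℤ) - w a - w b = k - (w a + w b : ℕ) := by push_cast; ring
      have m1 : (wordShift b (k - w a) (wordShift a k φ)).1 ∈
          wordSymbol gr₀ B e w (k - (w a + w b : ℕ)) :=
        e2 ▸ (wordShift b (k - w a) (wordShift a k φ)).2
      have m2 : (wordShift a (k - w b) (wordShift b k φ)).1 ∈
          wordSymbol gr₀ B e w (k - (w a + w b : ℕ)) :=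
        e1 ▸ (wordShift a (k - w b) (wordShift b k φ)).2
      rw [wordMap_congr (τ := fun d φ => τ d φ) (φ' := ⟨_, m1⟩) e2 rfl,
        wordMap_congr (τ := fun d φ => τ d φ) (φ' := ⟨_, m2⟩) e1 rfl, ← map_sub]
      congr 1
      refine Subtype.ext (funext fun l => ?_)
      -- The commutation rule with empty prefix.
      exact (φ.2.2.1 [] a b l).symm
    intro X Y
    exact LinearMap.congr_fun (LinearMap.congr_fun key X) Y

/-- Recursion on the stage: degrees below `k` keep the old map, and a symbol of degree `k` goes to
the linear map whose value at `e a` is the image of its shift by `a`, in degree `k - w a < k`. In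
negative degrees a word symbol is recorded by its value on the empty word; the third defining
condition makes this compatible with the bracket of `m`. The last clause makes the injectivity of
the resulting embedding provable letter by letter. -/
theorem exists_wordMap (k : ℕ) :
    ∃ τ : ∀ d : ℤ, wordSymbol gr₀ B e w d →ₗ[ℝ] (stage gr₀ B k).V,
      ∀ d < (k : ℤ), ∀ φ, (τ d φ ∈ (stage gr₀ B k).gr d ∧
        ∀ b, (stage gr₀ B k).act (τ d φ) (e b) = τ (d - w b) (wordShift b d φ)) ∧
        (τ d φ = 0 → φ.1 [] = 0) := by
  classical
  induction k with
  | zero =>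
    -- The sign is a convention: all the conditions on `τ` are linear, so either choice works.
    refine ⟨fun d => -((LinearMap.proj (φ := fun _ : List A => m) []).comp
      (wordSymbol gr₀ B e w d).subtype), fun d hd φ => ⟨⟨?_, fun b => ?_⟩, fun h => ?_⟩⟩
    · have := φ.2.1 []
      simp only [wt_nil, Nat.cast_zero, sub_zero] at this
      exact Submodule.neg_mem _ this
    · have := φ.2.2.2 [] b (by simpa using hd)
      change B (-(φ.1 [])) (e b) = -(φ.1 [b])
      rw [map_neg, LinearMap.neg_apply]
      exact congrArg _ this.symm
    · exact neg_eq_zero.1 h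
  | succ k ih =>
    obtain ⟨τ, hτ⟩ := ih
    have hsym : ∀ d : ℤ, d = k → ∀ φ : wordSymbol gr₀ B e w d,
        shiftEval τ d φ ∈ symbol gr₀ B (stage gr₀ B k) k := by
      rintro _ rfl φ
      exact H.shiftEval_mem_symbol τ (fun d hd φ => (hτ d hd φ).1) φ
    let τ' : ∀ d : ℤ, wordSymbol gr₀ B e w d →ₗ[ℝ]
        (stage gr₀ B k).V × ↥(symbol gr₀ B (stage gr₀ B k) k) := fun d =>
      if h : d = k then
        (LinearMap.inr ℝ _ _).comp ((shiftEval τ d).codRestrict _ (hsym d h))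
      else (LinearMap.inl ℝ _ _).comp (τ d)
    have hlt : ∀ d : ℤ, d < k → ∀ φ, τ' d φ = (τ d φ, 0) := by
      intro d hd φ
      simp only [τ', dif_neg hd.ne]
      rfl
    have heq : ∀ φ : wordSymbol gr₀ B e w k, τ' k φ = (0, ⟨shiftEval τ k φ, hsym k rfl φ⟩) := by
      intro φ
      simp only [τ', dif_pos]
      rfl
    have key : ∀ d < ((k + 1 : ℕ) : ℤ), ∀ φ,
        (τ' d φ ∈ ((stage gr₀ B k).gr d).prod (if d = (k : ℤ) then ⊤ else ⊥) ∧
        ∀ b, ((stage gr₀ B k).act (τ' d φ).1 (e b) + (τ' d φ).2.1 (e b), 0) =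
          τ' (d - w b) (wordShift b d φ)) ∧ (τ' d φ = 0 → φ.1 [] = 0) := by
      intro d hd φ
      rcases (show d ≤ k by push_cast at hd; omega).lt_or_eq with h | rfl
      · rw [hlt d h]
        refine ⟨⟨⟨(hτ d h φ).1.1, Submodule.zero_mem _⟩, fun b => ?_⟩, fun h0 => ?_⟩
        · rw [hlt _ (by omega), (hτ d h φ).1.2 b]
          simp
        · exact (hτ d h φ).2 (congrArg Prod.fst h0)
      · rw [heq]
        refine ⟨⟨⟨Submodule.zero_mem _, ?_⟩, fun b => ?_⟩, fun h0 => ?_⟩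
        · simp
        · rw [hlt _ (by have := H.pos b; omega)]
          simp [shiftEval_basis]
        · exact H.gr_nonneg (by simp) (φ.2.1 [])
    exact ⟨τ', key⟩

/-- Word symbols of degree `k` embed into the `k`-th Tanaka prolongation. -/
theorem exists_wordSymbol_injective (k : ℕ) :
    ∃ f : wordSymbol gr₀ B e w k →ₗ[ℝ] symbol gr₀ B (stage gr₀ B k) k, Function.Injective f := by
  obtain ⟨τ, hτ⟩ := H.exists_wordMap k
  refine ⟨(shiftEval τ k).codRestrict _
    (H.shiftEval_mem_symbol τ fun d hd φ => (hτ d hd φ).1), ?_⟩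
  -- Bracketing with the first letter replaces `φ` by its shift, so a zero image propagates along
  -- the whole word.
  have hinj : ∀ (l : List A) (d : ℤ), d < k → ∀ φ : wordSymbol gr₀ B e w d,
      τ d φ = 0 → φ.1 l = 0 := by
    intro l
    induction l with
    | nil => exact fun d hd φ => (hτ d hd φ).2
    | cons b l ih =>
      intro d hd φ h
      refine ih (d - w b) (by omega) (wordShift b d φ) ?_
      rw [← (hτ d hd φ).1.2 b, h, map_zero, LinearMap.zero_apply]
  rw [injective_iff_map_eq_zero]
  intro φ h
  have h0 : shiftEval τ k φ = 0 := congrArg Subtype.val h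
  refine Subtype.ext (funext fun l => ?_)
  cases l with
  | nil => exact H.gr_nonneg (by simp) (φ.2.1 [])
  | cons b l =>
    have := H.pos b
    refine hinj l (k - w b) (by omega) (wordShift b k φ) ?_
    rw [← shiftEval_basis, h0, LinearMap.zero_apply]

end GradedBasis

end WordSymbols

/-! ### Weighted order of vanishing -/

section WeightedOrder

variable {R : Type*} [CommRing R] [Algebra ℝ R] (ε : R →ₐ[ℝ] ℝ) {A : Type}
  (E : A → Derivation ℝ R R)

/-- The composition `E_{a₁} ∘ ⋯ ∘ E_{aₛ}` of derivations along a word. -/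
def wordOp (l : List A) : R →ₗ[ℝ] R :=
  l.foldr (fun a T => (E a : R →ₗ[ℝ] R).comp T) LinearMap.id

@[simp] theorem wordOp_nil (f : R) : wordOp E [] f = f := rfl

@[simp] theorem wordOp_cons (a : A) (l : List A) (f : R) :
    wordOp E (a :: l) f = E a (wordOp E l f) := rfl

theorem wordOp_append (l l' : List A) (f : R) :
    wordOp E (l ++ l') f = wordOp E l (wordOp E l' f) := by
  induction l with
  | nil => rfl
  | cons a l ih => simp [ih]

/-- The last letter of a word acts first. By Leibniz it falls on `g`, shortening the word, or on
`f`, lowering both the bound `k` and the weight of the word by `w a`. This is what makes the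
functions of given weighted order an ideal. -/
theorem eval_wordOp_mul (w : A → ℕ) (l : List A) : ∀ (k : ℕ) (f g : R), wt w l < k →
    (∀ l', wt w l' < k → ε (wordOp E l' f) = 0) → ε (wordOp E l (g * f)) = 0 := by
  induction l using List.reverseRecOn with
  | nil =>
    intro k f g hl hf
    have := hf [] hl
    simp only [wordOp_nil] at this ⊢
    rw [map_mul, this, mul_zero]
  | append_singleton l a ih =>
    intro k f g hl hf
    rw [wt_append, wt_cons, wt_nil] at hl
    rw [wordOp_append, wordOp_cons, wordOp_nil, Derivation.leibniz, map_add, map_add, smul_eq_mul,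
      smul_eq_mul, mul_comm f, ih k f (E a g) (by omega) hf, add_zero]
    refine ih (k - w a) (E a f) g (by omega) fun l' hl' => ?_
    have := hf (l' ++ [a]) (by rw [wt_append, wt_cons, wt_nil]; omega)
    rwa [wordOp_append] at this

/-- The functions of weighted order at least `k`. -/
def wOrd (w : A → ℕ) (k : ℕ) : Ideal R where
  carrier := {f | ∀ l, wt w l < k → ε (wordOp E l f) = 0}
  zero_mem' := fun l _ => by simp
  add_mem' := fun hf hg l hl => by rw [map_add, map_add, hf l hl, hg l hl, add_zero]
  smul_mem' := fun g f hf l hl => eval_wordOp_mul ε E w l k f g hl hf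

variable {ε E} {w : A → ℕ}

theorem wOrd_anti {k k' : ℕ} (h : k ≤ k') : wOrd ε E w k' ≤ wOrd ε E w k :=
  fun _ hf l hl => hf l (hl.trans_le h)

theorem wOrd_zero : wOrd ε E w 0 = ⊤ := by
  rw [eq_top_iff]
  exact fun f _ l hl => absurd hl (Nat.not_lt_zero _)

theorem wordOp_mem_wOrd {k : ℕ} {f : R} (hf : f ∈ wOrd ε E w k) (l : List A) :
    wordOp E l f ∈ wOrd ε E w (k - wt w l) := by
  intro l' hl'
  rw [← wordOp_append]
  exact hf _ (by rw [wt_append]; omega)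

theorem deriv_mem_wOrd {k : ℕ} {f : R} (hf : f ∈ wOrd ε E w k) (a : A) :
    E a f ∈ wOrd ε E w (k - w a) := by
  simpa using wordOp_mem_wOrd hf [a]

theorem mem_wOrd_succ_iff {k : ℕ} {f : R} :
    f ∈ wOrd ε E w (k + 1) ↔ ε f = 0 ∧ ∀ a, E a f ∈ wOrd ε E w (k + 1 - w a) := by
  refine ⟨fun h => ⟨h [] (by simp), fun a => deriv_mem_wOrd h a⟩, fun ⟨h0, h⟩ l => ?_⟩
  induction l using List.reverseRecOn with
  | nil => exact fun _ => h0
  | append_singleton l a =>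
    intro hl
    rw [wordOp_append]
    exact h a l (by simp at hl; omega)

/-- A letter that falls on `g` leaves for `f` a word of weight below its order, because weights are
positive. Only the term with all letters on `f` survives evaluation. -/
theorem eval_wordOp_mul_leading (hw : ∀ a, 0 < w a) (l : List A) : ∀ (f g : R),
    f ∈ wOrd ε E w (wt w l) → ε (wordOp E l (f * g)) = ε (wordOp E l f) * ε g := by
  induction l using List.reverseRecOn with
  | nil => intro f g _; simp
  | append_singleton l a ih =>
    intro f g hf
    have ha := hw a
    have h1 : ε (wordOp E l (f * E a g)) = 0 := by
      rw [mul_comm]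
      exact (Ideal.mul_mem_left _ (E a g) hf) l (by simp; omega)
    have h2 : E a f ∈ wOrd ε E w (wt w l) := by
      have := deriv_mem_wOrd hf a
      simpa using this
    rw [wordOp_append, wordOp_append, wordOp_cons, wordOp_nil, Derivation.leibniz, map_add, map_add,
      smul_eq_mul, smul_eq_mul, h1, zero_add, mul_comm g, ih _ _ h2]
    rfl

/-- The functions of order at least `k` in the usual sense, with all derivations of weight one. -/
abbrev jOrd (ε : R →ₐ[ℝ] ℝ) (E : A → Derivation ℝ R R) (k : ℕ) : Ideal R :=
  wOrd ε E (fun _ => 1) k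

theorem wt_one (l : List A) : wt (fun _ => 1) l = l.length := by
  induction l with
  | nil => rfl
  | cons a l ih => rw [wt_cons, ih, List.length_cons, add_comm]

theorem length_le_wt (hw : ∀ a, 0 < w a) (l : List A) : l.length ≤ wt w l := by
  induction l with
  | nil => simp
  | cons a l ih => have := hw a; simp; omega

theorem wt_le_length_mul {κ : ℕ} (hw : ∀ a, w a ≤ κ) (l : List A) : wt w l ≤ l.length * κ := by
  induction l with
  | nil => simp
  | cons a l ih => have := hw a; rw [wt_cons, List.length_cons, Nat.succ_mul]; omega

theorem jOrd_le_wOrd (hw : ∀ a, 0 < w a) (k : ℕ) : jOrd ε E k ≤ wOrd ε E w k :=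
  fun _ hf l hl => hf l (by rw [wt_one]; exact (length_le_wt hw l).trans_lt hl)

/-- A word of at most `j` letters weighs at most `j * κ`, hence less than `j * κ + 1`. -/
theorem wOrd_le_jOrd {κ : ℕ} (hw : ∀ a, w a ≤ κ) (j : ℕ) :
    wOrd ε E w (j * κ + 1) ≤ jOrd ε E (j + 1) := by
  intro f hf l hl
  rw [wt_one] at hl
  refine hf l ?_
  have h1 := wt_le_length_mul hw l
  have h2 : l.length * κ ≤ j * κ := Nat.mul_le_mul_right _ (by omega)
  omega

end WeightedOrder

/-! ### Weighted frames, the symmetry equation and leading parts -/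

section Frames

variable {R : Type*} [CommRing R] [Algebra ℝ R] {A : Type} [Fintype A] [DecidableEq A]

/-- The derivation with given coefficients. -/
def vec (E : A → Derivation ℝ R R) : (A → R) →ₗ[R] Derivation ℝ R R where
  toFun f := ∑ a, f a • E a
  map_add' f g := by simp [add_smul, Finset.sum_add_distrib]
  map_smul' r f := by simp [mul_smul, Finset.smul_sum]

theorem vec_apply (E : A → Derivation ℝ R R) (f : A → R) (g : R) :
    vec E f g = ∑ a, f a * E a g := by
  have h := congrFun (map_sum (Derivation.coeFnAddMonoidHom (R := ℝ) (A := R) (M := R))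
    (fun a => f a • E a) Finset.univ) g
  rw [Finset.sum_apply] at h
  exact h

theorem vec_single (E : A → Derivation ℝ R R) (b : A) : vec E (Pi.single b 1) = E b := by
  ext g
  rw [vec_apply, Finset.sum_eq_single b]
  · simp
  · intro a _ h; simp [h]
  · simp

/-- The bracket of vector fields in terms of their coefficients with respect to a frame with
structure functions `C`. -/
def tupleBr (E : A → Derivation ℝ R R) (C : A → A → A → R) (f g : A → R) (c : A) : R :=
  vec E f (g c) - vec E g (f c) + ∑ a, ∑ b, f a * g b * C a b c

theorem vec_tupleBr (E : A → Derivation ℝ R R) (C : A → A → A → R)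
    (hC : ∀ a b, ⁅E a, E b⁆ = ∑ c, C a b c • E c) (f g : A → R) :
    vec E (tupleBr E C f g) = ⁅vec E f, vec E g⁆ := by
  have hC' : ∀ a b h, E a (E b h) - E b (E a h) = ∑ c, C a b c * E c h := by
    intro a b h
    rw [← Derivation.commutator_apply, hC]
    exact vec_apply E (C a b) h
  ext h
  rw [Derivation.commutator_apply]
  simp only [vec_apply, tupleBr, map_sum, Derivation.leibniz, smul_eq_mul, add_mul, sub_mul,
    Finset.sum_add_distrib, Finset.sum_sub_distrib, Finset.mul_sum, Finset.sum_mul]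
  have h1 : ∑ c, ∑ a, ∑ b, f a * g b * C a b c * E c h =
      ∑ b, ∑ a, g b * (f a * E a (E b h)) - ∑ a, ∑ b, f a * (g b * E b (E a h)) := by
    rw [Finset.sum_comm (s := Finset.univ) (t := Finset.univ)
      (f := fun b a => g b * (f a * E a (E b h))), ← Finset.sum_sub_distrib, Finset.sum_comm]
    refine Finset.sum_congr rfl fun a _ => ?_
    rw [← Finset.sum_sub_distrib, Finset.sum_comm]
    refine Finset.sum_congr rfl fun b _ => ?_
    have : g b * (f a * E a (E b h)) - f a * (g b * E b (E a h)) =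
        f a * g b * (E a (E b h) - E b (E a h)) := by ring
    rw [this, hC', Finset.mul_sum]
    exact Finset.sum_congr rfl fun c _ => by ring
  have h2 : ∀ f g : A → R, ∑ c, ∑ a, f a * E a (g c) * E c h =
      ∑ c, ∑ a, E c h * (f a * E a (g c)) := fun f g =>
    Finset.sum_congr rfl fun _ _ => Finset.sum_congr rfl fun _ _ => by ring
  rw [h1, h2 f g, h2 g f]
  abel

/-- Used in the reverse direction: it expresses the derivative `E b (f c)` through undifferentiated
coefficients and the bracket with the frame field. -/
theorem tupleBr_single (E : A → Derivation ℝ R R) (C : A → A → A → R) (f : A → R) (b c : A) :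
    tupleBr E C f (Pi.single b 1) c = ∑ a, f a * C a b c - E b (f c) := by
  have h1 : vec E f (Pi.single (M := fun _ => R) b 1 c) = 0 := by
    by_cases h : c = b
    · subst h; simp
    · simp [h]
  have h2 : ∀ a, ∑ b', f a * Pi.single (M := fun _ => R) b 1 b' * C a b' c = f a * C a b c := by
    intro a
    rw [Finset.sum_eq_single b]
    · simp
    · intro b' _ h; simp [h]
    · simp
  rw [tupleBr, h1, vec_single]
  simp only [h2]
  ring

/-- A frame adapted to a filtration generated by its part of weight one. -/
structure WeightedFrame (E : A → Derivation ℝ R R) (C : A → A → A → R) (w : A → ℕ) (κ : ℕ) :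
    Prop where
  pos : ∀ a, 0 < w a
  le : ∀ a, w a ≤ κ
  lie : ∀ a b, ⁅E a, E b⁆ = ∑ c, C a b c • E c
  graded : ∀ a b c, w a + w b < w c → C a b c = 0
  gen : ∀ a, 2 ≤ w a → ∃ y z : A → R, (∀ b, w b ≠ 1 → y b = 0) ∧ (∀ b, w a ≤ w b → z b = 0) ∧
    E a = ⁅vec E y, vec E z⁆

namespace WeightedFrame

variable {ε : R →ₐ[ℝ] ℝ} {E : A → Derivation ℝ R R} {C : A → A → A → R} {w : A → ℕ} {κ : ℕ}
  (H : WeightedFrame E C w κ)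
include H

/-- Strong induction on the weight: a heavier frame field is a commutator `[Y, Z]` with `Y` of
weight one and `Z` of smaller weight, and each of `Y (Z f)`, `Z (Y f)` loses no more order than `w
a` allows. -/
theorem deriv_mem_of_weight_one {f : R} {i : ℕ} (h : ∀ b, w b = 1 → E b f ∈ wOrd ε E w i) (a : A) :
    E a f ∈ wOrd ε E w (i + 1 - w a) := by
  induction hp : w a using Nat.strong_induction_on generalizing a with
  | _ p ih =>
    subst hp
    rcases (show w a = 1 ∨ 2 ≤ w a by have := H.pos a; omega) with h1 | h2
    · rw [h1]; exact h a h1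
    · obtain ⟨y, z, hy, hz, hE⟩ := H.gen a h2
      rw [hE, Derivation.commutator_apply]
      refine Ideal.sub_mem _ ?_ ?_
      · have hZ : vec E z f ∈ wOrd ε E w (i + 1 - (w a - 1)) := by
          rw [vec_apply]
          refine Ideal.sum_mem _ fun b _ => ?_
          by_cases hb : w a ≤ w b
          · rw [hz b hb, zero_mul]; exact Ideal.zero_mem _
          · exact Ideal.mul_mem_left _ _ (wOrd_anti (by omega) (ih (w b) (by omega) b rfl))
        rw [vec_apply]
        refine Ideal.sum_mem _ fun b _ => ?_
        by_cases hb : w b = 1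
        · exact Ideal.mul_mem_left _ _ (wOrd_anti (by omega) (deriv_mem_wOrd hZ b))
        · rw [hy b hb, zero_mul]; exact Ideal.zero_mem _
      · have hY : vec E y f ∈ wOrd ε E w i := by
          rw [vec_apply]
          refine Ideal.sum_mem _ fun b _ => ?_
          by_cases hb : w b = 1
          · exact Ideal.mul_mem_left _ _ (h b hb)
          · rw [hy b hb, zero_mul]; exact Ideal.zero_mem _
        rw [vec_apply]
        refine Ideal.sum_mem _ fun b _ => ?_
        by_cases hb : w a ≤ w b
        · rw [hz b hb, zero_mul]; exact Ideal.zero_mem _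
        · exact Ideal.mul_mem_left _ _ (wOrd_anti (by omega) (deriv_mem_wOrd hY b))

/-- The weighted order is detected by derivations of weight one. -/
theorem mem_wOrd_succ_of_weight_one {f : R} {i : ℕ} (h0 : ε f = 0)
    (h : ∀ b, w b = 1 → E b f ∈ wOrd ε E w i) : f ∈ wOrd ε E w (i + 1) :=
  mem_wOrd_succ_iff.2 ⟨h0, H.deriv_mem_of_weight_one h⟩

/-- Only `vec E y` differentiates `f`, and it has weight one; the other terms contain `f`
undifferentiated. So a bracket with a section of Δ costs one order. -/
theorem tupleBr_mem_wOrd {f y : A → R} {i : ℕ} (hf : ∀ c, f c ∈ wOrd ε E w (i + 1))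
    (hy : ∀ b, w b ≠ 1 → y b = 0) (c : A) : tupleBr E C f y c ∈ wOrd ε E w i := by
  have hf' : ∀ c, f c ∈ wOrd ε E w i := fun c => wOrd_anti (Nat.le_succ i) (hf c)
  refine Ideal.add_mem _ (Ideal.sub_mem _ ?_ ?_) ?_
  · rw [vec_apply]
    exact Ideal.sum_mem _ fun a _ => Ideal.mul_mem_right _ _ (hf' a)
  · rw [vec_apply]
    refine Ideal.sum_mem _ fun b _ => ?_
    by_cases hb : w b = 1
    · have := deriv_mem_wOrd (hf c) b
      rw [hb] at this
      exact Ideal.mul_mem_left _ _ this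
    · rw [hy b hb, zero_mul]; exact Ideal.zero_mem _
  · exact Ideal.sum_mem _ fun a _ => Ideal.sum_mem _ fun b _ =>
      Ideal.mul_mem_right _ _ (Ideal.mul_mem_right _ _ (hf' a))

theorem eval_foldl_tupleBr {i : ℕ} (l : List (A → R)) (hl : l.length ≤ i)
    (hy : ∀ y ∈ l, ∀ b, w b ≠ 1 → y b = 0) : ∀ {f : A → R}, (∀ c, f c ∈ wOrd ε E w (i + 1)) →
    ∀ c, ε (l.foldl (tupleBr E C) f c) = 0 := by
  induction l generalizing i with
  | nil => exact fun hf c => hf c [] (by simp)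
  | cons y l ih =>
    intro f hf c
    obtain ⟨i, rfl⟩ : ∃ i', i = i' + 1 := ⟨i - 1, by simp at hl; omega⟩
    refine ih (i := i) (by simpa using hl) (fun z hz => hy z (by simp [hz])) ?_ c
    exact H.tupleBr_mem_wOrd hf (hy y (by simp))

/-- By induction both `f` and its bracket with a frame field of weight one have order `i + 1`. Their
difference in `tupleBr_single` is a derivative of weight one, and such derivatives detect the
weighted order. -/
theorem mem_wOrd_of_eval_foldl {i : ℕ} : ∀ {f : A → R},
    (∀ l : List A, l.length ≤ i → (∀ b ∈ l, w b = 1) →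
      ∀ c, ε ((l.map fun b => Pi.single b 1).foldl (tupleBr E C) f c) = 0) →
    ∀ c, f c ∈ wOrd ε E w (i + 1) := by
  induction i with
  | zero =>
    intro f h c
    refine mem_wOrd_succ_iff.2 ⟨h [] (by simp) (by simp) c, fun a => ?_⟩
    rw [Nat.sub_eq_zero_of_le (H.pos a), wOrd_zero]
    trivial
  | succ i ih =>
    intro f h c
    have hf := ih (f := f) fun l hl hb => h l (by omega) hb
    refine H.mem_wOrd_succ_of_weight_one (h [] (by simp) (by simp) c) fun b hb => ?_
    have h1 := ih (f := tupleBr E C f (Pi.single b 1))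
      (fun l hl hb' => h (b :: l) (by simpa using hl) (by simpa [hb] using hb')) c
    rw [tupleBr_single] at h1
    have h2 : ∑ a, f a * C a b c ∈ wOrd ε E w (i + 1) :=
      Ideal.sum_mem _ fun a _ => Ideal.mul_mem_right _ _ (hf a)
    have h3 := Ideal.sub_mem _ h2 h1
    rwa [sub_sub_cancel] at h3

/-- An infinitesimal symmetry of the filtration up to sufficiently high order whose coefficients
have weighted order at least `i + 1` has weighted degree at least `i`. -/
theorem mem_wOrd_add_weight {f : A → R} {i k : ℕ} (hk : i + κ ≤ k)
    (hf : ∀ c, f c ∈ wOrd ε E w (i + 1))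
    (hs : ∀ b c, w b < w c → tupleBr E C f (Pi.single b 1) c ∈ wOrd ε E w (k + 1)) (c : A) :
    f c ∈ wOrd ε E w (i + w c) := by
  suffices h : ∀ v : ℕ, ∀ c, v ≤ w c → f c ∈ wOrd ε E w (i + v) from h _ c le_rfl
  intro v
  induction v with
  | zero => exact fun c _ => wOrd_anti (by omega) (hf c)
  | succ v ih =>
    intro c hc
    -- The gain from `i` to `i + 1` is the hypothesis. After that `w c > 1 = w b`, so the symmetry
    -- equation applies, and gradedness leaves only coefficients `f a` with `w a ≥ w c - 1 ≥ v`.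
    rcases Nat.eq_zero_or_pos v with rfl | hv
    · exact hf c
    have hcκ := H.le c
    refine H.mem_wOrd_succ_of_weight_one (hf c [] (by simp)) fun b hb => ?_
    have h1 := hs b c (by omega)
    rw [tupleBr_single] at h1
    have h1 := wOrd_anti (k := i + v) (by omega) h1
    have h2 : ∑ a, f a * C a b c ∈ wOrd ε E w (i + v) := by
      refine Ideal.sum_mem _ fun a _ => ?_
      by_cases ha : w a + w b < w c
      · rw [H.graded a b c ha, mul_zero]; exact Ideal.zero_mem _
      · exact Ideal.mul_mem_right _ _ (ih a (by omega))
    have h3 := Ideal.sub_mem _ h2 h1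
    rwa [sub_sub_cancel] at h3

/-- Heavier `c` are excluded since the structure functions respect the weights. Lighter `c` give
words too light to be seen by `f`. For equal weight only the value of `C a b c` at the point
matters. -/
theorem eval_wordOp_comm {f : R} (l l' : List A) (a b : A)
    (hf : f ∈ wOrd ε E w (wt w (l ++ a :: b :: l'))) :
    ε (wordOp E (l ++ a :: b :: l') f) - ε (wordOp E (l ++ b :: a :: l') f) =
      ∑ c, if w c = w a + w b then ε (C a b c) * ε (wordOp E (l ++ c :: l') f) else 0 := by
  have h1 : ∀ g : R, E a (E b g) - E b (E a g) = ∑ c, E c g * C a b c := by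
    intro g
    rw [← Derivation.commutator_apply, H.lie]
    refine (vec_apply E (C a b) g).trans (Finset.sum_congr rfl fun c _ => mul_comm _ _)
  rw [← map_sub, wordOp_append, wordOp_append, ← map_sub]
  simp only [wordOp_cons]
  rw [h1, map_sum, map_sum]
  refine Finset.sum_congr rfl fun c _ => ?_
  have h2 := wordOp_mem_wOrd hf (c :: l')
  simp only [wt_append, wt_cons, wordOp_cons] at h2
  rw [wordOp_append, wordOp_cons]
  split_ifs with hc
  · rw [eval_wordOp_mul_leading H.pos, mul_comm]
    exact wOrd_anti (by omega) h2
  · by_cases hc' : w a + w b < w c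
    · rw [H.graded a b c hc']; simp
    · have h3 := Ideal.mul_mem_right (C a b c) _ h2
      exact h3 l (by omega)

variable {m : Type} [AddCommGroup m] [Module ℝ m] {gr₀ : ℤ → Submodule ℝ m}
  {B : m →ₗ[ℝ] m →ₗ[ℝ] m} {e : Module.Basis A ℝ m}

omit H in
variable (ε E w e) in
/-- The leading part of degree `i` of a vector field with the given coefficients, as a function of
words. -/
def leading (i : ℕ) : (A → R) →ₗ[ℝ] List A → m :=
  LinearMap.pi fun l => ∑ c, if w c + i = wt w l then
    (((ε.toLinearMap.comp (wordOp E l)).comp (LinearMap.proj c)).smulRight (e c)) else 0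

omit H in
theorem leading_apply (i : ℕ) (f : A → R) (l : List A) :
    leading ε E w e i f l = ∑ c, if w c + i = wt w l then ε (wordOp E l (f c)) • e c else 0 := by
  simp only [leading, LinearMap.pi_apply, LinearMap.sum_apply]
  refine Finset.sum_congr rfl fun c _ => ?_
  split_ifs <;> rfl

/-- The grading is built into the leading part. Swapping letters is the commutator relation of the
frame, whose leading structure constants are those of `B` by `hBC`. The rule for appending a letter
is the leading part of the symmetry equation. -/
theorem leading_mem_wordSymbol (hB : GradedBasis gr₀ B e w)
    (hBC : ∀ a b, B (e a) (e b) = ∑ c, if w c = w a + w b then ε (C a b c) • e c else 0)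
    {f : A → R} {i k : ℕ} (hk : i + κ ≤ k) (hf : ∀ c, f c ∈ wOrd ε E w (i + w c))
    (hs : ∀ b c, w b < w c → tupleBr E C f (Pi.single b 1) c ∈ wOrd ε E w (k + 1)) :
    leading ε E w e i f ∈ wordSymbol gr₀ B e w i := by
  refine ⟨fun l => ?_, fun l a b l' => ?_, fun l b hl => ?_⟩
  · rw [leading_apply]
    refine Submodule.sum_mem _ fun c _ => ?_
    split_ifs with hc
    · refine Submodule.smul_mem _ _ ?_
      rw [hB.span]
      exact Submodule.subset_span ⟨c, by omega, rfl⟩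
    · exact Submodule.zero_mem _
  · rw [hBC, map_sum]
    simp only [apply_ite (e.constr ℝ _), map_smul, Module.Basis.constr_basis, map_zero]
    simp only [leading_apply, wt_append, wt_cons]
    rw [← Finset.sum_sub_distrib]
    have h1 : ∀ c, ((if w c = w a + w b then
        ε (C a b c) • ∑ c', (if w c' + i = wt w l + (w c + wt w l') then
          ε (wordOp E (l ++ c :: l') (f c')) • e c' else 0) else 0) : m) =
        ∑ c', if w c' + i = wt w l + (w a + (w b + wt w l')) then
          (if w c = w a + w b then ε (C a b c) * ε (wordOp E (l ++ c :: l') (f c')) else 0) • e c'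
          else 0 := by
      intro c
      split_ifs with hc
      · rw [Finset.smul_sum, hc, add_assoc]
        refine Finset.sum_congr rfl fun c' _ => ?_
        split_ifs <;> simp [mul_smul]
      · simp
    simp only [h1]
    rw [Finset.sum_comm]
    refine Finset.sum_congr rfl fun c' _ => ?_
    have h2 : w c' + i = wt w l + (w b + (w a + wt w l')) ↔
        w c' + i = wt w l + (w a + (w b + wt w l')) := by omega
    simp only [h2]
    split_ifs with hc
    · rw [← sub_smul, H.eval_wordOp_comm, Finset.sum_smul]
      refine wOrd_anti ?_ (hf c')
      simp only [wt_append, wt_cons]; omega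
    · simp
  -- A component `c` that occurs satisfies `w c + i = wt w l + w b`, so `i < wt w l` says exactly
  -- that `w b < w c`, the range of the symmetry equation.
  · have hl : i < wt w l := by exact_mod_cast hl
    simp only [leading_apply, wt_append, wt_cons, wt_nil, add_zero]
    rw [map_sum, LinearMap.sum_apply]
    have h1 : ∀ a, B (if w a + i = wt w l then ε (wordOp E l (f a)) • e a else 0) (e b) =
        ∑ c, if w c + i = wt w l + w b then (if w a + i = wt w l then
          ε (wordOp E l (f a)) * ε (C a b c) else 0) • e c else 0 := by
      intro a
      split_ifs with ha
      · rw [map_smul, LinearMap.smul_apply, hBC, Finset.smul_sum]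
        refine Finset.sum_congr rfl fun c _ => ?_
        have : w c = w a + w b ↔ w c + i = wt w l + w b := by omega
        simp only [this]
        split_ifs <;> simp [mul_smul]
      · simp
    simp only [h1]
    rw [Finset.sum_comm]
    refine Finset.sum_congr rfl fun c _ => ?_
    split_ifs with hc
    · rw [← Finset.sum_smul]
      congr 1
      have h2 := hs b c (by omega)
      have h3 : E b (f c) = ∑ a, f a * C a b c - tupleBr E C f (Pi.single b 1) c := by
        rw [tupleBr_single, sub_sub_cancel]
      have hcκ := H.le c
      have hb := H.pos b
      rw [wordOp_append, wordOp_cons, wordOp_nil, h3, map_sub, map_sub, h2 l (by omega), sub_zero,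
        map_sum, map_sum]
      refine Finset.sum_congr rfl fun a _ => ?_
      split_ifs with ha
      · exact eval_wordOp_mul_leading H.pos _ _ _ (wOrd_anti (by omega) (hf a))
      · by_cases hac : w a + w b < w c
        · rw [H.graded a b c hac]; simp
        · exact (Ideal.mul_mem_right (C a b c) _ (hf a)) l (by omega)
    · simp

omit H in
theorem leading_eq_zero {f : A → R} {i : ℕ} (hf : ∀ c, f c ∈ wOrd ε E w (i + 1 + w c)) :
    leading ε E w e i f = 0 := by
  ext l
  rw [leading_apply]
  refine Finset.sum_eq_zero fun c _ => ?_
  split_ifs with hc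
  · rw [hf c l (by omega), zero_smul]
  · rfl

/-- Components with `w c ≥ 2` have order `i + 2` already; for `w c = 1` the missing values are the
coordinates of the leading part. -/
theorem mem_wOrd_of_leading_eq_zero {f : A → R} {i : ℕ} (hf : ∀ c, f c ∈ wOrd ε E w (i + w c))
    (h : leading ε E w e i f = 0) (c : A) : f c ∈ wOrd ε E w (i + 1 + 1) := by
  have hc := H.pos c
  rcases (show w c = 1 ∨ 2 ≤ w c by omega) with h1 | h2
  · intro l hl
    rcases (show wt w l < i + w c ∨ w c + i = wt w l by omega) with h3 | h3
    · exact hf c l h3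
    · have h4 : e.repr (leading ε E w e i f l) c = 0 := by rw [h]; simp
      rw [leading_apply, map_sum, Finsupp.finsetSum_apply, Finset.sum_eq_single c] at h4
      · simpa [h3] using h4
      · intro c' _ hc'
        split_ifs <;> simp [hc']
      · simp
  · exact wOrd_anti (by omega) (hf c)

end WeightedFrame

end Frames

/-! ### Germs of smooth functions, derivations and vanishing jets -/

section Germs

open Filter VectorField

variable {F G G' G'' : Type*} [NormedAddCommGroup F] [NormedSpace ℝ F]
  [NormedAddCommGroup G] [NormedSpace ℝ G] [NormedAddCommGroup G'] [NormedSpace ℝ G']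
  [NormedAddCommGroup G''] [NormedSpace ℝ G'']

/-- `g` is smooth on some neighbourhood of `p`. -/
def SmNear (p : F) (g : F → G) : Prop := ∀ᶠ y in 𝓝 p, ContDiffAt ℝ ∞ g y

theorem SmNear.fderiv {p : F} {g : F → G} (hg : SmNear p g) : SmNear p (fderiv ℝ g) := by
  filter_upwards [hg] with y h using h.fderiv_right (by simp)

theorem SmNear.clm_apply {p : F} {L : F → G →L[ℝ] G'} {g : F → G} (hL : SmNear p L)
    (hg : SmNear p g) : SmNear p fun y => L y (g y) := by
  filter_upwards [hL, hg] with y h1 h2 using h1.clm_apply h2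

theorem SmNear.comp_clm (L : G →L[ℝ] G') {p : F} {g : F → G} (hg : SmNear p g) :
    SmNear p fun y => L (g y) := by
  filter_upwards [hg] with y h using L.contDiff.contDiffAt.comp y h

/-- Smooth functions near `p`. -/
def smFun (p : F) : Subalgebra ℝ (F → ℝ) where
  carrier := {g | SmNear p g}
  mul_mem' := by
    intro f g hf hg
    filter_upwards [hf, hg] with y h1 h2 using h1.mul h2
  add_mem' := by
    intro f g hf hg
    filter_upwards [hf, hg] with y h1 h2 using h1.add h2
  algebraMap_mem' := fun r => Eventually.of_forall fun _ => contDiffAt_const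

/-- The functions vanishing near `p`. -/
def zeroGerms (p : F) : Ideal (smFun p) where
  carrier := {g | ∀ᶠ y in 𝓝 p, g.1 y = 0}
  zero_mem' := Eventually.of_forall fun _ => rfl
  add_mem' := by
    intro f g hf hg
    filter_upwards [hf, hg] with y h1 h2
    change f.1 y + g.1 y = 0
    rw [h1, h2, add_zero]
  smul_mem' := by
    intro f g hg
    filter_upwards [hg] with y h1
    change f.1 y * g.1 y = 0
    rw [h1, mul_zero]

/-- The ring of germs at `p` of smooth functions. -/
def GermRing (p : F) : Type _ := smFun p ⧸ zeroGerms p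

instance (p : F) : CommRing (GermRing p) := inferInstanceAs (CommRing (smFun p ⧸ zeroGerms p))

instance (p : F) : Algebra ℝ (GermRing p) := inferInstanceAs (Algebra ℝ (smFun p ⧸ zeroGerms p))

/-- The germ of a smooth function. -/
def germ {p : F} (g : F → ℝ) (hg : SmNear p g) : GermRing p :=
  Ideal.Quotient.mk (zeroGerms p) ⟨g, hg⟩

theorem germ_surjective {p : F} (r : GermRing p) : ∃ g, ∃ hg : SmNear p g, germ g hg = r := by
  obtain ⟨g, rfl⟩ := Ideal.Quotient.mk_surjective r
  exact ⟨g.1, g.2, rfl⟩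

theorem germ_eq_iff {p : F} {g h : F → ℝ} {hg : SmNear p g} {hh : SmNear p h} :
    germ g hg = germ h hh ↔ g =ᶠ[𝓝 p] h := by
  refine Ideal.Quotient.eq.trans ?_
  change (∀ᶠ y in 𝓝 p, g y - h y = 0) ↔ _
  simp only [sub_eq_zero]
  rfl

theorem germ_eq_zero_iff {p : F} {g : F → ℝ} {hg : SmNear p g} :
    germ g hg = 0 ↔ ∀ᶠ y in 𝓝 p, g y = 0 :=
  Ideal.Quotient.eq_zero_iff_mem

theorem SmNear.const {p : F} (c : G) : SmNear p fun _ => c :=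
  Eventually.of_forall fun _ => contDiffAt_const

theorem SmNear.add {p : F} {f g : F → G} (hf : SmNear p f) (hg : SmNear p g) :
    SmNear p (f + g) := by
  filter_upwards [hf, hg] with y h1 h2 using h1.add h2

theorem SmNear.mul {p : F} {f g : F → ℝ} (hf : SmNear p f) (hg : SmNear p g) :
    SmNear p (f * g) := by
  filter_upwards [hf, hg] with y h1 h2 using h1.mul h2

theorem SmNear.smul {p : F} (c : ℝ) {f : F → G} (hf : SmNear p f) : SmNear p (c • f) := by
  filter_upwards [hf] with y h1 using contDiffAt_const.smul h1

theorem germ_add {p : F} {f g : F → ℝ} (hf : SmNear p f) (hg : SmNear p g) :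
    germ (f + g) (hf.add hg) = germ f hf + germ g hg := rfl

theorem germ_mul {p : F} {f g : F → ℝ} (hf : SmNear p f) (hg : SmNear p g) :
    germ (f * g) (hf.mul hg) = germ f hf * germ g hg := rfl

theorem germ_smul {p : F} (c : ℝ) {f : F → ℝ} (hf : SmNear p f) :
    germ (c • f) (hf.smul c) = c • germ f hf := rfl

theorem germ_sum {p : F} {ι : Type*} (s : Finset ι) (f : ι → F → ℝ)
    (hf : ∀ i, SmNear p (f i)) :
    ∃ h : SmNear p fun y => ∑ i ∈ s, f i y, germ _ h = ∑ i ∈ s, germ (f i) (hf i) := by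
  classical
  induction s using Finset.induction_on with
  | empty => exact ⟨by simpa using SmNear.const (0 : ℝ), germ_eq_zero_iff.2 (by simp)⟩
  | insert i s hi ih =>
    obtain ⟨h1, h2⟩ := ih
    have h : (fun y => ∑ j ∈ insert i s, f j y) = f i + fun y => ∑ j ∈ s, f j y := by
      ext y; simp [hi]
    refine ⟨h ▸ (hf i).add h1, ?_⟩
    rw [Finset.sum_insert hi, ← h2, ← germ_add]
    exact germ_eq_iff.2 (Eventually.of_forall fun y => congrFun h y)

/-- The value of a germ. -/
def germEval (p : F) : GermRing p →ₐ[ℝ] ℝ :=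
  Ideal.Quotient.liftₐ _ ((Pi.evalAlgHom ℝ (fun _ : F => ℝ) p).comp (smFun p).val)
    fun _ hg => hg.self_of_nhds

@[simp] theorem germEval_germ {p : F} {g : F → ℝ} (hg : SmNear p g) :
    germEval p (germ g hg) = g p := rfl

/-- A representative of a germ. -/
def germRep {p : F} (r : GermRing p) : F → ℝ := (germ_surjective r).choose

theorem germRep_smNear {p : F} (r : GermRing p) : SmNear p (germRep r) :=
  (germ_surjective r).choose_spec.choose

theorem germ_germRep {p : F} (r : GermRing p) : germ (germRep r) (germRep_smNear r) = r :=
  (germ_surjective r).choose_spec.choose_spec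

theorem SmNear.derivAlong {p : F} {g : F → ℝ} {V : F → F} (hV : SmNear p V) (hg : SmNear p g) :
    SmNear p fun y => _root_.fderiv ℝ g y (V y) := hg.fderiv.clm_apply hV

theorem derivAlong_congr {p : F} {g h : F → ℝ} {V W : F → F} (hgh : g =ᶠ[𝓝 p] h)
    (hVW : V =ᶠ[𝓝 p] W) :
    (fun y => fderiv ℝ g y (V y)) =ᶠ[𝓝 p] fun y => fderiv ℝ h y (W y) := by
  filter_upwards [hgh.eventuallyEq_nhds, hVW] with y h1 h2
  rw [h1.fderiv_eq, h2]

/-- The derivative of a germ along a vector field, on representatives. -/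
def derivGerm {p : F} (V : F → F) (hV : SmNear p V) (r : GermRing p) : GermRing p :=
  germ _ (hV.derivAlong (germRep_smNear r))

theorem derivGerm_germ {p : F} {V : F → F} (hV : SmNear p V) {g : F → ℝ} (hg : SmNear p g) :
    derivGerm V hV (germ g hg) = germ _ (hV.derivAlong hg) :=
  germ_eq_iff.2 (derivAlong_congr (germ_eq_iff.1 (germ_germRep (germ g hg)))
    (EventuallyEq.refl _ _))

theorem SmNear.differentiableAt {p : F} {g : F → G} (hg : SmNear p g) :
    ∀ᶠ y in 𝓝 p, DifferentiableAt ℝ g y := by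
  filter_upwards [hg] with y h using h.differentiableAt (by simp)

/-- The derivation of the ring of germs defined by a vector field. -/
def der {p : F} (V : F → F) (hV : SmNear p V) : Derivation ℝ (GermRing p) (GermRing p) :=
  Derivation.mk'
    { toFun := derivGerm V hV
      map_add' := by
        intro r s
        obtain ⟨f, hf, rfl⟩ := germ_surjective r
        obtain ⟨g, hg, rfl⟩ := germ_surjective s
        rw [← germ_add, derivGerm_germ, derivGerm_germ, derivGerm_germ]
        refine germ_eq_iff.2 ?_
        filter_upwards [hf.differentiableAt, hg.differentiableAt] with y h1 h2
        rw [fderiv_add h1 h2]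
        rfl
      map_smul' := by
        intro c r
        obtain ⟨f, hf, rfl⟩ := germ_surjective r
        rw [← germ_smul, derivGerm_germ, derivGerm_germ]
        refine germ_eq_iff.2 ?_
        filter_upwards [hf.differentiableAt] with y h1
        rw [fderiv_const_smul h1]
        rfl }
    (by
      intro r s
      obtain ⟨f, hf, rfl⟩ := germ_surjective r
      obtain ⟨g, hg, rfl⟩ := germ_surjective s
      change derivGerm V hV _ = _ * derivGerm V hV _ + _ * derivGerm V hV _
      rw [← germ_mul, derivGerm_germ, derivGerm_germ, derivGerm_germ]
      refine germ_eq_iff.2 ?_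
      filter_upwards [hf.differentiableAt, hg.differentiableAt] with y h1 h2
      rw [fderiv_mul h1 h2]
      rfl)

theorem der_germ {p : F} {V : F → F} (hV : SmNear p V) {g : F → ℝ} (hg : SmNear p g) :
    der V hV (germ g hg) = germ _ (hV.derivAlong hg) := derivGerm_germ hV hg

theorem SmNear.lieBracket {p : F} {V W : F → F} (hV : SmNear p V) (hW : SmNear p W) :
    SmNear p (lieBracket ℝ V W) := by
  filter_upwards [hV, hW] with y h1 h2 using h1.lieBracket_vectorField h2 (m := ∞) (by simp)

theorem der_lieBracket {p : F} {V W : F → F} (hV : SmNear p V) (hW : SmNear p W) :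
    der _ (hV.lieBracket hW) = ⁅der V hV, der W hW⁆ := by
  ext r
  obtain ⟨g, hg, rfl⟩ := germ_surjective r
  rw [Derivation.commutator_apply, der_germ, der_germ, der_germ, der_germ, der_germ]
  refine germ_eq_iff.2 ?_
  filter_upwards [hg, hV.differentiableAt, hW.differentiableAt] with y h1 h2 h3
  exact fderiv_apply_lieBracket h1 (by
    rw [minSmoothness_of_isRCLikeNormedField]
    exact WithTop.coe_le_coe.2 (le_top (a := (2 : ℕ∞)))) h3 h2

/-- The derivatives of `g` at `p` of order up to `k` vanish. -/
def VanTo (p : F) (k : ℕ) (g : F → G) : Prop := ∀ t ≤ k, iteratedFDeriv ℝ t g p = 0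

theorem vanTo_zero_iff {p : F} {g : F → G} : VanTo p 0 g ↔ g p = 0 := by
  have : iteratedFDeriv ℝ 0 g p = 0 ↔ g p = 0 := by
    rw [← norm_eq_zero, norm_iteratedFDeriv_zero, norm_eq_zero]
  exact ⟨fun h => this.1 (h 0 le_rfl), fun h t ht => by rwa [Nat.le_zero.1 ht, this]⟩

theorem vanTo_succ_iff {p : F} {k : ℕ} {g : F → G} :
    VanTo p (k + 1) g ↔ g p = 0 ∧ VanTo p k (fderiv ℝ g) := by
  have h : ∀ t, iteratedFDeriv ℝ t (fderiv ℝ g) p = 0 ↔ iteratedFDeriv ℝ (t + 1) g p = 0 := by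
    intro t
    rw [← norm_eq_zero, norm_iteratedFDeriv_fderiv, norm_eq_zero]
  constructor
  · exact fun H => ⟨vanTo_zero_iff.1 fun t ht => H t (by omega),
      fun t ht => (h t).2 (H _ (by omega))⟩
  · rintro ⟨h0, H⟩ t ht
    cases t with
    | zero => exact vanTo_zero_iff.2 h0 0 le_rfl
    | succ t => exact (h t).1 (H t (by omega))

theorem VanTo.congr {p : F} {k : ℕ} {g h : F → G} (hg : VanTo p k g) (hgh : h =ᶠ[𝓝 p] g) :
    VanTo p k h := fun t ht => by
  rw [hgh.iteratedFDeriv (𝕜 := ℝ) t |>.self_of_nhds]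
  exact hg t ht

/-- In the Leibniz bound for derivatives of order at most `k`, every term contains a derivative of
`g` of order at most `k`. -/
theorem VanTo.bilinear (B : G →L[ℝ] G' →L[ℝ] G'') {p : F} {k : ℕ} {g : F → G} {h : F → G'}
    (hg : SmNear p g) (hh : SmNear p h) (hv : VanTo p k g) :
    VanTo p k fun y => B (g y) (h y) := by
  obtain ⟨s, hs, hso, hps⟩ := eventually_nhds_iff.1 (hg.and hh)
  intro t ht
  have h1 : ContDiffOn ℝ t g s := fun y hy =>
    ((hs y hy).1.of_le (by exact_mod_cast le_top)).contDiffWithinAt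
  have h2 : ContDiffOn ℝ t h s := fun y hy =>
    ((hs y hy).2.of_le (by exact_mod_cast le_top)).contDiffWithinAt
  have := B.norm_iteratedFDerivWithin_le_of_bilinear h1 h2 hso.uniqueDiffOn hps (n := t) le_rfl
  rw [iteratedFDerivWithin_of_isOpen t hso hps, Finset.sum_eq_zero, mul_zero] at this
  · exact norm_le_zero_iff.1 this
  · intro i hi
    rw [iteratedFDerivWithin_of_isOpen i hso hps,
      hv i ((Nat.lt_succ_iff.1 (Finset.mem_range.1 hi)).trans ht)]
    simp

theorem VanTo.comp_clm (L : G →L[ℝ] G') {p : F} {k : ℕ} {g : F → G}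
    (hg : SmNear p g) (hv : VanTo p k g) : VanTo p k fun y => L (g y) :=
  ((VanTo.bilinear ((ContinuousLinearMap.lsmul ℝ ℝ (E := G')).flip.comp L) hg
    (SmNear.const (1 : ℝ)) hv).congr (Eventually.of_forall fun y => by simp))

end Germs

/-! ### Local frames and coefficient germs -/

section LocalFrames

open Filter VectorField

variable {F : Type*} [NormedAddCommGroup F] [NormedSpace ℝ F] {A : Type} [Fintype A]
  [DecidableEq A]

/-- The linear map with a given frame as columns. -/
def frameMap (V : A → F → F) (y : F) : (A → ℝ) →L[ℝ] F :=
  ∑ a, (ContinuousLinearMap.proj (R := ℝ) (φ := fun _ : A => ℝ) a).smulRight (V a y)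

theorem frameMap_apply (V : A → F → F) (y : F) (c : A → ℝ) :
    frameMap V y c = ∑ a, c a • V a y := by
  simp [frameMap]

/-- `V` is a smooth local frame near `p`. -/
structure IsFrameAt (p : F) (V : A → F → F) : Prop where
  smooth : ∀ a, SmNear p (V a)
  inv : ∀ᶠ y in 𝓝 p, (frameMap V y).IsInvertible

theorem smNear_frameMap {p : F} {V : A → F → F} (hV : ∀ a, SmNear p (V a)) :
    SmNear p (frameMap V) := by
  filter_upwards [eventually_all.2 hV] with y h
  refine ContDiffAt.sum fun a _ => ?_
  exact (ContinuousLinearMap.smulRightL ℝ (A → ℝ) F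
    (ContinuousLinearMap.proj a)).contDiff.contDiffAt.comp y (h a)

theorem IsFrameAt.of_isInvertible [CompleteSpace F] {p : F} {V : A → F → F}
    (hV : ∀ a, SmNear p (V a)) (h : (frameMap V p).IsInvertible) : IsFrameAt p V := by
  refine ⟨hV, ?_⟩
  obtain ⟨e, he⟩ := h
  have h1 : ContinuousAt (frameMap V) p := (smNear_frameMap hV).self_of_nhds.continuousAt
  have h2 := ContinuousLinearEquiv.nhds e
  rw [he] at h2
  filter_upwards [h1 h2] with y hy
  obtain ⟨e', he'⟩ := hy
  exact ⟨e', he'⟩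

/-- The coefficients of a vector field with respect to a frame. -/
def frameCoef (V : A → F → F) (W : F → F) (y : F) : A → ℝ := (frameMap V y).inverse (W y)

namespace IsFrameAt

variable {p : F} {V : A → F → F} (hV : IsFrameAt p V)
include hV

theorem sum_frameCoef (W : F → F) :
    ∀ᶠ y in 𝓝 p, ∑ a, frameCoef V W y a • V a y = W y := by
  filter_upwards [hV.inv] with y hy
  rw [← frameMap_apply]
  exact hy.self_apply_inverse _

theorem frameCoef_eq : ∀ᶠ y in 𝓝 p, ∀ (W : F → F) (c : A → ℝ),
    W y = ∑ a, c a • V a y → frameCoef V W y = c := by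
  filter_upwards [hV.inv] with y hy W c h
  rw [frameCoef, h, ← frameMap_apply, hy.inverse_apply_self]

theorem smNear_inverse : SmNear p fun y => (frameMap V y).inverse := by
  filter_upwards [smNear_frameMap hV.smooth, hV.inv] with y h1 h2
  exact h2.contDiffAt_map_inverse.comp y h1

theorem smNear_frameCoef {W : F → F} (hW : SmNear p W) (a : A) :
    SmNear p fun y => frameCoef V W y a :=
  (hV.smNear_inverse.clm_apply hW).comp_clm
    (ContinuousLinearMap.proj (R := ℝ) (φ := fun _ : A => ℝ) a)

/-- The germs of the coefficients of a vector field. -/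
def coef (W : F → F) (hW : SmNear p W) (a : A) : GermRing p :=
  germ _ (hV.smNear_frameCoef hW a)

/-- The derivations along the fields of a frame. -/
def ders (a : A) : Derivation ℝ (GermRing p) (GermRing p) := der (V a) (hV.smooth a)

theorem der_eq_vec {W : F → F} (hW : SmNear p W) {f : A → F → ℝ} (hf : ∀ a, SmNear p (f a))
    (h : ∀ᶠ y in 𝓝 p, W y = ∑ a, f a y • V a y) :
    der W hW = vec hV.ders fun a => germ (f a) (hf a) := by
  ext r
  obtain ⟨g, hg, rfl⟩ := germ_surjective r
  rw [vec_apply, der_germ]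
  simp only [ders, der_germ, ← germ_mul]
  obtain ⟨h1, h2⟩ := germ_sum Finset.univ _
    fun a => (hf a).mul ((hV.smooth a).derivAlong hg)
  rw [← h2]
  refine germ_eq_iff.2 ?_
  filter_upwards [h] with y hy
  simp [hy]

theorem der_eq_vec_coef {W : F → F} (hW : SmNear p W) :
    der W hW = vec hV.ders (hV.coef W hW) := by
  refine hV.der_eq_vec hW (fun a => hV.smNear_frameCoef hW a) ?_
  filter_upwards [hV.sum_frameCoef W] with y hy using hy.symm

/-- A field whose derivation kills enough linear functions is zero near `p`. -/
theorem vec_ders_injective : Function.Injective (vec hV.ders) := by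
  rw [injective_iff_map_eq_zero]
  intro f hf
  choose g hg hgf using fun a => germ_surjective (f a)
  obtain rfl : (fun a => germ (g a) (hg a)) = f := funext hgf
  have hp := hV.inv.self_of_nhds
  -- Linear coordinates on `F` dual to the frame at `p`.
  let ℓ : A → F →L[ℝ] ℝ := fun b =>
    (ContinuousLinearMap.proj (R := ℝ) (φ := fun _ : A => ℝ) b).comp (frameMap V p).inverse
  have key : ∀ b, ∀ᶠ y in 𝓝 p, ℓ b (∑ a, g a y • V a y) = 0 := by
    intro b
    have hb : SmNear p (ℓ b) := Eventually.of_forall fun y => (ℓ b).contDiff.contDiffAt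
    have h := congrArg (fun D => D (germ _ hb)) hf
    simp only [vec_apply, ders, der_germ, ← germ_mul, Derivation.coe_zero, Pi.zero_apply] at h
    obtain ⟨h1, h2⟩ := germ_sum Finset.univ _
      fun a => (hg a).mul ((hV.smooth a).derivAlong hb)
    rw [← h2, germ_eq_zero_iff] at h
    filter_upwards [h] with y hy
    simpa using hy
  funext a
  refine germ_eq_zero_iff.2 ?_
  filter_upwards [eventually_all.2 key, hV.inv] with y h1 h2
  have h3 : (frameMap V p).inverse (frameMap V y fun a => g a y) = 0 := by
    ext b
    rw [frameMap_apply]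
    exact h1 b
  have h4 := hp.inverse.injective (h3.trans (map_zero _).symm)
  have h5 := h2.injective (h4.trans (map_zero _).symm)
  exact congrFun h5 a

/-- The frame derivatives of `g` are the components of `fderiv ℝ g` in the frame. The change of
components is smooth and invertible, hence respects vanishing jets, and one inducts on the order. -/
theorem germ_mem_jOrd_iff {k : ℕ} : ∀ {g : F → ℝ} (hg : SmNear p g),
    germ g hg ∈ jOrd (germEval p) hV.ders (k + 1) ↔ VanTo p k g := by
  induction k with
  | zero =>
    intro g hg
    rw [mem_wOrd_succ_iff, vanTo_zero_iff, germEval_germ]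
    refine ⟨fun h => h.1, fun h => ⟨h, fun a => ?_⟩⟩
    rw [Nat.sub_self, wOrd_zero]
    trivial
  | succ k ih =>
    intro g hg
    rw [mem_wOrd_succ_iff, vanTo_succ_iff, germEval_germ]
    refine and_congr_right fun _ => ?_
    simp only [ders, der_germ, Nat.add_sub_cancel]
    simp only [jOrd] at ih
    simp only [ih]
    constructor
    · intro h
      have h1 : SmNear p fun y => fun a => fderiv ℝ g y (V a y) := by
        filter_upwards [eventually_all.2 fun a => (hV.smooth a).derivAlong hg] with y hy
        exact contDiffAt_pi.2 hy
      have h2 : VanTo p k fun y => fun a => fderiv ℝ g y (V a y) := by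
        have h3 : ∀ a, VanTo p k fun y => (fderiv ℝ g y (V a y)) •
            (Pi.single a (1 : ℝ) : A → ℝ) := fun a =>
          VanTo.comp_clm ((ContinuousLinearMap.id ℝ ℝ).smulRight (Pi.single a (1 : ℝ) : A → ℝ))
            ((hV.smooth a).derivAlong hg) (h a)
        intro t ht
        have h4 : (fun y => fun a => fderiv ℝ g y (V a y)) =
            fun y => ∑ a, (fderiv ℝ g y (V a y)) • (Pi.single a (1 : ℝ) : A → ℝ) := by
          ext y b
          simp [Finset.sum_apply, Pi.single_apply]
        rw [h4, iteratedFDeriv_fun_sum_apply]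
        · exact Finset.sum_eq_zero fun a _ => h3 a t ht
        · intro a _
          exact (((hV.smooth a).derivAlong hg).self_of_nhds.of_le
            (by exact_mod_cast le_top)).smul contDiffAt_const
      let T : (A → ℝ) →L[ℝ] (A → ℝ) →L[ℝ] ℝ := ∑ a,
        (ContinuousLinearMap.proj (R := ℝ) (φ := fun _ : A => ℝ) a).smulRight
          (ContinuousLinearMap.proj (R := ℝ) (φ := fun _ : A => ℝ) a)
      have h5 := VanTo.bilinear ((ContinuousLinearMap.compL ℝ F (A → ℝ) ℝ).comp T) h1
        hV.smNear_inverse h2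
      refine h5.congr ?_
      filter_upwards [hV.inv] with y hy
      ext v
      obtain ⟨c, rfl⟩ := hy.surjective v
      have h6 : (frameMap V y).inverse (frameMap V y c) = c := hy.inverse_apply_self c
      have h7 : ∀ (d : A → ℝ) (L : F →L[ℝ] A → ℝ) (v : F),
          ((ContinuousLinearMap.compL ℝ F (A → ℝ) ℝ).comp T) d L v = ∑ a, d a * L v a := by
        intro d L v
        simp [T]
      rw [h7, h6, frameMap_apply]
      simp [mul_comm]
    · intro h a
      exact VanTo.bilinear (ContinuousLinearMap.id ℝ (F →L[ℝ] ℝ)) hg.fderiv (hV.smooth a) h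

theorem vanTo_iff {W : F → F} (hW : SmNear p W) {k : ℕ} :
    VanTo p k W ↔ ∀ a, hV.coef W hW a ∈ jOrd (germEval p) hV.ders (k + 1) := by
  simp only [coef, germ_mem_jOrd_iff]
  constructor
  · intro h a
    have h1 := VanTo.bilinear (ContinuousLinearMap.id ℝ (F →L[ℝ] (A → ℝ))).flip hW
      hV.smNear_inverse h
    refine VanTo.comp_clm (ContinuousLinearMap.proj (R := ℝ) (φ := fun _ : A => ℝ) a)
      (hV.smNear_inverse.clm_apply hW) h1
  · intro h
    have h1 : ∀ a, VanTo p k fun y => frameCoef V W y a • V a y := fun a =>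
      VanTo.bilinear (ContinuousLinearMap.lsmul ℝ ℝ (E := F)) (hV.smNear_frameCoef hW a)
        (hV.smooth a) (h a)
    have h2 : VanTo p k fun y => ∑ a, frameCoef V W y a • V a y := by
      intro t ht
      rw [iteratedFDeriv_fun_sum_apply]
      · exact Finset.sum_eq_zero fun a _ => h1 a t ht
      · intro a _
        exact ((hV.smNear_frameCoef hW a).self_of_nhds.of_le (by exact_mod_cast le_top)).smul
          ((hV.smooth a).self_of_nhds.of_le (by exact_mod_cast le_top))
    refine h2.congr ?_
    filter_upwards [hV.sum_frameCoef W] with y hy using hy.symm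

/-- The structure functions of a frame. -/
def structureFun (a b : A) : A → GermRing p :=
  hV.coef _ ((hV.smooth a).lieBracket (hV.smooth b))

theorem lie_ders (a b : A) : ⁅hV.ders a, hV.ders b⁆ = ∑ c, hV.structureFun a b c • hV.ders c := by
  rw [ders, ders, ← der_lieBracket]
  exact hV.der_eq_vec_coef _

/-- Coefficients are determined by the derivation, and both sides give the commutator of the two
derivations. -/
theorem coef_lieBracket {X Y : F → F} (hX : SmNear p X) (hY : SmNear p Y) :
    hV.coef _ (hX.lieBracket hY) =
      tupleBr hV.ders hV.structureFun (hV.coef X hX) (hV.coef Y hY) := by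
  apply hV.vec_ders_injective
  rw [vec_tupleBr _ _ hV.lie_ders, ← hV.der_eq_vec_coef, ← hV.der_eq_vec_coef,
    ← hV.der_eq_vec_coef, der_lieBracket]

theorem coef_congr {X Y : F → F} (hX : SmNear p X) (hY : SmNear p Y) (h : X =ᶠ[𝓝 p] Y) :
    hV.coef X hX = hV.coef Y hY := by
  ext a
  refine germ_eq_iff.2 ?_
  filter_upwards [h] with y hy
  rw [frameCoef, frameCoef, hy]

theorem coef_frame (a : A) : hV.coef (V a) (hV.smooth a) = Pi.single a 1 := by
  apply hV.vec_ders_injective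
  rw [vec_single, ← hV.der_eq_vec_coef, ders]

end IsFrameAt

end LocalFrames

/-! ### Passage from the manifold to the chart -/

section Chart

open Filter VectorField

variable {n : ℕ} {M : Type*} [TopologicalSpace M] [ChartedSpace (EuclideanSpace ℝ (Fin n)) M]

theorem rep_eq (x : M) (X : VF n M) (z : EuclideanSpace ℝ (Fin n)) :
    rep x X z = (mfderivWithin 𝓘(ℝ, EuclideanSpace ℝ (Fin n)) (𝓡 n) (extChartAt (𝓡 n) x).symm
      (Set.range (𝓡 n)) z).inverse (X ((extChartAt (𝓡 n) x).symm z)) := rfl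

theorem eventually_chart_iff {x : M} {P : M → Prop} :
    (∀ᶠ z in 𝓝 (extChartAt (𝓡 n) x x), P ((extChartAt (𝓡 n) x).symm z)) ↔ ∀ᶠ y in 𝓝 x, P y := by
  constructor
  · intro h
    have h1 := (continuousAt_extChartAt (I := 𝓡 n) x).eventually h
    filter_upwards [h1, extChartAt_source_mem_nhds (I := 𝓡 n) x] with y h2 h3
    rwa [(extChartAt (𝓡 n) x).left_inv h3] at h2
  · intro h
    refine (continuousAt_extChartAt_symm (I := 𝓡 n) x).eventually ?_
    rwa [extChartAt_to_inv]

variable [IsManifold (𝓡 n) ∞ M]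

theorem eventually_isInvertible (x : M) : ∀ᶠ z in 𝓝 (extChartAt (𝓡 n) x x),
    (mfderivWithin 𝓘(ℝ, EuclideanSpace ℝ (Fin n)) (𝓡 n) (extChartAt (𝓡 n) x).symm
      (Set.range (𝓡 n)) z).IsInvertible := by
  have : IsManifold (𝓡 n) 1 M := .of_le (n := ∞) (by simp)
  filter_upwards [extChartAt_target_mem_nhds (I := 𝓡 n) x] with z hz
  exact isInvertible_mfderivWithin_extChartAt_symm hz

theorem SmoothNear.rep_smNear {x : M} {X : VF n M} (h : SmoothNear x X) :
    SmNear (extChartAt (𝓡 n) x x) (rep x X) := by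
  have : IsManifold (𝓡 n) 1 M := .of_le (n := ∞) (by simp)
  filter_upwards [eventually_chart_iff.2 h, extChartAt_target_mem_nhds (I := 𝓡 n) x] with z hz hzt
  have h1 : ContMDiffWithinAt 𝓘(ℝ, EuclideanSpace ℝ (Fin n)) (𝓡 n) ∞ (extChartAt (𝓡 n) x).symm
      (Set.range (𝓡 n)) z := contMDiffWithinAt_extChartAt_symm_range x hzt
  have h2 := ContMDiffWithinAt.mpullbackWithin_vectorField_of_mem (m := ∞) (n := ∞)
    (t := Set.univ) (V := X) hz.contMDiffWithinAt h1
    (isInvertible_mfderivWithin_extChartAt_symm hzt) (by simp)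
    (by simpa using uniqueMDiffOn_univ) (by simp) (by simp)
  have h3 := h2.contMDiffAt (by simp)
  exact ((contMDiff_snd_tangentBundle_modelSpace (EuclideanSpace ℝ (Fin n))
    𝓘(ℝ, EuclideanSpace ℝ (Fin n))).contMDiffAt.comp _ h3).contDiffAt

theorem rep_br {x : M} {X Y : VF n M} (hX : SmoothNear x X) (hY : SmoothNear x Y) :
    rep x (br X Y) =ᶠ[𝓝 (extChartAt (𝓡 n) x x)] lieBracket ℝ (rep x X) (rep x Y) := by
  filter_upwards [eventually_chart_iff.2 hX, eventually_chart_iff.2 hY,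
    extChartAt_target_mem_nhds (I := 𝓡 n) x] with z h1 h2 hzt
  have h3 : ContMDiffWithinAt 𝓘(ℝ, EuclideanSpace ℝ (Fin n)) (𝓡 n) ∞ (extChartAt (𝓡 n) x).symm
      (Set.range (𝓡 n)) z := contMDiffWithinAt_extChartAt_symm_range x hzt
  have : IsManifold (𝓡 n) (minSmoothness ℝ 2) M := by
    rw [minSmoothness_of_isRCLikeNormedField]; infer_instance
  have : IsManifold (𝓡 n) (minSmoothness ℝ 3) M := by
    rw [minSmoothness_of_isRCLikeNormedField]; infer_instance
  have h4 := mpullbackWithin_mlieBracketWithin (n := ∞) (I := 𝓘(ℝ, EuclideanSpace ℝ (Fin n)))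
    (I' := 𝓡 n) (t := Set.univ) (s := Set.range (𝓡 n)) (V := X) (W := Y) (x₀ := z)
    (f := (extChartAt (𝓡 n) x).symm)
    (h1.mdifferentiableAt (by simp)).mdifferentiableWithinAt
    (h2.mdifferentiableAt (by simp)).mdifferentiableWithinAt
    (by simpa using uniqueMDiffOn_univ) h3 (by simp)
    (by rw [minSmoothness_of_isRCLikeNormedField]
        exact WithTop.coe_le_coe.2 (le_top (a := (2 : ℕ∞)))) (by simp) (by simp)
  rw [mlieBracketWithin_eq_lieBracketWithin, mlieBracketWithin_univ] at h4
  refine h4.trans ?_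
  change lieBracketWithin ℝ (rep x X) (rep x Y) (Set.range (𝓡 n)) z = _
  rw [ModelWithCorners.range_eq_univ, lieBracketWithin_univ]

end Chart

/-! ### The filtration of derivations generated in weight one -/

section DerivationFiltration

variable {R : Type*} [CommRing R] [Algebra ℝ R] {A : Type} [Fintype A] [DecidableEq A]

theorem lie_smul_derivation (D D' : Derivation ℝ R R) (g : R) :
    ⁅D, g • D'⁆ = D g • D' + g • ⁅D, D'⁆ := by
  ext h
  simp only [Derivation.commutator_apply, Derivation.add_apply, Derivation.smul_apply,
    Derivation.leibniz, smul_eq_mul]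
  ring

/-- The derivations in the span of the frame fields of weight at most `p`. -/
def derFil (E : A → Derivation ℝ R R) (w : A → ℕ) (p : ℕ) : Submodule R (Derivation ℝ R R) :=
  Submodule.span R {D | ∃ a, w a ≤ p ∧ D = E a}

variable {E : A → Derivation ℝ R R} {w : A → ℕ}

theorem derFil_mono {p q : ℕ} (h : p ≤ q) : derFil E w p ≤ derFil E w q :=
  Submodule.span_mono fun _ ⟨a, ha, hD⟩ => ⟨a, ha.trans h, hD⟩

theorem frame_mem_derFil {a : A} {p : ℕ} (h : w a ≤ p) : E a ∈ derFil E w p :=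
  Submodule.subset_span ⟨a, h, rfl⟩

theorem vec_mem_derFil {f : A → R} {p : ℕ} (hf : ∀ a, p < w a → f a = 0) :
    vec E f ∈ derFil E w p := by
  refine Submodule.sum_mem _ fun a _ => ?_
  by_cases h : p < w a
  · rw [hf a h, zero_smul]; exact Submodule.zero_mem _
  · exact Submodule.smul_mem _ _ (frame_mem_derFil (not_lt.1 h))

theorem vec_mem_derFil_iff (hE : Function.Injective (vec E)) {f : A → R} {p : ℕ} :
    vec E f ∈ derFil E w p ↔ ∀ a, p < w a → f a = 0 := by
  refine ⟨fun h a ha => ?_, vec_mem_derFil⟩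
  have key : ∀ D ∈ derFil E w p, ∃ g : A → R, (∀ a, p < w a → g a = 0) ∧ vec E g = D := by
    intro D hD
    induction hD using Submodule.span_induction with
    | mem D hD =>
      obtain ⟨b, hb, rfl⟩ := hD
      refine ⟨Pi.single b 1, fun a ha => ?_, vec_single E b⟩
      rw [Pi.single_eq_of_ne]
      rintro rfl
      omega
    | zero => exact ⟨0, fun _ _ => rfl, map_zero _⟩
    | add D D' _ _ h h' =>
      obtain ⟨g, h1, rfl⟩ := h
      obtain ⟨g', h2, rfl⟩ := h'
      exact ⟨g + g', fun a ha => by simp [h1 a ha, h2 a ha], map_add _ _ _⟩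
    | smul r D _ h =>
      obtain ⟨g, h1, rfl⟩ := h
      exact ⟨r • g, fun a ha => by simp [h1 a ha], map_smul _ _ _⟩
  obtain ⟨g, h1, h2⟩ := key _ h
  rw [← hE h2]
  exact h1 a ha

/-- The bracket is not linear over `R`, but its error term `D g • Z` stays in level `q ≤ r`; so
frame fields suffice. -/
theorem lie_mem_derFil {D : Derivation ℝ R R} {q r : ℕ} (hqr : q ≤ r)
    (h : ∀ b, w b ≤ q → ⁅D, E b⁆ ∈ derFil E w r) {Z : Derivation ℝ R R} (hZ : Z ∈ derFil E w q) :
    ⁅D, Z⁆ ∈ derFil E w r := by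
  induction hZ using Submodule.span_induction with
  | mem Z hZ => obtain ⟨b, hb, rfl⟩ := hZ; exact h b hb
  | zero => rw [lie_zero]; exact Submodule.zero_mem _
  | add Z Z' _ _ h1 h2 => rw [lie_add]; exact Submodule.add_mem _ h1 h2
  | smul g Z hZ h1 =>
    rw [lie_smul_derivation]
    exact Submodule.add_mem _ (Submodule.smul_mem _ _ (derFil_mono hqr hZ))
      (Submodule.smul_mem _ _ h1)

/-- The flag is defined by brackets with Δ only; the Jacobi identity and induction on `p` extend
this to brackets of any two levels. -/
theorem lie_mem_derFil_add (hw : ∀ a, 0 < w a)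
    (h1 : ∀ a b, w a = 1 → ⁅E a, E b⁆ ∈ derFil E w (w b + 1))
    (hgen : ∀ a, 2 ≤ w a → ∃ Y ∈ derFil E w 1, ∃ Z ∈ derFil E w (w a - 1), E a = ⁅Y, Z⁆)
    (p : ℕ) : ∀ Y ∈ derFil E w p, ∀ q, ∀ Z ∈ derFil E w q, ⁅Y, Z⁆ ∈ derFil E w (p + q) := by
  induction p using Nat.strong_induction_on with
  | _ p ih =>
    intro Y hY q Z hZ
    have key : ∀ a, w a ≤ p → ⁅E a, Z⁆ ∈ derFil E w (p + q) := by
      intro a ha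
      rcases (show w a = 1 ∨ 2 ≤ w a by have := hw a; omega) with ha1 | ha2
      · refine lie_mem_derFil (q := q) (by omega) (fun b hb => ?_) hZ
        exact derFil_mono (by omega) (h1 a b ha1)
      · obtain ⟨Y', hY', Z', hZ', hE⟩ := hgen a ha2
        rw [hE, lie_lie]
        have e1 := ih 1 (by omega) Y' hY' _ _ (ih (w a - 1) (by omega) Z' hZ' q Z hZ)
        have e2 := ih (w a - 1) (by omega) Z' hZ' _ _ (ih 1 (by omega) Y' hY' q Z hZ)
        exact Submodule.sub_mem _ (derFil_mono (by omega) e1) (derFil_mono (by omega) e2)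
    have h2 := lie_mem_derFil (D := Z) (q := p) (r := p + q) (by omega) (fun a ha => by
      rw [← lie_skew]; exact Submodule.neg_mem _ (key a ha)) hY
    rw [← lie_skew]
    exact Submodule.neg_mem _ h2

/-- Jacobi again: a field that preserves Δ acts as a derivation on the brackets generating the
higher levels. -/
theorem lie_mem_derFil_self (hw : ∀ a, 0 < w a)
    (hlie : ∀ p, ∀ Y ∈ derFil E w p, ∀ q, ∀ Z ∈ derFil E w q, ⁅Y, Z⁆ ∈ derFil E w (p + q))
    (hgen : ∀ a, 2 ≤ w a → ∃ Y ∈ derFil E w 1, ∃ Z ∈ derFil E w (w a - 1), E a = ⁅Y, Z⁆)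
    {D : Derivation ℝ R R} (hD : ∀ b, w b = 1 → ⁅D, E b⁆ ∈ derFil E w 1) (p : ℕ) :
    ∀ Z ∈ derFil E w p, ⁅D, Z⁆ ∈ derFil E w p := by
  induction p using Nat.strong_induction_on with
  | _ p ih =>
    intro Z hZ
    refine lie_mem_derFil le_rfl (fun a ha => ?_) hZ
    have := hw a
    rcases (show w a = 1 ∨ 2 ≤ w a by omega) with ha1 | ha2
    · exact derFil_mono (by omega) (hD a ha1)
    · obtain ⟨Y', hY', Z', hZ', hE⟩ := hgen a ha2
      rw [hE, leibniz_lie]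
      have e1 := hlie 1 _ (ih 1 (by omega) Y' hY') _ Z' hZ'
      have e2 := hlie 1 Y' hY' _ _ (ih (w a - 1) (by omega) Z' hZ')
      exact Submodule.add_mem _ (derFil_mono (by omega) e1) (derFil_mono (by omega) e2)

end DerivationFiltration

/-! ### Vector fields adapted to the flag at a point -/

section AdaptedFrames

open Filter VectorField Module

variable {n : ℕ} {M : Type*} [TopologicalSpace M] [ChartedSpace (EuclideanSpace ℝ (Fin n)) M]
  [IsManifold (𝓡 n) ∞ M]

theorem flag_le_succ (Δ : PlaneField n M) (p : ℕ) (y : M) : flag Δ p y ≤ flag Δ (p + 1) y := by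
  cases p with
  | zero => exact bot_le
  | succ p => exact le_sup_left

theorem flag_mono (Δ : PlaneField n M) (y : M) {p q : ℕ} (h : p ≤ q) :
    flag Δ p y ≤ flag Δ q y := by
  induction h with
  | refl => exact le_rfl
  | step _ ih => exact ih.trans (flag_le_succ Δ _ y)

theorem br_congr {x : M} {X X' Y Y' : VF n M} (hX : X =ᶠ[𝓝 x] X') (hY : Y =ᶠ[𝓝 x] Y') :
    br X Y =ᶠ[𝓝 x] br X' Y' := hX.mlieBracket_vectorField hY

theorem eventually_mem_secs {D : PlaneField n M} {x : M} {X : VF n M} (h : X ∈ secs D x) :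
    ∀ᶠ y in 𝓝 x, X ∈ secs D y := by
  filter_upwards [eventually_eventually_nhds.2 h.1, eventually_eventually_nhds.2 h.2] with y h1 h2
  exact ⟨h1, h2⟩

theorem br_mem_secs_succ {Δ : PlaneField n M} {x : M} {Y Z : VF n M} (hY : Y ∈ secs Δ x) {p : ℕ}
    (hZ : Z ∈ secs (flag Δ p) x) : br Y Z ∈ secs (flag Δ (p + 1)) x := by
  cases p with
  | zero =>
    have h : Z =ᶠ[𝓝 x] (0 : VF n M) := hZ.2.mono fun y hy => (Submodule.mem_bot ℝ).1 hy
    refine secs_congr (Submodule.zero_mem _) ((br_congr (EventuallyEq.refl _ Y) h).trans ?_)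
    have h0 : br Y (0 : VF n M) = 0 := mlieBracket_zero_right
    exact Eventually.of_forall fun y => congrFun h0 y
  | succ p =>
    refine ⟨hY.1.br hZ.1, ?_⟩
    filter_upwards [eventually_mem_secs hY, eventually_mem_secs hZ] with y h1 h2
    exact Submodule.mem_sup_right (Submodule.subset_span ⟨Y, h1, Z, h2, rfl⟩)

/-- A local section of the `p`-th member of the flag which is a bracket if `p ≥ 2`. -/
def IsGenerator (Δ : PlaneField n M) (x : M) (p : ℕ) (X : VF n M) : Prop :=
  X ∈ secs (flag Δ p) x ∧
    (2 ≤ p → ∃ Y ∈ secs Δ x, ∃ Z ∈ secs (flag Δ (p - 1)) x, X = br Y Z)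

/-- Modulo the previous level, Δ_p is spanned by values of brackets by its definition; for `p = 1`
vectors extend to sections. The frame is thereby made of actual brackets, which the weighted
calculus requires. -/
theorem span_generators {Δ : PlaneField n M} (hΔ : IsDistribution Δ) (x : M) (p : ℕ) :
    ⊤ ≤ Submodule.span ℝ {v : NegPart Δ x p | ∃ X, ∃ h : IsGenerator Δ x p X,
      v = Submodule.Quotient.mk ⟨X x, secs_apply_mem h.1⟩} := by
  rintro v -
  obtain ⟨⟨u, hu⟩, rfl⟩ := Submodule.Quotient.mk_surjective _ v
  match p, hu with
  | 0, hu =>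
    have : (⟨u, hu⟩ : flag Δ 0 x) = 0 := Subtype.ext ((Submodule.mem_bot ℝ).1 hu)
    rw [this, Submodule.Quotient.mk_zero]
    exact Submodule.zero_mem _
  | 1, hu =>
    obtain ⟨Y, hY, hYu⟩ := hΔ.2 x u hu
    subst hYu
    exact Submodule.subset_span ⟨Y, ⟨hY, fun h => absurd h (by norm_num)⟩, rfl⟩
  | p + 2, hu =>
    obtain ⟨u₁, h1, u₂, h2, rfl⟩ := Submodule.mem_sup.1 hu
    have hu1 : u₁ ∈ flag Δ (p + 2) x := flag_le_succ Δ (p + 1) x h1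
    have hle : Submodule.span ℝ {v | ∃ Y ∈ secs Δ x, ∃ Z ∈ secs (flag Δ (p + 1)) x,
        v = br Y Z x} ≤ flag Δ (p + 2) x := le_sup_right
    have h3 : (Submodule.Quotient.mk ⟨u₁ + u₂, hu⟩ : NegPart Δ x (p + 2)) =
        Submodule.Quotient.mk ⟨u₂, hle h2⟩ := by
      refine (Submodule.Quotient.eq _).2 ?_
      change u₁ + u₂ - u₂ ∈ flag Δ (p + 1) x
      rwa [add_sub_cancel_right]
    rw [h3]
    have key : ∀ u ∈ Submodule.span ℝ {v | ∃ Y ∈ secs Δ x, ∃ Z ∈ secs (flag Δ (p + 1)) x,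
        v = br Y Z x}, ∀ hu : u ∈ flag Δ (p + 2) x,
        (Submodule.Quotient.mk ⟨u, hu⟩ : NegPart Δ x (p + 2)) ∈ Submodule.span ℝ
          {v : NegPart Δ x (p + 2) | ∃ X, ∃ h : IsGenerator Δ x (p + 2) X,
            v = Submodule.Quotient.mk ⟨X x, secs_apply_mem h.1⟩} := by
      intro u hu
      induction hu using Submodule.span_induction with
      | mem u hu =>
        intro _
        obtain ⟨Y, hY, Z, hZ, rfl⟩ := hu
        exact Submodule.subset_span ⟨br Y Z, ⟨br_mem_secs_succ hY hZ,
          fun _ => ⟨Y, hY, Z, hZ, rfl⟩⟩, rfl⟩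
      | zero => exact fun _ => Submodule.zero_mem _
      | add u u' hu hu' ih ih' =>
        exact fun _ => Submodule.add_mem _ (ih (hle hu)) (ih' (hle hu'))
      | smul r u hu ih => exact fun _ => Submodule.smul_mem _ r (ih (hle hu))
    exact key u₂ h2 _

theorem exists_generator_basis {Δ : PlaneField n M} (hΔ : IsDistribution Δ) (x : M) (p : ℕ) :
    ∃ (ι : Type) (b : Basis ι ℝ (NegPart Δ x p)) (X : ι → VF n M)
      (h : ∀ i, IsGenerator Δ x p (X i)), Finite ι ∧
      ∀ i, b i = Submodule.Quotient.mk ⟨X i x, secs_apply_mem (h i).1⟩ := by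
  have : FiniteDimensional ℝ (TangentSpace (𝓡 n) x) :=
    inferInstanceAs (FiniteDimensional ℝ (EuclideanSpace ℝ (Fin n)))
  let b := Basis.ofSpan (span_generators hΔ x p)
  choose X hX hXb using fun i => Basis.ofSpan_subset (span_generators hΔ x p) ⟨i, rfl⟩
  exact ⟨_, b, X, hX, Module.Finite.finite_basis b, hXb⟩

/-- A system of local vector fields adapted to the weak derived flag at `x`. -/
structure IsAdapted (Δ : PlaneField n M) (x : M) (κ : ℕ) {A : Type} (X : A → VF n M) (w : A → ℕ)
    (e : Basis A ℝ (Neg Δ x)) : Prop where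
  mem : ∀ a, X a ∈ secs (flag Δ (w a)) x
  pos : ∀ a, 0 < w a
  le : ∀ a, w a ≤ κ
  basis_eq : ∀ a, e a = cls Δ x (w a) (X a x) (secs_apply_mem (mem a))
  range_lof : ∀ p, LinearMap.range (DirectSum.lof ℝ ℕ (NegPart Δ x) p) =
    Submodule.span ℝ {v | ∃ a, w a = p ∧ v = e a}
  gen : ∀ a, 2 ≤ w a → ∃ Y ∈ secs Δ x, ∃ Z ∈ secs (flag Δ (w a - 1)) x, X a = br Y Z

theorem dfinsupp_basis_apply {ι : Type} [DecidableEq ι] {N : ι → Type} [∀ i, AddCommGroup (N i)]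
    [∀ i, Module ℝ (N i)] {η : ι → Type} (b : ∀ i, Basis (η i) ℝ (N i)) (i : ι) (k : η i) :
    (DFinsupp.basis b : Basis _ ℝ (Π₀ i, N i)) ⟨i, k⟩ = DFinsupp.single i (b i k) := by
  classical
  change (DFinsupp.mapRange.linearEquiv fun i => (b i).repr).symm
    (sigmaFinsuppLequivDFinsupp ℝ (Finsupp.single ⟨i, k⟩ 1)) = _
  rw [LinearEquiv.symm_apply_eq]
  have h : (DFinsupp.mapRange.linearEquiv fun i => (b i).repr) (DFinsupp.single i (b i k)) =
      DFinsupp.single i ((b i).repr (b i k)) :=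
    DFinsupp.mapRange_single (hf := fun i => map_zero (b i).repr)
  rw [h, Basis.repr_self]
  exact sigmaFinsuppEquivDFinsupp_single _ _

theorem negPart_subsingleton {Δ : PlaneField n M} {κ : ℕ} (hκ : ∀ y, flag Δ κ y = ⊤) (x : M)
    {p : ℕ} (hp : p = 0 ∨ κ < p) : Subsingleton (NegPart Δ x p) := by
  refine Submodule.Quotient.subsingleton_iff.2 (Submodule.submoduleOf_eq_top.2 ?_)
  rcases hp with rfl | hp
  · exact le_rfl
  · have : flag Δ κ x ≤ flag Δ (p - 1) x := flag_mono Δ x (by omega)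
    exact le_top.trans ((hκ x).symm.le.trans this)

theorem exists_isAdapted {Δ : PlaneField n M} (hΔ : IsDistribution Δ) {κ : ℕ}
    (hκ : ∀ y, flag Δ κ y = ⊤) (x : M) :
    ∃ (A : Type) (_ : Finite A) (X : A → VF n M) (w : A → ℕ) (e : Basis A ℝ (Neg Δ x)),
      IsAdapted Δ x κ X w e := by
  classical
  choose ι b X hX hfin hXb using exists_generator_basis hΔ x
  let e : Basis ((p : ℕ) × ι p) ℝ (Neg Δ x) := DFinsupp.basis b
  have he : ∀ a, e a = DirectSum.lof ℝ ℕ (NegPart Δ x) a.1 (b a.1 a.2) := fun a =>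
    dfinsupp_basis_apply b a.1 a.2
  -- The graded pieces of degree zero and beyond κ vanish, so they contribute no basis vectors; this
  -- bounds the weights and makes the index type finite.
  have hpos : ∀ a : (p : ℕ) × ι p, ¬ (a.1 = 0 ∨ κ < a.1) := by
    rintro a h
    have := negPart_subsingleton hκ x h
    exact (b a.1).ne_zero a.2 (Subsingleton.elim _ _)
  refine ⟨(p : ℕ) × ι p, ?_, fun a => X a.1 a.2, fun a => a.1, e, ?_⟩
  · refine Finite.of_injective (β := (p : Fin (κ + 1)) × ι p)
      (fun a => ⟨⟨a.1, by have := hpos a; omega⟩, a.2⟩) ?_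
    rintro ⟨p, i⟩ ⟨q, j⟩ h
    simp only [Sigma.mk.injEq, Fin.mk.injEq] at h
    obtain ⟨rfl, h⟩ := h
    rw [eq_of_heq h]
  · refine ⟨fun a => (hX a.1 a.2).1, fun a => ?_, fun a => ?_, fun a => ?_, fun p => ?_,
      fun a => (hX a.1 a.2).2⟩
    · have := hpos a; omega
    · have := hpos a; omega
    · rw [he, cls, ← hXb]
    · refine le_antisymm ?_ (Submodule.span_le.2 ?_)
      · rw [LinearMap.range_eq_map, ← (b p).span_eq, Submodule.map_span_le]
        rintro _ ⟨i, rfl⟩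
        exact Submodule.subset_span ⟨⟨p, i⟩, rfl, (he ⟨p, i⟩).symm⟩
      · rintro _ ⟨a, rfl, rfl⟩
        rw [he a]
        exact LinearMap.mem_range_self _ _

end AdaptedFrames

/-! ### From adapted systems to frames of the flag near the point -/

section FlagFrames

open Filter VectorField Module

variable {n : ℕ} {M : Type*} [TopologicalSpace M] [ChartedSpace (EuclideanSpace ℝ (Fin n)) M]
  [IsManifold (𝓡 n) ∞ M]

/-- The projection of the `p`-th member of the flag to `𝔪`. -/
def clsMap (Δ : PlaneField n M) (x : M) (p : ℕ) : flag Δ p x →ₗ[ℝ] Neg Δ x :=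
  (DirectSum.lof ℝ ℕ (NegPart Δ x) p).comp (Submodule.mkQ _)

theorem clsMap_eq_iff {Δ : PlaneField n M} {x : M} {p : ℕ} {u v : TangentSpace (𝓡 n) x}
    {hu : u ∈ flag Δ p x} {hv : v ∈ flag Δ p x} :
    clsMap Δ x p ⟨u, hu⟩ = clsMap Δ x p ⟨v, hv⟩ ↔ u - v ∈ flag Δ (p - 1) x := by
  have h : Function.Injective (DirectSum.lof ℝ ℕ (NegPart Δ x) p) := DFinsupp.single_injective
  rw [clsMap, LinearMap.comp_apply, LinearMap.comp_apply, h.eq_iff]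
  exact Submodule.Quotient.eq _

theorem clsMap_eq_zero_iff {Δ : PlaneField n M} {x : M} {p : ℕ} {v : TangentSpace (𝓡 n) x}
    {hv : v ∈ flag Δ p x} : clsMap Δ x p ⟨v, hv⟩ = 0 ↔ v ∈ flag Δ (p - 1) x := by
  have h := clsMap_eq_iff (hu := hv) (hv := Submodule.zero_mem (flag Δ p x))
  rw [sub_zero] at h
  rw [← h, ← map_zero (clsMap Δ x p)]
  rfl

theorem exists_rep_sum_eq (x : M) (z : EuclideanSpace ℝ (Fin n)) {A : Type*} [Fintype A]
    (X : A → VF n M) :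
    ∃ T : EuclideanSpace ℝ (Fin n) →L[ℝ] EuclideanSpace ℝ (Fin n), ∀ c : A → ℝ,
      ∑ a, c a • rep x (X a) z =
        T (∑ a, c a • (X a ((extChartAt (𝓡 n) x).symm z) : EuclideanSpace ℝ (Fin n))) := by
  have key : ∀ (T : EuclideanSpace ℝ (Fin n) →L[ℝ] EuclideanSpace ℝ (Fin n)) (c : A → ℝ)
      (v : A → EuclideanSpace ℝ (Fin n)), ∑ a, c a • T (v a) = T (∑ a, c a • v a) := by simp
  exact ⟨_, fun c => key _ c _⟩

theorem basis_coeff_eq_zero {m : Type*} [AddCommMonoid m] [Module ℝ m] {A : Type*} [Fintype A]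
    (e : Basis A ℝ m) {c : A → ℝ} {P : A → Prop} [DecidablePred P]
    (h : ∑ a, (if P a then c a • e a else 0) = 0) {a : A} (ha : P a) : c a = 0 := by
  classical
  have h1 := congrArg (fun v => e.repr v a) h
  have h2 : ∀ b, e.repr (if P b then c b • e b else 0) a = if b = a then c a else 0 := by
    intro b
    by_cases hb : b = a
    · subst hb; simp [ha]
    · split_ifs <;> simp [hb]
  simpa [map_sum, Finsupp.finsetSum_apply, h2] using h1

namespace IsAdapted

variable {Δ : PlaneField n M} {x : M} {κ : ℕ} {A : Type} [Fintype A] [DecidableEq A]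
  {X : A → VF n M} {w : A → ℕ} {e : Basis A ℝ (Neg Δ x)} (hA : IsAdapted Δ x κ X w e)
include hA

theorem apply_mem (a : A) : X a x ∈ flag Δ (w a) x := secs_apply_mem (hA.mem a)

theorem cls_sum {p : ℕ} {c : A → ℝ} (hc : ∀ a, p < w a → c a = 0) {v : TangentSpace (𝓡 n) x}
    (h : v = ∑ a, c a • X a x) (hv : v ∈ flag Δ p x) :
    cls Δ x p v hv = ∑ a, if w a = p then c a • e a else 0 := by
  change clsMap Δ x p ⟨v, hv⟩ = _
  have h1 : (⟨v, hv⟩ : flag Δ p x) = ∑ a, c a •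
      (if h : w a ≤ p then ⟨X a x, flag_mono Δ x h (hA.apply_mem a)⟩ else 0 : flag Δ p x) := by
    apply Subtype.ext
    rw [AddSubmonoidClass.coe_finsetSum]
    refine h.trans ?_
    refine Finset.sum_congr rfl fun a _ => ?_
    split_ifs with h2
    · rfl
    · rw [hc a (not_le.1 h2), zero_smul, zero_smul]; rfl
  rw [h1, map_sum]
  refine Finset.sum_congr rfl fun a _ => ?_
  rw [map_smul]
  split_ifs with h2 h3 h3
  · subst h3
    rw [hA.basis_eq]
    rfl
  · have : clsMap Δ x p ⟨X a x, flag_mono Δ x h2 (hA.apply_mem a)⟩ = 0 :=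
      clsMap_eq_zero_iff.2 (flag_mono Δ x (by omega) (hA.apply_mem a))
    rw [this, smul_zero]
  · omega
  · rw [map_zero, smul_zero]

theorem linearIndependent : LinearIndependent ℝ fun a => X a x := by
  rw [Fintype.linearIndependent_iff]
  intro c hc
  -- Descending induction on the weight: once heavier coefficients vanish, passing to the class in
  -- degree `w a` isolates those of weight `w a`.
  have key : ∀ q, ∀ a, κ < w a + q → c a = 0 := by
    intro q
    induction q with
    | zero => intro a ha; have := hA.le a; omega
    | succ q ih =>
      intro a ha
      by_cases h : κ < w a + q
      · exact ih a h
      have h1 := hA.cls_sum (p := w a) (c := c) (fun b hb => ih b (by omega)) hc.symm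
        (Submodule.zero_mem _)
      have h2 : cls Δ x (w a) 0 (Submodule.zero_mem _) = 0 := map_zero (clsMap Δ x (w a))
      rw [h2] at h1
      exact basis_coeff_eq_zero e (P := fun b => w b = w a) h1.symm rfl
  exact fun a => key (κ + 1) a (by omega)

/-- The classes of the fields of weight `p + 1` span the graded piece, so a vector of level `p + 1`
minus a combination of them drops to level `p`. -/
theorem flag_eq_span (p : ℕ) :
    flag Δ p x = Submodule.span ℝ {v | ∃ a, w a ≤ p ∧ v = X a x} := by
  have hle : ∀ p, Submodule.span ℝ {v | ∃ a, w a ≤ p ∧ v = X a x} ≤ flag Δ p x := by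
    intro p
    refine Submodule.span_le.2 ?_
    rintro _ ⟨a, ha, rfl⟩
    exact flag_mono Δ x ha (hA.apply_mem a)
  refine le_antisymm ?_ (hle p)
  induction p with
  | zero => exact bot_le
  | succ p ih =>
    intro u hu
    have h1 : ∀ v ∈ Submodule.span ℝ {v | ∃ a, w a = p + 1 ∧ v = e a},
        ∃ t, ∃ ht : t ∈ flag Δ (p + 1) x,
          t ∈ Submodule.span ℝ {v | ∃ a, w a ≤ p + 1 ∧ v = X a x} ∧
          v = clsMap Δ x (p + 1) ⟨t, ht⟩ := by
      intro v hv
      induction hv using Submodule.span_induction with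
      | mem v hv =>
        obtain ⟨a, ha, rfl⟩ := hv
        refine ⟨X a x, ha ▸ hA.apply_mem a, Submodule.subset_span ⟨a, ha.le, rfl⟩, ?_⟩
        rw [hA.basis_eq]
        change clsMap Δ x (w a) _ = _
        congr!
      | zero => exact ⟨0, Submodule.zero_mem _, Submodule.zero_mem _, (map_zero _).symm⟩
      | add v v' _ _ h h' =>
        obtain ⟨t, ht, h1, rfl⟩ := h
        obtain ⟨t', ht', h1', rfl⟩ := h'
        exact ⟨t + t', Submodule.add_mem _ ht ht', Submodule.add_mem _ h1 h1',
          (map_add (clsMap Δ x (p + 1)) ⟨t, ht⟩ ⟨t', ht'⟩).symm⟩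
      | smul r v _ h =>
        obtain ⟨t, ht, h1, rfl⟩ := h
        exact ⟨r • t, Submodule.smul_mem _ _ ht, Submodule.smul_mem _ _ h1,
          (map_smul (clsMap Δ x (p + 1)) r ⟨t, ht⟩).symm⟩
    obtain ⟨t, ht, h2, h3⟩ := h1 (clsMap Δ x (p + 1) ⟨u, hu⟩) (by
      rw [← hA.range_lof]
      exact LinearMap.mem_range_self _ _)
    have h4 := ih (clsMap_eq_iff.1 h3)
    have h5 : u - t ∈ Submodule.span ℝ {v | ∃ a, w a ≤ p + 1 ∧ v = X a x} := by
      refine Submodule.span_mono ?_ h4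
      rintro v ⟨a, ha, hv⟩
      exact ⟨a, by omega, hv⟩
    rw [← sub_add_cancel u t]
    exact Submodule.add_mem _ h5 h2

theorem span_eq_top (hκ : flag Δ κ x = ⊤) : ⊤ ≤ Submodule.span ℝ (Set.range fun a => X a x) := by
  rw [← hκ, hA.flag_eq_span]
  exact Submodule.span_mono fun v ⟨a, _, hv⟩ => ⟨a, hv.symm⟩

theorem isFrameAt (hκ : flag Δ κ x = ⊤) :
    IsFrameAt (extChartAt (𝓡 n) x x) fun a => rep x (X a) := by
  refine IsFrameAt.of_isInvertible (fun a => (hA.mem a).1.rep_smNear) ?_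
  let b : Basis A ℝ (EuclideanSpace ℝ (Fin n)) := Basis.mk hA.linearIndependent (hA.span_eq_top hκ)
  obtain ⟨D₀, hD⟩ := (eventually_isInvertible (n := n) x).self_of_nhds
  let D : EuclideanSpace ℝ (Fin n) ≃L[ℝ] EuclideanSpace ℝ (Fin n) := D₀
  let L : (A → ℝ) ≃L[ℝ] EuclideanSpace ℝ (Fin n) :=
    b.equivFun.symm.toContinuousLinearEquiv.trans D.symm
  refine ⟨L, ?_⟩
  have hr : ∀ a, rep x (X a) (extChartAt (𝓡 n) x x) =
      D.symm (X a x : EuclideanSpace ℝ (Fin n)) := by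
    intro a
    rw [rep_eq, ← hD, ContinuousLinearMap.inverse_equiv]
    exact congrArg (fun y => D.symm (X a y : EuclideanSpace ℝ (Fin n))) (extChartAt_to_inv x)
  have hb : ∀ a, b a = (X a x : EuclideanSpace ℝ (Fin n)) := Basis.mk_apply _ _
  ext1 c
  rw [frameMap_apply]
  change D.symm (b.equivFun.symm c) = _
  rw [Basis.equivFun_symm_apply, map_sum]
  refine Finset.sum_congr rfl fun a _ => ?_
  rw [map_smul]
  exact congrArg (c a • ·) ((congrArg D.symm (hb a)).trans (hr a).symm)

theorem eventually_linearIndependent (hκ : flag Δ κ x = ⊤) :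
    ∀ᶠ y in 𝓝 x, LinearIndependent ℝ fun a => X a y := by
  rw [← eventually_chart_iff (n := n)]
  filter_upwards [(hA.isFrameAt hκ).inv] with z hz
  rw [Fintype.linearIndependent_iff]
  intro c hc
  have : frameMap (fun a => rep x (X a)) z c = 0 := by
    obtain ⟨T, hT⟩ := exists_rep_sum_eq x z X
    rw [frameMap_apply, hT]
    exact (congrArg T hc).trans (map_zero _)
  exact congrFun (hz.injective (this.trans (map_zero _).symm))

/-- Regularity enters here: near `x` the fields of weight at most `p` stay independent and in Δ_p,
and their number is its constant rank. -/
theorem eventually_flag_le (hreg : IsRegular Δ) (hκ : flag Δ κ x = ⊤) (p : ℕ) :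
    ∀ᶠ y in 𝓝 x, flag Δ p y ≤ Submodule.span ℝ {v | ∃ a, w a ≤ p ∧ v = X a y} := by
  obtain ⟨r, hr⟩ := hreg p
  have hspan : ∀ y, {v | ∃ a, w a ≤ p ∧ v = X a y} =
      Set.range fun a : {a // w a ≤ p} => X a.1 y := by
    intro y
    ext v
    exact ⟨fun ⟨a, ha, hv⟩ => ⟨⟨a, ha⟩, hv.symm⟩, fun ⟨a, hv⟩ => ⟨a.1, a.2, hv.symm⟩⟩
  have hcard : ∀ y, LinearIndependent ℝ (fun a => X a y) →
      finrank ℝ (Submodule.span ℝ (Set.range fun a : {a // w a ≤ p} => X a.1 y)) =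
        Fintype.card {a // w a ≤ p} := fun y hy =>
    finrank_span_eq_card (hy.comp (Subtype.val : {a // w a ≤ p} → A) Subtype.val_injective)
  have hx := hr x
  rw [hA.flag_eq_span, hspan, hcard x hA.linearIndependent] at hx
  filter_upwards [hA.eventually_linearIndependent hκ,
    eventually_all.2 fun a => (hA.mem a).2] with y h1 h2
  have : FiniteDimensional ℝ (TangentSpace (𝓡 n) y) :=
    inferInstanceAs (FiniteDimensional ℝ (EuclideanSpace ℝ (Fin n)))
  refine (Submodule.eq_of_le_of_finrank_eq (Submodule.span_le.2 ?_) ?_).ge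
  · rintro _ ⟨a, ha, rfl⟩
    exact flag_mono Δ y ha (h2 a)
  · rw [hspan, hcard y h1, hr, hx]

end IsAdapted

/-- A frame adapted to the weak derived flag near `x`. -/
structure IsFlagFrame (Δ : PlaneField n M) (x : M) (κ : ℕ) {A : Type} [Fintype A] [DecidableEq A]
    (X : A → VF n M) (w : A → ℕ) (e : Basis A ℝ (Neg Δ x)) : Prop
    extends IsAdapted Δ x κ X w e where
  frame : IsFrameAt (extChartAt (𝓡 n) x x) fun a => rep x (X a)
  flag_le : ∀ p, ∀ᶠ y in 𝓝 x, flag Δ p y ≤ Submodule.span ℝ {v | ∃ a, w a ≤ p ∧ v = X a y}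

theorem exists_isFlagFrame {Δ : PlaneField n M} (hΔ : IsDistribution Δ) (hreg : IsRegular Δ)
    {κ : ℕ} (hκ : ∀ y, flag Δ κ y = ⊤) (x : M) :
    ∃ (A : Type) (_ : Fintype A) (_ : DecidableEq A) (X : A → VF n M) (w : A → ℕ)
      (e : Basis A ℝ (Neg Δ x)), IsFlagFrame Δ x κ X w e := by
  classical
  obtain ⟨A, _, X, w, e, hA⟩ := exists_isAdapted hΔ hκ x
  have := Fintype.ofFinite A
  exact ⟨A, inferInstance, inferInstance, X, w, e, hA, hA.isFrameAt (hκ x),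
    hA.eventually_flag_le hreg (hκ x)⟩

end FlagFrames

/-! ### The flag and its symmetries in terms of coefficients -/

section Coefficients

open Filter VectorField Module

variable {n : ℕ} {M : Type*} [TopologicalSpace M] [ChartedSpace (EuclideanSpace ℝ (Fin n)) M]
  [IsManifold (𝓡 n) ∞ M] {Δ : PlaneField n M} {x : M} {κ : ℕ} {A : Type} [Fintype A]
  [DecidableEq A] {X : A → VF n M} {w : A → ℕ}

/-- The germs of the coefficients of local vector fields with respect to a frame. -/
def coefMap (hV : IsFrameAt (extChartAt (𝓡 n) x x) fun a => rep x (X a)) :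
    LocVF (n := n) x →ₗ[ℝ] A → GermRing (extChartAt (𝓡 n) x x) where
  toFun Y := hV.coef (rep x Y.1) (SmoothNear.rep_smNear Y.2)
  map_add' Y Z := by
    funext a
    refine Eq.trans (germ_eq_iff.2 ?_) (germ_add (hV.smNear_frameCoef
      (SmoothNear.rep_smNear Y.2) a) (hV.smNear_frameCoef (SmoothNear.rep_smNear Z.2) a))
    refine Eventually.of_forall fun y => ?_
    change frameCoef _ (rep x (Y.1 + Z.1)) y a = _
    simp [frameCoef, rep_add]
  map_smul' c Y := by
    funext a
    refine Eq.trans (germ_eq_iff.2 ?_) (germ_smul c (hV.smNear_frameCoef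
      (SmoothNear.rep_smNear Y.2) a))
    refine Eventually.of_forall fun y => ?_
    change frameCoef _ (rep x (c • Y.1)) y a = _
    simp [frameCoef, rep_smul]

theorem coefMap_br (hV : IsFrameAt (extChartAt (𝓡 n) x x) fun a => rep x (X a)) {Y Z : VF n M}
    (hY : SmoothNear x Y) (hZ : SmoothNear x Z) :
    coefMap hV ⟨br Y Z, hY.br hZ⟩ =
      tupleBr hV.ders hV.structureFun (coefMap hV ⟨Y, hY⟩) (coefMap hV ⟨Z, hZ⟩) :=
  (hV.coef_congr (hY.br hZ).rep_smNear _ (rep_br hY hZ)).trans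
    (hV.coef_lieBracket hY.rep_smNear hZ.rep_smNear)

theorem mem_van_iff (hV : IsFrameAt (extChartAt (𝓡 n) x x) fun a => rep x (X a)) {Y : VF n M}
    (hY : SmoothNear x Y) {k : ℕ} : Y ∈ van x k ↔
      ∀ a, coefMap hV ⟨Y, hY⟩ a ∈ jOrd (germEval (extChartAt (𝓡 n) x x)) hV.ders (k + 1) :=
  Iff.trans ⟨fun h => h.2, fun h => ⟨hY, h⟩⟩ (hV.vanTo_iff hY.rep_smNear)

theorem rep_eq_sum_iff {z : EuclideanSpace ℝ (Fin n)}
    (hz : (mfderivWithin 𝓘(ℝ, EuclideanSpace ℝ (Fin n)) (𝓡 n) (extChartAt (𝓡 n) x).symm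
      (Set.range (𝓡 n)) z).IsInvertible) (Y : VF n M) (c : A → ℝ) :
    rep x Y z = ∑ a, c a • rep x (X a) z ↔
      Y ((extChartAt (𝓡 n) x).symm z) = ∑ a, c a • X a ((extChartAt (𝓡 n) x).symm z) := by
  obtain ⟨D, hD⟩ := hz
  have key : ∀ (T : EuclideanSpace ℝ (Fin n) ≃L[ℝ] EuclideanSpace ℝ (Fin n))
      (u : EuclideanSpace ℝ (Fin n)) (v : A → EuclideanSpace ℝ (Fin n)),
      T u = ∑ a, c a • T (v a) ↔ u = ∑ a, c a • v a := by
    intro T u v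
    simp only [← map_smul, ← map_sum, T.injective.eq_iff]
  simp only [rep_eq, ← hD, ContinuousLinearMap.inverse_equiv]
  exact key D.symm _ _

theorem eventually_eq_sum (hV : IsFrameAt (extChartAt (𝓡 n) x x) fun a => rep x (X a))
    (Y : VF n M) :
    ∀ᶠ z in 𝓝 (extChartAt (𝓡 n) x x), Y ((extChartAt (𝓡 n) x).symm z) =
      ∑ a, frameCoef (fun a => rep x (X a)) (rep x Y) z a •
        X a ((extChartAt (𝓡 n) x).symm z) := by
  filter_upwards [hV.sum_frameCoef (rep x Y), eventually_isInvertible (n := n) x] with z h1 h2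
  exact (rep_eq_sum_iff h2 Y _).1 h1.symm

theorem apply_eq_sum (hV : IsFrameAt (extChartAt (𝓡 n) x x) fun a => rep x (X a)) {Y : VF n M}
    (hY : SmoothNear x Y) :
    Y x = ∑ a, germEval _ (coefMap hV ⟨Y, hY⟩ a) • X a x := by
  have h := (eventually_eq_sum hV Y).self_of_nhds
  rw [extChartAt_to_inv] at h
  exact h

theorem exists_sum_eq_of_mem_span {F : Type*} [AddCommGroup F] [Module ℝ F] {u : A → F}
    {P : A → Prop} {v : F} (hv : v ∈ Submodule.span ℝ {v | ∃ a, P a ∧ v = u a}) :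
    ∃ c : A → ℝ, (∀ a, ¬ P a → c a = 0) ∧ v = ∑ a, c a • u a := by
  induction hv using Submodule.span_induction with
  | mem v hv =>
    obtain ⟨b, hb, rfl⟩ := hv
    refine ⟨Pi.single b 1, fun a ha => ?_, ?_⟩
    · rw [Pi.single_eq_of_ne]
      rintro rfl
      exact ha hb
    · simp [Pi.single_apply]
  | zero => exact ⟨0, fun _ _ => rfl, by simp⟩
  | add u v _ _ hu hv =>
    obtain ⟨c, h1, rfl⟩ := hu
    obtain ⟨d, h2, rfl⟩ := hv
    exact ⟨c + d, fun a ha => by simp [h1 a ha, h2 a ha],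
      by simp [add_smul, Finset.sum_add_distrib]⟩
  | smul r v _ hv =>
    obtain ⟨c, h1, rfl⟩ := hv
    exact ⟨r • c, fun a ha => by simp [h1 a ha], by simp [Finset.smul_sum, smul_smul]⟩

namespace IsFlagFrame

variable {e : Basis A ℝ (Neg Δ x)} (hF : IsFlagFrame Δ x κ X w e)
include hF

/-- The frame fields of weight at most `p` span Δ_p on a whole neighbourhood, so this dictionary is
between germs, not values at `x`. -/
theorem mem_secs_iff {Y : VF n M} (hY : SmoothNear x Y) {p : ℕ} :
    Y ∈ secs (flag Δ p) x ↔ ∀ a, p < w a → coefMap hF.frame ⟨Y, hY⟩ a = 0 := by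
  constructor
  · intro h a ha
    refine germ_eq_zero_iff.2 ?_
    filter_upwards [eventually_chart_iff.2 h.2, eventually_chart_iff.2 (hF.flag_le p),
      hF.frame.frameCoef_eq, eventually_isInvertible (n := n) x] with z h1 h2 h3 h4
    obtain ⟨c, hc, hv⟩ := exists_sum_eq_of_mem_span (h2 h1)
    rw [h3 _ _ ((rep_eq_sum_iff h4 Y c).2 hv)]
    exact hc a (not_le.2 ha)
  · intro h
    refine ⟨hY, eventually_chart_iff (n := n).1 ?_⟩
    have h0 : ∀ a, ∀ᶠ z in 𝓝 (extChartAt (𝓡 n) x x), p < w a →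
        frameCoef (fun a => rep x (X a)) (rep x Y) z a = 0 := by
      intro a
      by_cases ha : p < w a
      · filter_upwards [germ_eq_zero_iff.1 (h a ha)] with z hz _ using hz
      · exact Eventually.of_forall fun z hz => absurd hz ha
    filter_upwards [eventually_eq_sum hF.frame Y, eventually_all.2 h0,
      eventually_all.2 fun a => eventually_chart_iff.2 (hF.mem a).2] with z h1 h2 h3
    rw [h1]
    refine Submodule.sum_mem _ fun a _ => ?_
    by_cases ha : p < w a
    · rw [h2 a ha, zero_smul]; exact Submodule.zero_mem _
    · exact Submodule.smul_mem _ _ (flag_mono Δ _ (not_lt.1 ha) (h3 a))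

theorem smooth (a : A) : SmoothNear x (X a) := (hF.mem a).1

theorem coefMap_frame (a : A) : coefMap hF.frame ⟨X a, hF.smooth a⟩ = Pi.single a 1 :=
  hF.frame.coef_frame a

theorem vec_coefMap_mem {Y : VF n M} (hY : SmoothNear x Y) {p : ℕ} :
    vec hF.frame.ders (coefMap hF.frame ⟨Y, hY⟩) ∈ derFil hF.frame.ders w p ↔
      Y ∈ secs (flag Δ p) x := by
  rw [vec_mem_derFil_iff hF.frame.vec_ders_injective, hF.mem_secs_iff]

theorem vec_coefMap_br {Y Z : VF n M} (hY : SmoothNear x Y) (hZ : SmoothNear x Z) :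
    vec hF.frame.ders (coefMap hF.frame ⟨br Y Z, hY.br hZ⟩) =
      ⁅vec hF.frame.ders (coefMap hF.frame ⟨Y, hY⟩),
        vec hF.frame.ders (coefMap hF.frame ⟨Z, hZ⟩)⁆ := by
  rw [coefMap_br, vec_tupleBr _ _ hF.frame.lie_ders]

theorem ders_eq_vec (a : A) :
    hF.frame.ders a = vec hF.frame.ders (coefMap hF.frame ⟨X a, hF.smooth a⟩) := by
  rw [hF.coefMap_frame, vec_single]

theorem exists_ders_eq_lie (a : A) (ha : 2 ≤ w a) : ∃ Y ∈ derFil hF.frame.ders w 1,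
    ∃ Z ∈ derFil hF.frame.ders w (w a - 1), hF.frame.ders a = ⁅Y, Z⁆ := by
  obtain ⟨Y, hY, Z, hZ, h⟩ := hF.gen a ha
  refine ⟨_, (hF.vec_coefMap_mem hY.1).2 hY, _, (hF.vec_coefMap_mem hZ.1).2 hZ, ?_⟩
  rw [← hF.vec_coefMap_br, hF.ders_eq_vec]
  congr 3

theorem lie_mem_derFil_add (p : ℕ) : ∀ Y ∈ derFil hF.frame.ders w p, ∀ q,
    ∀ Z ∈ derFil hF.frame.ders w q, ⁅Y, Z⁆ ∈ derFil hF.frame.ders w (p + q) := by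
  refine WeakFlag.lie_mem_derFil_add hF.pos (fun a b ha => ?_) hF.exists_ders_eq_lie p
  have h1 : X a ∈ secs Δ x := by
    have := hF.mem a
    rw [ha] at this
    exact this
  rw [hF.ders_eq_vec a, hF.ders_eq_vec b, ← hF.vec_coefMap_br, hF.vec_coefMap_mem]
  exact br_mem_secs_succ h1 (hF.mem b)

theorem br_mem_secs_add {p q : ℕ} {Y Z : VF n M} (hY : Y ∈ secs (flag Δ p) x)
    (hZ : Z ∈ secs (flag Δ q) x) : br Y Z ∈ secs (flag Δ (p + q)) x := by
  rw [← hF.vec_coefMap_mem (hY.1.br hZ.1), hF.vec_coefMap_br hY.1 hZ.1]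
  exact hF.lie_mem_derFil_add p _ ((hF.vec_coefMap_mem hY.1).2 hY) q _
    ((hF.vec_coefMap_mem hZ.1).2 hZ)

theorem sym_br_mem {Y : VF n M} (hY : Y ∈ sym Δ x) {p : ℕ} {Z : VF n M}
    (hZ : Z ∈ secs (flag Δ p) x) : br Y Z ∈ secs (flag Δ p) x := by
  rw [← hF.vec_coefMap_mem (hY.1.br hZ.1), hF.vec_coefMap_br hY.1 hZ.1]
  refine lie_mem_derFil_self hF.pos hF.lie_mem_derFil_add hF.exists_ders_eq_lie (fun b hb => ?_) p _
    ((hF.vec_coefMap_mem hZ.1).2 hZ)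
  have h1 : X b ∈ secs Δ x := by
    have := hF.mem b
    rw [hb] at this
    exact this
  rw [hF.ders_eq_vec b, ← hF.vec_coefMap_br, hF.vec_coefMap_mem]
  exact hY.2 _ h1

/-- A symmetry of Δ preserves every level of the flag exactly, so it solves the equation to every
order. -/
theorem sym_le_lieEqn (k : ℕ) : sym Δ x ≤ lieEqn Δ x k :=
  fun _ hY => ⟨hY.1, fun _ _ hZ => Submodule.mem_sup_left (hF.sym_br_mem hY hZ)⟩

theorem structureFun_eq (a b : A) : hF.frame.structureFun a b =
    coefMap hF.frame ⟨br (X a) (X b), (hF.smooth a).br (hF.smooth b)⟩ :=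
  (hF.frame.coef_congr ((hF.smooth a).br (hF.smooth b)).rep_smNear _
    (rep_br (hF.smooth a) (hF.smooth b))).symm

theorem weightedFrame : WeightedFrame hF.frame.ders hF.frame.structureFun w κ where
  pos := hF.pos
  le := hF.le
  lie := hF.frame.lie_ders
  graded a b := by
    rw [hF.structureFun_eq]
    exact (hF.mem_secs_iff _).1 (hF.br_mem_secs_add (hF.mem a) (hF.mem b))
  gen a ha := by
    obtain ⟨Y, hY, Z, hZ, h⟩ := hF.gen a ha
    refine ⟨coefMap hF.frame ⟨Y, hY.1⟩, coefMap hF.frame ⟨Z, hZ.1⟩, fun b hb => ?_, fun b hb => ?_,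
      ?_⟩
    · have := hF.pos b
      exact (hF.mem_secs_iff (p := 1) hY.1).1 hY b (by omega)
    · exact (hF.mem_secs_iff hZ.1).1 hZ b (by omega)
    · rw [← hF.vec_coefMap_br, hF.ders_eq_vec]
      congr 3

theorem cls_eq_sum {p : ℕ} {Y : VF n M} (hY : Y ∈ secs (flag Δ p) x) (h : Y x ∈ flag Δ p x) :
    cls Δ x p (Y x) h =
      ∑ a, if w a = p then germEval _ (coefMap hF.frame ⟨Y, hY.1⟩ a) • e a else 0 := by
  refine hF.toIsAdapted.cls_sum (fun a ha => ?_) (apply_eq_sum hF.frame hY.1) h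
  rw [(hF.mem_secs_iff hY.1).1 hY a ha, map_zero]

end IsFlagFrame

end Coefficients

/-! ### The bracket with leading structure constants -/

section SymbolBracket

open Module

variable {R : Type*} [CommRing R] [Algebra ℝ R] {A : Type} [Fintype A] [DecidableEq A]
  {m : Type} [AddCommMonoid m] [Module ℝ m]

/-- The bracket whose structure constants are the leading values of structure functions. -/
def symbolBr (ε : R →ₐ[ℝ] ℝ) (C : A → A → A → R) (w : A → ℕ) (e : Basis A ℝ m) :
    m →ₗ[ℝ] m →ₗ[ℝ] m :=
  e.constr ℝ fun a => e.constr ℝ fun b => ∑ c, if w c = w a + w b then ε (C a b c) • e c else 0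

theorem symbolBr_sum_sum (ε : R →ₐ[ℝ] ℝ) (C : A → A → A → R) (w : A → ℕ) (e : Basis A ℝ m)
    (s t : A → ℝ) : symbolBr ε C w e (∑ a, s a • e a) (∑ b, t b • e b) =
      ∑ c, (∑ a, ∑ b, if w c = w a + w b then s a * t b * ε (C a b c) else 0) • e c := by
  simp only [map_sum, map_smul, LinearMap.sum_apply, LinearMap.smul_apply, symbolBr,
    Basis.constr_basis, Finset.smul_sum, Finset.sum_smul]
  have h : ∀ a b c, s a • t b • (if w c = w a + w b then ε (C a b c) • e c else 0) =
      (if w c = w a + w b then s a * t b * ε (C a b c) else 0) • e c := by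
    intro a b c
    split_ifs
    · rw [smul_smul, smul_smul]
    · simp
  have h2 : ∀ F : A → A → A → m, ∑ c, ∑ a, ∑ b, F a b c = ∑ a, ∑ b, ∑ c, F a b c := by
    intro F
    rw [Finset.sum_comm]
    exact Finset.sum_congr rfl fun a _ => Finset.sum_comm
  rw [h2 fun a b c => (if w c = w a + w b then s a * t b * ε (C a b c) else 0) • e c]
  simp only [← h]
  rw [Finset.sum_comm]
  exact Finset.sum_congr rfl fun a _ => Finset.sum_congr rfl fun b _ =>
    Finset.sum_congr rfl fun c _ => smul_comm _ _ _

/-- In weight `p + q` the terms differentiating coefficients vanish, because `f` has no components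
above `p` and `g` none above `q`. Gradedness then leaves only the structure functions with `w a = p`
and `w b = q`. -/
theorem WeightedFrame.symbolBr_leading {ε : R →ₐ[ℝ] ℝ} {E : A → Derivation ℝ R R}
    {C : A → A → A → R} {w : A → ℕ} {κ : ℕ} (H : WeightedFrame E C w κ) (e : Basis A ℝ m)
    {p q : ℕ} {f g : A → R} (hf : ∀ a, p < w a → f a = 0) (hg : ∀ a, q < w a → g a = 0) :
    symbolBr ε C w e (∑ a, if w a = p then ε (f a) • e a else 0)
        (∑ b, if w b = q then ε (g b) • e b else 0) =
      ∑ c, if w c = p + q then ε (tupleBr E C f g c) • e c else 0 := by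
  have h1 : ∀ (p : ℕ) (f : A → R), (∑ a, if w a = p then ε (f a) • e a else 0) =
      ∑ a, (if w a = p then ε (f a) else 0) • e a := fun p f =>
    Finset.sum_congr rfl fun a _ => by split_ifs <;> simp
  rw [h1, h1, symbolBr_sum_sum]
  refine Finset.sum_congr rfl fun c _ => ?_
  split_ifs with hc
  · congr 1
    have h2 : vec E f (g c) = 0 := by
      rcases Nat.eq_zero_or_pos p with rfl | hp
      · have : f = 0 := funext fun a => hf a (H.pos a)
        rw [this, map_zero, Derivation.coe_zero, Pi.zero_apply]
      · rw [hg c (by omega), map_zero]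
    have h3 : vec E g (f c) = 0 := by
      rcases Nat.eq_zero_or_pos q with rfl | hp
      · have : g = 0 := funext fun a => hg a (H.pos a)
        rw [this, map_zero, Derivation.coe_zero, Pi.zero_apply]
      · rw [hf c (by omega), map_zero]
    rw [tupleBr, h2, h3, sub_zero, zero_add, map_sum]
    refine Finset.sum_congr rfl fun a _ => ?_
    rw [map_sum]
    refine Finset.sum_congr rfl fun b _ => ?_
    rw [map_mul, map_mul]
    by_cases ha : p < w a
    · simp [hf a ha]
    by_cases hb : q < w b
    · simp [hg b hb]
    by_cases hab : w a + w b < w c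
    · simp [H.graded a b c hab]
    rw [if_pos (by omega), if_pos (by omega), if_pos (by omega)]
  · rw [Finset.sum_eq_zero, zero_smul]
    intro a _
    refine Finset.sum_eq_zero fun b _ => ?_
    split_ifs <;> first | omega | simp

end SymbolBracket

/-! ### The bracket of the graded nilpotent algebra -/

section Levi

open Filter VectorField Module

variable {n : ℕ} {M : Type*} [TopologicalSpace M] [ChartedSpace (EuclideanSpace ℝ (Fin n)) M]
  [IsManifold (𝓡 n) ∞ M] {Δ : PlaneField n M} {x : M} {κ : ℕ} {A : Type} [Fintype A]
  [DecidableEq A] {X : A → VF n M} {w : A → ℕ}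

namespace IsFlagFrame

variable {e : Basis A ℝ (Neg Δ x)} (hF : IsFlagFrame Δ x κ X w e)
include hF

theorem isLeviBracket_symbolBr : IsLeviBracket Δ x
    (symbolBr (m := Neg Δ x) (germEval (extChartAt (𝓡 n) x x)) hF.frame.structureFun w e) := by
  intro p q Y Z hY hZ
  have h := hF.br_mem_secs_add hY hZ
  refine ⟨secs_apply_mem h, ?_⟩
  rw [hF.cls_eq_sum hY, hF.cls_eq_sum hZ, hF.cls_eq_sum h, coefMap_br hF.frame hY.1 hZ.1]
  exact hF.weightedFrame.symbolBr_leading (m := Neg Δ x) e ((hF.mem_secs_iff hY.1).1 hY)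
    ((hF.mem_secs_iff hZ.1).1 hZ)

/-- The frame exhibits one such bilinear map, so the definition of `leviBracket` does not fall into
its default value zero. -/
theorem isLeviBracket : IsLeviBracket Δ x (leviBracket Δ x) := by
  have h : ∃ B, IsLeviBracket Δ x B := ⟨_, hF.isLeviBracket_symbolBr⟩
  rw [leviBracket, dif_pos h]
  exact h.choose_spec

theorem leviBracket_basis (a b : A) :
    leviBracket Δ x (e a) (e b) = ∑ c, if w c = w a + w b then
      germEval (extChartAt (𝓡 n) x x) (hF.frame.structureFun a b c) • e c else 0 := by
  obtain ⟨h, h1⟩ := hF.isLeviBracket (w a) (w b) (X a) (X b) (hF.mem a) (hF.mem b)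
  rw [hF.basis_eq a, hF.basis_eq b, h1,
    hF.cls_eq_sum (hF.br_mem_secs_add (hF.mem a) (hF.mem b)), hF.structureFun_eq]

theorem gradedBasis : GradedBasis (m := Neg Δ x) (negGr Δ x) (leviBracket Δ x) e w where
  pos := hF.pos
  mem a b := by
    obtain ⟨h, h1⟩ := hF.isLeviBracket (w a) (w b) (X a) (X b) (hF.mem a) (hF.mem b)
    rw [hF.basis_eq a, hF.basis_eq b, h1]
    exact Submodule.mem_iSup_of_mem (w a + w b)
      (Submodule.mem_iSup_of_mem rfl (LinearMap.mem_range_self _ _))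
  span d := by
    refine le_antisymm (iSup_le fun p => iSup_le fun hd => ?_) (Submodule.span_le.2 ?_)
    · rw [hF.range_lof]
      refine Submodule.span_mono ?_
      rintro v ⟨a, ha, rfl⟩
      exact ⟨a, by rw [hd, ha], rfl⟩
    · rintro v ⟨a, ha, rfl⟩
      refine Submodule.mem_iSup_of_mem (w a) (Submodule.mem_iSup_of_mem ha.symm ?_)
      rw [hF.range_lof]
      exact Submodule.subset_span ⟨a, rfl, rfl⟩

end IsFlagFrame

end Levi

/-! ### Weighted filtration and the embedding into the Tanaka algebra -/

section LeadingParts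

open Filter VectorField Module

variable {n : ℕ} {M : Type*} [TopologicalSpace M] [ChartedSpace (EuclideanSpace ℝ (Fin n)) M]
  [IsManifold (𝓡 n) ∞ M] {Δ : PlaneField n M} {x : M} {κ : ℕ} {A : Type} [Fintype A]
  [DecidableEq A] {X : A → VF n M} {w : A → ℕ}

theorem coefMap_iterBr (hV : IsFrameAt (extChartAt (𝓡 n) x x) fun a => rep x (X a))
    (l : List (LocVF (n := n) x)) : ∀ Y : LocVF (n := n) x,
      ∃ h : SmoothNear x (iterBr Y.1 (l.map Subtype.val)),
        coefMap hV ⟨iterBr Y.1 (l.map Subtype.val), h⟩ =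
          (l.map (coefMap hV)).foldl (tupleBr hV.ders hV.structureFun) (coefMap hV Y) := by
  induction l with
  | nil => exact fun Y => ⟨Y.2, rfl⟩
  | cons Z l ih =>
    intro Y
    obtain ⟨h, h1⟩ := ih ⟨br Y.1 Z.1, SmoothNear.br Y.2 Z.2⟩
    refine ⟨h, h1.trans ?_⟩
    rw [coefMap_br hV Y.2 Z.2]
    rfl

theorem exists_quotient_injective {P ι m : Type*} [AddCommGroup P] [Module ℝ P] [AddCommGroup m]
    [Module ℝ m] {S : Submodule ℝ (ι → m)} {N : Submodule ℝ P} (φ : P →ₗ[ℝ] S)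
    (h : ∀ v, φ v = 0 ↔ v ∈ N) : ∃ f : P ⧸ N →ₗ[ℝ] S, Function.Injective f :=
  ⟨N.liftQ φ fun v hv => LinearMap.mem_ker.2 ((h v).2 hv), LinearMap.ker_eq_bot.1
    (Submodule.ker_liftQ_eq_bot _ _ _ fun v hv => (h v).1 hv)⟩

namespace IsFlagFrame

variable {e : Basis A ℝ (Neg Δ x)} (hF : IsFlagFrame Δ x κ X w e)
include hF

theorem apply_eq_zero_iff {Y : VF n M} (hY : SmoothNear x Y) :
    Y x = 0 ↔ ∀ a, germEval (extChartAt (𝓡 n) x x) (coefMap hF.frame ⟨Y, hY⟩ a) = 0 := by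
  rw [apply_eq_sum hF.frame hY]
  constructor
  · exact Fintype.linearIndependent_iff.1 hF.toIsAdapted.linearIndependent _
  · intro h
    exact Finset.sum_eq_zero fun a _ => by rw [h, zero_smul]

theorem mem_secs_of_weight_one {a : A} (ha : w a = 1) : X a ∈ secs Δ x := by
  have := hF.mem a
  rw [ha] at this
  exact this

/-- Brackets with arbitrary sections of Δ lose one order each; conversely, testing with the frame
fields of weight one recovers the order. -/
theorem mem_wvan_iff {Y : VF n M} (hY : SmoothNear x Y) {i : ℕ} : Y ∈ wvan Δ x i ↔
    ∀ c, coefMap hF.frame ⟨Y, hY⟩ c ∈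
      wOrd (germEval (extChartAt (𝓡 n) x x)) hF.frame.ders w (i + 1) := by
  constructor
  · intro h
    refine hF.weightedFrame.mem_wOrd_of_eval_foldl fun l hl hlw => ?_
    obtain ⟨h1, h2⟩ := coefMap_iterBr hF.frame
      (l.map fun a => (⟨X a, hF.smooth a⟩ : LocVF (n := n) x)) ⟨Y, hY⟩
    have h3 := h.2 ((l.map fun a => (⟨X a, hF.smooth a⟩ : LocVF (n := n) x)).map Subtype.val)
      (by simpa using hl) (by
        simp only [List.map_map, List.mem_map, Function.comp_apply]
        rintro _ ⟨a, ha, rfl⟩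
        exact hF.mem_secs_of_weight_one (hlw a ha))
    rw [hF.apply_eq_zero_iff h1, h2, List.map_map] at h3
    have h4 : (coefMap hF.frame ∘ fun a => (⟨X a, hF.smooth a⟩ : LocVF (n := n) x)) =
        fun a => Pi.single a 1 := funext hF.coefMap_frame
    rwa [h4] at h3
  · refine fun h => ⟨hY, fun l hl hls => ?_⟩
    lift l to List (LocVF (n := n) x) using fun Z hZ => (hls Z hZ).1
    obtain ⟨h1, h2⟩ := coefMap_iterBr hF.frame l ⟨Y, hY⟩
    rw [hF.apply_eq_zero_iff h1, h2]
    refine hF.weightedFrame.eval_foldl_tupleBr (i := i) _ (by simpa using hl) ?_ h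
    intro y hy b hb
    obtain ⟨Z, hZ, rfl⟩ := List.mem_map.1 hy
    have h3 : Z.1 ∈ secs (flag Δ 1) x := hls Z.1 (List.mem_map_of_mem hZ)
    have := hF.pos b
    exact (hF.mem_secs_iff Z.2).1 h3 b (by omega)

theorem van_le_wvan (j : ℕ) : van x j ≤ wvan Δ x j := fun _ hY =>
  (hF.mem_wvan_iff hY.1).2 fun c =>
    jOrd_le_wOrd hF.pos (j + 1) ((mem_van_iff hF.frame hY.1).1 hY c)

theorem wvan_le_van (j : ℕ) : wvan Δ x (j * κ) ≤ van x j := fun _ hY =>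
  (mem_van_iff hF.frame hY.1).2 fun c =>
    wOrd_le_jOrd hF.le j ((hF.mem_wvan_iff hY.1).1 hY c)

/-- The equation writes the bracket with `X b` as a section of Δ_{w b}, which has no component `c`
of larger weight, plus a field vanishing to order `k`. Changing `Y` within its `(k + 1)`-jet changes
the bracket by another such field. -/
theorem tupleBr_mem_jOrd {k : ℕ} {Y : VF n M} (hY : SmoothNear x Y)
    (h : Y ∈ lieEqn Δ x k ⊔ van x (k + 1)) (b c : A) (hbc : w b < w c) :
    tupleBr hF.frame.ders hF.frame.structureFun (coefMap hF.frame ⟨Y, hY⟩) (Pi.single b 1) c ∈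
      jOrd (germEval (extChartAt (𝓡 n) x x)) hF.frame.ders (k + 1) := by
  obtain ⟨Y₁, h1, Y₂, h2, rfl⟩ := Submodule.mem_sup.1 h
  have h3 : coefMap hF.frame ⟨Y₁ + Y₂, hY⟩ =
      coefMap hF.frame ⟨Y₁, h1.1⟩ + coefMap hF.frame ⟨Y₂, h2.1⟩ :=
    map_add (coefMap hF.frame) ⟨Y₁, h1.1⟩ ⟨Y₂, h2.1⟩
  have h4 : tupleBr hF.frame.ders hF.frame.structureFun (coefMap hF.frame ⟨Y₁, h1.1⟩)
      (Pi.single b 1) c ∈ jOrd (germEval (extChartAt (𝓡 n) x x)) hF.frame.ders (k + 1) := by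
    rw [← hF.coefMap_frame b, ← coefMap_br hF.frame h1.1 (hF.smooth b)]
    obtain ⟨S, hS, T, hT, hST⟩ := Submodule.mem_sup.1 (h1.2 (w b) (X b) (hF.mem b))
    have h5 : (⟨br Y₁ (X b), h1.1.br (hF.smooth b)⟩ : LocVF (n := n) x) =
        ⟨S, hS.1⟩ + ⟨T, hT.1⟩ := Subtype.ext hST.symm
    rw [h5, map_add, Pi.add_apply, (hF.mem_secs_iff hS.1).1 hS c hbc, zero_add]
    exact (mem_van_iff hF.frame hT.1).1 hT c
  have h5 := (mem_van_iff hF.frame h2.1).1 h2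
  rw [tupleBr_single] at h4 ⊢
  have h6 : ∑ a, coefMap hF.frame ⟨Y₂, h2.1⟩ a * hF.frame.structureFun a b c -
      hF.frame.ders b (coefMap hF.frame ⟨Y₂, h2.1⟩ c) ∈
        jOrd (germEval (extChartAt (𝓡 n) x x)) hF.frame.ders (k + 1) := by
    refine Ideal.sub_mem _ (Ideal.sum_mem _ fun a _ => ?_) (deriv_mem_wOrd (h5 c) b)
    exact Ideal.mul_mem_right _ _ (wOrd_anti (by omega) (h5 a))
  rw [h3]
  have h7 := Ideal.add_mem _ h4 h6
  convert h7 using 1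
  simp only [Pi.add_apply, add_mul, Finset.sum_add_distrib, map_add]
  ring

/-- The map `ρ` chooses representing fields linearly, so germs and infinite jets are treated at
once. The order `i + 1 + κ` is what raising the weighted order requires at level `i + 1`, where the
kernel is computed; level `i` needs one less. -/
theorem exists_leading {V : Type*} [AddCommGroup V] [Module ℝ V] (L : ℕ → Submodule ℝ V)
    (i : ℕ) (ρ : L i →ₗ[ℝ] LocVF (n := n) x) (hρ : ∀ v, (ρ v).1 ∈ wvan Δ x i)
    (hL : ∀ v, (ρ v).1 ∈ lieEqn Δ x (i + 1 + κ) ⊔ van x (i + 1 + κ + 1))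
    (hker : ∀ v : L i, (v : V) ∈ L (i + 1) ↔ (ρ v).1 ∈ wvan Δ x (i + 1)) :
    ∃ φ : L i →ₗ[ℝ] wordSymbol (m := Neg Δ x) (negGr Δ x) (leviBracket Δ x) e w i,
      ∀ v, φ v = 0 ↔ (v : V) ∈ L (i + 1) := by
  have H := hF.weightedFrame
  have hs : ∀ v b c, w b < w c → tupleBr hF.frame.ders hF.frame.structureFun
      (coefMap hF.frame (ρ v)) (Pi.single b 1) c ∈
        wOrd (germEval (extChartAt (𝓡 n) x x)) hF.frame.ders w (i + 1 + κ + 1) :=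
    fun v b c hbc => jOrd_le_wOrd hF.pos _ (hF.tupleBr_mem_jOrd (ρ v).2 (hL v) b c hbc)
  have hc : ∀ v c, coefMap hF.frame (ρ v) c ∈
      wOrd (germEval (extChartAt (𝓡 n) x x)) hF.frame.ders w (i + w c) := fun v =>
    H.mem_wOrd_add_weight (by omega) ((hF.mem_wvan_iff (ρ v).2).1 (hρ v)) (hs v)
  let lead : L i →ₗ[ℝ] List A → Neg Δ x :=
    ((WeightedFrame.leading (m := Neg Δ x) (germEval (extChartAt (𝓡 n) x x)) hF.frame.ders w
      e i).comp (coefMap hF.frame)).comp ρ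
  let leadS : L i →ₗ[ℝ] wordSymbol (m := Neg Δ x) (negGr Δ x) (leviBracket Δ x) e w i :=
    lead.codRestrict _ fun v => H.leading_mem_wordSymbol (m := Neg Δ x) hF.gradedBasis
      hF.leviBracket_basis (by omega) (hc v) (hs v)
  refine ⟨leadS, fun v => ?_⟩
  rw [hker]
  constructor
  · intro h
    exact (hF.mem_wvan_iff (ρ v).2).2
      (H.mem_wOrd_of_leading_eq_zero (m := Neg Δ x) (hc v) (congrArg Subtype.val h))
  · intro h
    refine Subtype.ext (WeightedFrame.leading_eq_zero (m := Neg Δ x) ?_)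
    exact H.mem_wOrd_add_weight le_rfl ((hF.mem_wvan_iff (ρ v).2).1 h) (hs v)

theorem exists_gr_injective {V : Type*} [AddCommGroup V] [Module ℝ V] (L : ℕ → Submodule ℝ V)
    (i : ℕ) (ρ : L i →ₗ[ℝ] LocVF (n := n) x) (hρ : ∀ v, (ρ v).1 ∈ wvan Δ x i)
    (hL : ∀ v, (ρ v).1 ∈ lieEqn Δ x (i + 1 + κ) ⊔ van x (i + 1 + κ + 1))
    (hker : ∀ v : L i, (v : V) ∈ L (i + 1) ↔ (ρ v).1 ∈ wvan Δ x (i + 1)) :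
    ∃ f : Gr L i →ₗ[ℝ] tanaka Δ x i, Function.Injective f := by
  have hg : ∃ g : wordSymbol (m := Neg Δ x) (negGr Δ x) (leviBracket Δ x) e w i →ₗ[ℝ] tanaka Δ x i,
      Function.Injective g :=
    GradedBasis.exists_wordSymbol_injective (m := Neg Δ x) hF.gradedBasis i
  obtain ⟨g, hg⟩ := hg
  obtain ⟨φ, hφ⟩ := hF.exists_leading L i ρ hρ hL hker
  have hq : ∃ q : Gr L i →ₗ[ℝ]
      wordSymbol (m := Neg Δ x) (negGr Δ x) (leviBracket Δ x) e w i, Function.Injective q :=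
    exists_quotient_injective (m := Neg Δ x) φ hφ
  obtain ⟨q, hq⟩ := hq
  exact ⟨g.comp q, hg.comp hq⟩

end IsFlagFrame

end LeadingParts

/-! ### Prolongation-projection and formal symmetries -/

section Jets

open Filter VectorField Module

variable {n : ℕ} {M : Type*} [TopologicalSpace M] [ChartedSpace (EuclideanSpace ℝ (Fin n)) M]
  [IsManifold (𝓡 n) ∞ M]

theorem jet_surjective (x : M) (k : ℕ) : Function.Surjective (jet n x k) :=
  Submodule.mkQ_surjective _

theorem jet_eq_iff {x : M} {k : ℕ} {Y Z : LocVF (n := n) x} :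
    jet n x k Y = jet n x k Z ↔ Y.1 - Z.1 ∈ van x k :=
  Submodule.Quotient.eq _

theorem jet_eq_zero_iff {x : M} {k : ℕ} {Y : LocVF (n := n) x} :
    jet n x k Y = 0 ↔ Y.1 ∈ van x k :=
  Submodule.Quotient.mk_eq_zero _

theorem proj_jet {x : M} {k l : ℕ} (h : k ≤ l) (Y : LocVF (n := n) x) :
    proj n x h (jet n x l Y) = jet n x k Y := rfl

theorem proj_proj {x : M} {k l r : ℕ} (h : k ≤ l) (h' : l ≤ r) (η : Jet (n := n) x r) :
    proj n x h (proj n x h' η) = proj n x (h.trans h') η := by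
  obtain ⟨Y, rfl⟩ := jet_surjective x r η
  rfl

theorem proj_self {x : M} {k : ℕ} (h : k ≤ k) (η : Jet (n := n) x k) : proj n x h η = η := by
  obtain ⟨Y, rfl⟩ := jet_surjective x k η
  rfl

/-- The partial derivatives at `x` up to order `k` of local vector fields. -/
def taylor (x : M) (k : ℕ) : LocVF (n := n) x →ₗ[ℝ] (t : Fin (k + 1)) →
    MultilinearMap ℝ (fun _ : Fin t => EuclideanSpace ℝ (Fin n)) (EuclideanSpace ℝ (Fin n)) where
  toFun Y t := (iteratedFDeriv ℝ t (rep x Y.1) (extChartAt (𝓡 n) x x)).toMultilinearMap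
  map_add' Y Z := by
    funext t
    change (iteratedFDeriv ℝ t (rep x (Y.1 + Z.1)) _).toMultilinearMap = _
    rw [rep_add, iteratedFDeriv_add_apply ((rep_contDiffAt Y.2).of_le (mod_cast le_top))
      ((rep_contDiffAt Z.2).of_le (mod_cast le_top))]
    rfl
  map_smul' c Y := by
    funext t
    change (iteratedFDeriv ℝ t (rep x (c • Y.1)) _).toMultilinearMap = _
    rw [rep_smul, iteratedFDeriv_const_smul_apply ((rep_contDiffAt Y.2).of_le (mod_cast le_top))]
    rfl

/-- Taylor coefficients embed jets in a finite-dimensional space; descending chains of jet subspaces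
therefore stabilize. -/
instance (x : M) (k : ℕ) : FiniteDimensional ℝ (Jet (n := n) x k) := by
  have h : ∀ Y : LocVF (n := n) x, taylor x k Y = 0 ↔ Y ∈ (van x k).submoduleOf (LocVF x) := by
    intro Y
    constructor
    · intro h
      refine ⟨Y.2, fun t ht => ?_⟩
      exact ContinuousMultilinearMap.toMultilinearMap_injective
        (congrFun h ⟨t, Nat.lt_succ_of_le ht⟩)
    · intro h
      funext t
      change (iteratedFDeriv ℝ t (rep x Y.1) _).toMultilinearMap = 0
      have h1 : iteratedFDeriv ℝ t (rep x Y.1) (extChartAt (𝓡 n) x x) = 0 :=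
        h.2 t (Nat.lt_succ_iff.1 t.2)
      rw [h1]
      rfl
  let f : Jet (n := n) x k →ₗ[ℝ] _ := ((van x k).submoduleOf (LocVF x)).liftQ (taylor x k)
    fun Y hY => LinearMap.mem_ker.2 ((h Y).2 hY)
  have hf : Function.Injective f := LinearMap.ker_eq_bot.1
    (Submodule.ker_liftQ_eq_bot _ _ _ fun Y hY => (h Y).1 hY)
  exact FiniteDimensional.of_injective f hf

variable {Δ : PlaneField n M} {x : M}

theorem lieEqn_anti {k l : ℕ} (h : k ≤ l) : lieEqn Δ x l ≤ lieEqn Δ x k := fun _ hY =>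
  ⟨hY.1, fun i Z hZ => sup_le_sup_left (van_anti x h) _ (hY.2 i Z hZ)⟩

theorem wvan_anti {i i' : ℕ} (h : i ≤ i') : wvan Δ x i' ≤ wvan Δ x i := fun _ hY =>
  ⟨hY.1, fun l hl => hY.2 l (hl.trans h)⟩

theorem map_proj_prolong_le {k l : ℕ} (h : k ≤ l) (i : ℕ) (hi : i ≤ k + 1) :
    (prolong Δ x l).map (proj n x (show i ≤ l + 1 by omega)) ≤
      (prolong Δ x k).map (proj n x hi) := by
  rintro _ ⟨_, ⟨Y, hY, rfl⟩, rfl⟩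
  exact ⟨jet n x (k + 1) Y, ⟨Y, lieEqn_anti h hY, rfl⟩, rfl⟩

theorem mem_ebar {i : ℕ} {η : Jet (n := n) x i} : η ∈ ebar Δ x i ↔
    ∀ k, ∀ h : i ≤ k + 1, η ∈ (prolong Δ x k).map (proj n x h) := by
  simp only [ebar, Submodule.mem_iInf]

theorem proj_mem_ebar {i l : ℕ} (h : i ≤ l) {η : Jet (n := n) x l} (hη : η ∈ ebar Δ x l) :
    proj n x h η ∈ ebar Δ x i := by
  refine mem_ebar.2 fun k hk => ?_
  obtain ⟨ζ, hζ, rfl⟩ := mem_ebar.1 hη (max k l) (by omega)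
  rw [proj_proj]
  exact map_proj_prolong_le (le_max_left k l) i hk ⟨ζ, hζ, rfl⟩

/-- The projections of the prolongations decrease with the order, so their infinite intersection is
attained at a finite stage. -/
theorem exists_map_proj_prolong_le_ebar (i : ℕ) :
    ∃ K, ∃ h : i ≤ K + 1, (prolong Δ x K).map (proj n x h) ≤ ebar Δ x i := by
  let f : ℕ →o (Submodule ℝ (Jet (n := n) x i))ᵒᵈ :=
    { toFun := fun k => OrderDual.toDual ((prolong Δ x (i + k)).map (proj n x (by omega)))
      monotone' := fun k l hkl => map_proj_prolong_le (by omega) i (by omega) }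
  obtain ⟨K, hK⟩ := IsArtinian.monotone_stabilizes f
  refine ⟨i + K, by omega, fun η hη => mem_ebar.2 fun k hk => ?_⟩
  have h1 : (prolong Δ x (i + K)).map (proj n x (show i ≤ i + K + 1 by omega)) =
      (prolong Δ x (i + max K k)).map (proj n x (by omega)) := hK (max K k) (le_max_left K k)
  rw [h1] at hη
  exact map_proj_prolong_le (by omega) i hk hη

/-- Mittag-Leffler: lift `η` to a prolongation so high that its projection to order `i + 1` already
lies in the intersection. -/
theorem exists_proj_eq {i : ℕ} {η : Jet (n := n) x i} (hη : η ∈ ebar Δ x i) :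
    ∃ ζ ∈ ebar Δ x (i + 1), proj n x (Nat.le_succ i) ζ = η := by
  obtain ⟨K, hK, h⟩ := exists_map_proj_prolong_le_ebar (Δ := Δ) (x := x) (i + 1)
  obtain ⟨θ, hθ, rfl⟩ := mem_ebar.1 hη K (by omega)
  exact ⟨_, h ⟨θ, hθ, rfl⟩, proj_proj _ _ _⟩

theorem exists_mem_ebarInf {i : ℕ} {η : Jet (n := n) x i} (hη : η ∈ ebar Δ x i) :
    ∃ ξ ∈ ebarInf Δ x, ξ i = η := by
  choose g hg hgp using fun (l : ℕ) (ζ : ebar Δ x l) => exists_proj_eq ζ.2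
  let ζ : (m : ℕ) → ebar Δ x (i + m) := fun m =>
    Nat.rec ⟨η, hη⟩ (fun m ζ => ⟨g (i + m) ζ, hg (i + m) ζ⟩) m
  have hζ : ∀ m, proj n x (Nat.le_succ (i + m)) (ζ (m + 1)).1 = (ζ m).1 := fun m =>
    hgp (i + m) (ζ m)
  have hζi : ∀ m, proj n x (Nat.le_add_right i m) (ζ m).1 = η := by
    intro m
    induction m with
    | zero => exact proj_self _ _
    | succ m ih =>
      rw [← ih, ← hζ m, proj_proj]
  refine ⟨fun k => proj n x (Nat.le_add_left k i) (ζ k).1, ⟨fun k => ?_, fun k => ?_⟩, hζi i⟩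
  · change proj n x _ (proj n x _ (ζ (k + 1)).1) = proj n x _ (ζ k).1
    rw [proj_proj, ← hζ k, proj_proj]
  · exact proj_mem_ebar _ (ζ k).2

theorem proj_of_mem_ebarInf {ξ : JetSeq n x} (hξ : ξ ∈ ebarInf Δ x) {k l : ℕ} (h : k ≤ l) :
    proj n x h (ξ l) = ξ k := by
  induction l, h using Nat.le_induction with
  | base => exact proj_self _ _
  | succ l h ih => rw [← ih, ← hξ.1 l, proj_proj]

/-- Surjectivity of the projections extends each element of the Spencer symbol to an infinite jet,
and its `j`-jet is automatically zero. -/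
theorem spencer_succ_eq (j : ℕ) :
    spencer Δ x (j + 1) = (formalJet Δ x j).map (toJet n x (j + 1)) := by
  ext η
  constructor
  · rintro ⟨h1, h2⟩
    obtain ⟨ξ, hξ, rfl⟩ := exists_mem_ebarInf h1
    refine ⟨ξ, ⟨hξ, ?_⟩, rfl⟩
    change ξ j = 0
    rw [← hξ.1 j]
    exact h2
  · rintro ⟨ξ, ⟨hξ, h⟩, rfl⟩
    refine ⟨hξ.2 _, ?_⟩
    change proj n x _ (ξ (j + 1)) = 0
    rw [hξ.1 j]
    exact h

theorem nonempty_quotient_equiv_map {V W : Type*} [AddCommGroup V] [Module ℝ V] [AddCommGroup W]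
    [Module ℝ W] (f : V →ₗ[ℝ] W) (P N : Submodule ℝ V) (h : ∀ v ∈ P, f v = 0 ↔ v ∈ N) :
    Nonempty ((P ⧸ N.submoduleOf P) ≃ₗ[ℝ] P.map f) := by
  have h1 : N.submoduleOf P = LinearMap.ker (f.domRestrict P) := by
    ext v
    exact (h v v.2).symm
  refine ⟨(Submodule.quotEquivOfEq _ _ h1).trans ((LinearMap.quotKerEquivRange _).trans
    (LinearEquiv.ofEq _ _ ?_))⟩
  rw [LinearMap.range_domRestrict]

theorem nonempty_gr_equiv_spencer (j : ℕ) :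
    Nonempty (Gr (V := JetSeq n x) (formalJet Δ x) j ≃ₗ[ℝ] spencer Δ x (j + 1)) := by
  rw [spencer_succ_eq]
  refine nonempty_quotient_equiv_map _ _ _ fun ξ hξ => ?_
  exact ⟨fun h => ⟨hξ.1, h⟩, fun h => h.2⟩

theorem mem_formalJet_iff {ξ : JetSeq n x} (hξ : ξ ∈ ebarInf Δ x) {j N : ℕ} (hj : j ≤ N)
    {Y : LocVF (n := n) x} (hY : jet n x N Y = ξ N) : ξ ∈ formalJet Δ x j ↔ Y.1 ∈ van x j := by
  rw [← jet_eq_zero_iff, ← proj_jet hj, hY, proj_of_mem_ebarInf hξ]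
  exact ⟨fun h => h.2, fun h => ⟨hξ, h⟩⟩

end Jets

/-! ### The two filtrations for germs and for infinite jets -/

section Comparison

open Module

variable {n : ℕ} {M : Type u} [TopologicalSpace M] [ChartedSpace (EuclideanSpace ℝ (Fin n)) M]
  [IsManifold (𝓡 n) ∞ M] {Δ : PlaneField n M} {x : M} {κ : ℕ} {A : Type} [Fintype A]
  [DecidableEq A] {X : A → VF n M} {w : A → ℕ}

namespace IsFlagFrame

variable {e : Basis A ℝ (Neg Δ x)} (hF : IsFlagFrame Δ x κ X w e)
include hF

theorem comparable_sym : ComparableFiltrations (V := VF n M) (symWt Δ x) (symJet Δ x) κ where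
  antiA _ _ h := inf_le_inf_left _ (wvan_anti h)
  antiB _ _ h := inf_le_inf_left _ (van_anti x h)
  zero_le := inf_le_inf_left _ (by simpa using hF.wvan_le_van 0)
  le j := inf_le_inf_left _ (hF.van_le_wvan j)
  ge j := inf_le_inf_left _ (hF.wvan_le_van (j + 1))

theorem exists_symG_injective (i : ℕ) :
    ∃ f : symG Δ x i →ₗ[ℝ] tanaka Δ x i, Function.Injective f := by
  refine hF.exists_gr_injective (symWt Δ x) i
    ((symWt Δ x i).subtype.codRestrict (LocVF x) fun v => v.2.1.1) (fun v => v.2.2)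
    (fun v => Submodule.mem_sup_left (hF.sym_le_lieEqn _ v.2.1)) fun v => ?_
  exact ⟨fun h => h.2, fun h => ⟨v.2.1, h⟩⟩

theorem jet_mem_ebarInf {Y : VF n M} (hY : Y ∈ sym Δ x) :
    (fun k => jet n x k ⟨Y, hY.1⟩) ∈ ebarInf Δ x :=
  ⟨fun _ => rfl, fun _ => mem_ebar.2 fun _ _ => ⟨_, ⟨⟨Y, hY.1⟩, hF.sym_le_lieEqn _ hY, rfl⟩, rfl⟩⟩

/-- Two representatives of an `i`-jet differ by a field vanishing to order `i`, which lies in `wvan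
Δ x i`; so any representative of any higher jet may be tested. -/
theorem mem_formalWt_iff {ξ : JetSeq n x} (hξ : ξ ∈ ebarInf Δ x) {i N : ℕ} (hi : i ≤ N)
    {Y : LocVF (n := n) x} (hY : jet n x N Y = ξ N) :
    ξ ∈ formalWt Δ x i ↔ Y.1 ∈ wvan Δ x i := by
  have h1 : jet n x i Y = ξ i := by
    rw [← proj_jet hi, hY, proj_of_mem_ebarInf hξ]
  constructor
  · rintro ⟨-, Z, hZ, hZY⟩
    have h2 : jet n x i Y = jet n x i Z := h1.trans hZY.symm
    have h3 := Submodule.add_mem _ (hF.van_le_wvan i (jet_eq_iff.1 h2)) hZ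
    simpa using h3
  · exact fun h => ⟨hξ, Y, h, h1⟩

theorem comparable_formal :
    ComparableFiltrations (V := JetSeq n x) (formalWt Δ x) (formalJet Δ x) κ where
  antiA i i' h := by
    rintro ξ hξ
    obtain ⟨Y, hY⟩ := jet_surjective x i' (ξ i')
    exact (hF.mem_formalWt_iff hξ.1 h hY).2
      (wvan_anti h ((hF.mem_formalWt_iff hξ.1 le_rfl hY).1 hξ))
  antiB j j' h := by
    rintro ξ hξ
    obtain ⟨Y, hY⟩ := jet_surjective x j' (ξ j')
    exact (mem_formalJet_iff hξ.1 h hY).2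
      (van_anti x h ((mem_formalJet_iff hξ.1 le_rfl hY).1 hξ))
  zero_le := by
    rintro ξ hξ
    obtain ⟨Y, hY⟩ := jet_surjective x 0 (ξ 0)
    refine (mem_formalJet_iff hξ.1 le_rfl hY).2 (hF.wvan_le_van 0 ?_)
    rw [zero_mul]
    exact (hF.mem_formalWt_iff hξ.1 le_rfl hY).1 hξ
  le j := by
    rintro ξ hξ
    obtain ⟨Y, hY⟩ := jet_surjective x j (ξ j)
    exact (hF.mem_formalWt_iff hξ.1 le_rfl hY).2
      (hF.van_le_wvan j ((mem_formalJet_iff hξ.1 le_rfl hY).1 hξ))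
  ge j := by
    rintro ξ hξ
    -- The representative must serve both orders, and for `κ = 0` the first would be too small.
    obtain ⟨Y, hY⟩ := jet_surjective x (max ((j + 1) * κ) (j + 1)) (ξ _)
    exact (mem_formalJet_iff hξ.1 (le_max_right _ _) hY).2
      (hF.wvan_le_van (j + 1) ((hF.mem_formalWt_iff hξ.1 (le_max_left _ _) hY).1 hξ))

theorem exists_formalG_injective (i : ℕ) :
    ∃ f : formalG Δ x i →ₗ[ℝ] tanaka Δ x i, Function.Injective f := by
  -- A linear section of the jet map provides `ρ`: the represented jet lies in the prolongation of
  -- order `i + 1 + κ`, so the field solves the equation up to a field with zero jet of that order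
  -- plus one.
  obtain ⟨s, hs⟩ := (jet n x (i + 1 + κ + 1)).exists_rightInverse_of_surjective
    (LinearMap.range_eq_top.2 (jet_surjective x _))
  have hsj : ∀ η, jet n x (i + 1 + κ + 1) (s η) = η := fun η => LinearMap.congr_fun hs η
  refine hF.exists_gr_injective (formalWt Δ x) i
    ((s.comp (toJet n x (i + 1 + κ + 1))).comp (formalWt Δ x i).subtype) (fun ξ => ?_)
    (fun ξ => ?_) fun ξ => ?_
  · exact (hF.mem_formalWt_iff ξ.2.1 (by omega) (hsj _)).1 ξ.2
  · obtain ⟨_, ⟨Z, hZ, rfl⟩, h⟩ := mem_ebar.1 (ξ.2.1.2 (i + 1 + κ + 1)) (i + 1 + κ) le_rfl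
    rw [proj_self] at h
    have h1 := jet_eq_iff.1 (h.trans (hsj (ξ.1 (i + 1 + κ + 1))).symm).symm
    have h2 := Submodule.add_mem_sup (S := lieEqn Δ x (i + 1 + κ)) hZ h1
    simpa using h2
  · exact hF.mem_formalWt_iff ξ.2.1 (by omega) (hsj _)

theorem nonempty_spencer_equiv (j : ℕ) :
    Nonempty (spencer Δ x (j + 1) ≃ₗ[ℝ] ⨁ i : {i : ℕ // j ≤ i}, formalH Δ x i j) := by
  obtain ⟨f⟩ := nonempty_gr_equiv_spencer (Δ := Δ) (x := x) j
  obtain ⟨g⟩ := hF.comparable_formal.nonempty_grB_equiv j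
  exact ⟨f.symm.trans g⟩

theorem sum_rank_symS_le :
    Cardinal.lift.{0} (Cardinal.sum fun i : ℕ => Module.rank ℝ (symS Δ x i)) ≤
      Cardinal.lift.{u} (Cardinal.sum fun j : ℕ => Module.rank ℝ (tanaka Δ x j)) :=
  hF.comparable_sym.sum_rank_le (T := fun i => tanaka Δ x i) hF.exists_symG_injective

theorem sum_rank_spencer_le :
    Cardinal.lift.{0} (Cardinal.sum fun i : ℕ => Module.rank ℝ (spencer Δ x (i + 1))) ≤
      Cardinal.lift.{u} (Cardinal.sum fun j : ℕ => Module.rank ℝ (tanaka Δ x j)) := by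
  have h : ∀ i, Module.rank ℝ (spencer Δ x (i + 1)) =
      Module.rank ℝ (Gr (V := JetSeq n x) (formalJet Δ x) i) := fun i => by
    obtain ⟨f⟩ := nonempty_gr_equiv_spencer (Δ := Δ) (x := x) i
    exact f.symm.rank_eq
  simp only [h]
  exact hF.comparable_formal.sum_rank_le (T := fun i => tanaka Δ x i) hF.exists_formalG_injective

theorem exists_directSum_symS_injective :
    ∃ f : (⨁ j : ℕ, symS Δ x j) →ₗ[ℝ] ⨁ i : ℕ, tanaka Δ x i, Function.Injective f :=
  exists_injective_directSum (S := fun j => symS Δ x j) (T := fun i => tanaka Δ x i)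
    hF.sum_rank_symS_le

theorem exists_directSum_spencer_injective :
    ∃ f : (⨁ j : ℕ, spencer Δ x (j + 1)) →ₗ[ℝ] ⨁ i : ℕ, tanaka Δ x i, Function.Injective f :=
  exists_injective_directSum (S := fun j => spencer Δ x (j + 1)) (T := fun i => tanaka Δ x i)
    hF.sum_rank_spencer_le

end IsFlagFrame

end Comparison

end WeakFlag

end

open WeakFlag in
theorem mainTheorem8 {n : ℕ} {M : Type u} [TopologicalSpace M]
    [ChartedSpace (EuclideanSpace ℝ (Fin n)) M] [IsManifold (𝓡 n) ∞ M]
    (Δ : PlaneField n M) (hΔ : IsDistribution Δ) (hreg : IsRegular Δ)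
    (κ : ℕ) (hκ : ∀ y, flag Δ κ y = ⊤) (x : M) :
    -- the prolongation-projection `Ē` of the Lie equation of the weak derived flag
    ((∀ i, Nonempty (formalG Δ x i ≃ₗ[ℝ] ⨁ j : {j : ℕ // j ≤ i}, formalH Δ x i j)) ∧
      (∀ j, spencer Δ x (j + 1) = (formalJet Δ x j).map (toJet n x (j + 1))) ∧
      (∀ j, Nonempty (spencer Δ x (j + 1) ≃ₗ[ℝ] ⨁ i : {i : ℕ // j ≤ i}, formalH Δ x i j)) ∧
      (∀ i j, (i < j ∨ (j + 1) * κ ≤ i) → Subsingleton (formalH Δ x i j)) ∧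
      (∀ i, ∃ f : formalG Δ x i →ₗ[ℝ] tanaka Δ x i, Function.Injective f) ∧
      (∃ f : (⨁ j : ℕ, spencer Δ x (j + 1)) →ₗ[ℝ] ⨁ i : ℕ, tanaka Δ x i,
        Function.Injective f) ∧
      Cardinal.lift.{0} (Cardinal.sum fun i : ℕ => Module.rank ℝ (spencer Δ x (i + 1))) ≤
        Cardinal.lift.{u} (Cardinal.sum fun j : ℕ => Module.rank ℝ (tanaka Δ x j))) ∧
    -- the stalk `L(x)` of germs of local symmetries
    ((∀ X, ∀ hX : X ∈ sym Δ x, (fun k => jet n x k ⟨X, hX.1⟩) ∈ ebarInf Δ x) ∧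
      (∀ i, Nonempty (symG Δ x i ≃ₗ[ℝ] ⨁ j : {j : ℕ // j ≤ i}, symH Δ x i j)) ∧
      (∀ j, Nonempty (symS Δ x j ≃ₗ[ℝ] ⨁ i : {i : ℕ // j ≤ i}, symH Δ x i j)) ∧
      (∀ i j, (i < j ∨ (j + 1) * κ ≤ i) → Subsingleton (symH Δ x i j)) ∧
      (∀ i, ∃ f : symG Δ x i →ₗ[ℝ] tanaka Δ x i, Function.Injective f) ∧
      (∃ f : (⨁ j : ℕ, symS Δ x j) →ₗ[ℝ] ⨁ i : ℕ, tanaka Δ x i, Function.Injective f) ∧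
      Cardinal.lift.{0} (Cardinal.sum fun i : ℕ => Module.rank ℝ (symS Δ x i)) ≤
        Cardinal.lift.{u} (Cardinal.sum fun j : ℕ => Module.rank ℝ (tanaka Δ x j))) := by

  have hF := exists_isFlagFrame hΔ hreg hκ x
  refine ⟨⟨?_, ?_, ?_, ?_, ?_, ?_, ?_⟩, ?_, ?_, ?_, ?_, ?_, ?_, ?_⟩ <;>
    obtain ⟨A, _, _, X, w, e, hF⟩ := hF
  · exact hF.comparable_formal.nonempty_grA_equiv
  · exact spencer_succ_eq
  · exact hF.nonempty_spencer_equiv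
  · exact hF.comparable_formal.subsingleton
  · exact hF.exists_formalG_injective
  · exact hF.exists_directSum_spencer_injective
  · exact hF.sum_rank_spencer_le
  · exact fun _ hX => hF.jet_mem_ebarInf hX
  · exact hF.comparable_sym.nonempty_grA_equiv
  · exact hF.comparable_sym.nonempty_grB_equiv
  · exact hF.comparable_sym.subsingleton
  · exact hF.exists_symG_injective
  · exact hF.exists_directSum_symS_injective
  · exact hF.sum_rank_symS_le
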